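/- **Setting.** On a probability space $(\Omega,\mathcal F,\mathbb P)$ let $T_1,\dots,T_n$ be i.i.d. with law $F$ and $C_1,\dots,C_n$ be i.i.d. with law $G$, where $F$ and $G$ are arbitrary probability laws on $(0,\infty)$ (atoms, also common ones, are allowed) and $(T_i)_{i}$ is independent of $(C_i)_{i}$. Put $X_i=\min(T_i,C_i)$, $\Delta_i=\mathbf 1_{\{T_i\le C_i\}}$, $N(t)=\sum_i \mathbf 1_{\{X_i\le t\}}\Delta_i$, $Y(t)=\sum_i\mathbf 1_{\{X_i\ge t\}}$, $S(t)=F((t,\infty))$, $S(t-)=F([t,\infty))$, $d\Lambda(t)=S(t-)^{-1}dF(t)$, and $M(t)=N(t)-\int_{(0,t]}Y(s)\,d\Lambda(s)$. Let $\mathcal F_t$ be the $\sigma$-algebra generated by the events $\{X_i\le s,\Delta_i=1\}$, $\{X_i\le s,\Delta_i=0\}$ ($s\le t$, $1\le i\le n$) and the $\mathbb P$-null sets of $\mathcal F$. Almost every path of $M$ has finite total variation; $dM$ denotes its signed Stieltjes measure, $|dM|$ the total variation measure of $dM$, and $|dM(x)dM(y)|=|dM|(dx)\,|dM|(dy)$.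 Recall that $M$ is a square-integrable $(\mathcal F_t)$-martingale with predictable variation $d\langle M\rangle(t)=(1-\Delta\Lambda(t))Y(t)\,d\Lambda(t)$, where $\Delta\Lambda(t)=\Lambda(\{t\})$. The two-time predictable $\sigma$-algebra $\mathcal P$ is generated by the sets $(a_1,b_1]\times(a_2,b_2]\times A$ with $0\le a_1\le b_1<a_2\le b_2$, $A\in\mathcal F_{a_2}$, and $\{0\}\times\{0\}\times A$ with $A\in\mathcal F_0$. A real process $h=(h(x,y):0<x<y<\infty)$ is $\mathcal P$-measurable if it is measurable for the trace of $\mathcal P$ on $\{0<x<y\}\times\Omega$. Put $C_t=\{(x,y):0<x<y\le t\}$. A process $W$ is a square-integrable martingale if it is a martingale with $\mathbb E\,W(t)^2<\infty$ for every $t\ge 0$; its predictable variation process $\langle W\rangle$ is the predictable, increasing, right-continuous process started at $0$ (these path properties holding almost surely) for which $W^2-\langle W\rangle$ is a martingale. **Theorem.** Let $h$ be $\mathcal P$-measurable and suppose that for all $t\ge0$ $$\mathbb E\Big(\int_{C_t}|h(x,y)|\,|dM(x)dM(y)|\Big)<\infty .$$ Then $$W(t)=\int_{C_t}h(x,y)\,dM(x)\,dM(y),\qquad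 t\ge 0,$$ is a martingale with respect to $(\mathcal F_t)_{t\ge0}$. If moreover, for all $t\ge0$, $$\mathbb E\Big(\int_{(0,t]}\Big(\int_{(0,y)}|h(x,y)|\,|dM(x)|\Big)^2 d\langle M\rangle(y)\Big)<\infty ,$$ then $W$ is a square-integrable $(\mathcal F_t)$-martingale, with predictable variation process $$\langle W\rangle(t)=\int_{(0,t]}\Big(\int_{(0,y)}h(x,y)\,dM(x)\Big)^2\frac{Y(y)\,S(y)}{S(y-)^2}\,dF(y).$$ -/

import Mathlib

open MeasureTheory ProbabilityTheory Set
open scoped NNReal ENNReal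

noncomputable section

namespace Censored

/-! ### Filtrations, predictability in two times, predictable variation -/

section General

variable {Ω : Type*} {mΩ : MeasurableSpace Ω}

/-- The two-time predictable σ-algebra on `[0,∞) × [0,∞) × Ω`, generated by the sets
`(a₁, b₁] × (a₂, b₂] × A` with `a₁ ≤ b₁ < a₂ ≤ b₂` and `A ∈ 𝓕 a₂`, and the sets `{0} × {0} × A` with
`A ∈ 𝓕 0`. -/
@[reducible]
def twoTimePredictable (𝓕 : Filtration ℝ≥0 mΩ) : MeasurableSpace (ℝ≥0 × ℝ≥0 × Ω) :=
  MeasurableSpace.generateFrom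
    ({s | ∃ (a₁ b₁ a₂ b₂ : ℝ≥0) (A : Set Ω), a₁ ≤ b₁ ∧ b₁ < a₂ ∧ a₂ ≤ b₂ ∧
        MeasurableSet[𝓕 a₂] A ∧ s = Ioc a₁ b₁ ×ˢ (Ioc a₂ b₂ ×ˢ A)} ∪
      {s | ∃ A : Set Ω, MeasurableSet[𝓕 0] A ∧ s = {0} ×ˢ ({0} ×ˢ A)})

/-- A process `h(x, y)`, indexed by the pairs with `0 < x < y`, is two-time predictable if it is
measurable for the trace of the two-time predictable σ-algebra on `{0 < x < y} × Ω`. The values of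
`h` at the other pairs play no role. -/
def IsTwoTimePredictable (𝓕 : Filtration ℝ≥0 mΩ) (h : ℝ≥0 → ℝ≥0 → Ω → ℝ) : Prop :=
  Measurable[(twoTimePredictable 𝓕).comap Subtype.val]
    fun q : {q : ℝ≥0 × ℝ≥0 × Ω // 0 < q.1 ∧ q.1 < q.2.1} => h q.1.1 q.1.2.1 q.1.2.2

/-- `V` is (a version of) the predictable variation process of `W`: it is predictable, almost all
its paths start at `0`, are increasing and right-continuous, and `W² - V` is a martingale. -/
structure IsPredictableVariation (𝓕 : Filtration ℝ≥0 mΩ) (P : Measure Ω)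
    (W V : ℝ≥0 → Ω → ℝ) : Prop where
  predictable : IsStronglyPredictable 𝓕 V
  zero : ∀ᵐ ω ∂P, V 0 ω = 0
  mono : ∀ᵐ ω ∂P, Monotone fun t => V t ω
  rightCont : ∀ᵐ ω ∂P, ∀ t, ContinuousWithinAt (fun s => V s ω) (Ici t) t
  martingale : Martingale (fun t ω => W t ω ^ 2 - V t ω) 𝓕 P

/-- `W` is a square-integrable martingale: a martingale with `E W(t)² < ∞` for every `t`. -/
def IsSquareIntegrableMartingale (𝓕 : Filtration ℝ≥0 mΩ) (P : Measure Ω)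
    (W : ℝ≥0 → Ω → ℝ) : Prop :=
  Martingale W 𝓕 P ∧ ∀ t, MemLp (W t) 2 P

end General

/-! ### The law of the survival times -/

/-- The survival function `S(x) = 1 - F(x)`. -/
def survival (F : Measure ℝ≥0) (x : ℝ≥0) : ℝ := F.real (Ioi x)

/-- The left limit `S(x-)` of the survival function. -/
def survivalLeft (F : Measure ℝ≥0) (x : ℝ≥0) : ℝ := F.real (Ici x)

/-- The cumulative hazard measure `dΛ(t) = S(t-)⁻¹ dF(t)` on `(0, ∞)`. -/
def hazard (F : Measure ℝ≥0) : Measure ℝ≥0 :=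
  (F.restrict (Ioi 0)).withDensity fun t => (F (Ici t))⁻¹

/-! ### Right-censored observations -/

section Data

variable {Ω : Type*} {mΩ : MeasurableSpace Ω} {n : ℕ}

/-- The observed time `Xᵢ = min(Tᵢ, Cᵢ)`. The observation is uncensored if `Tᵢ ≤ Cᵢ`. -/
def obsTime (T C : Fin n → Ω → ℝ≥0) (i : Fin n) (ω : Ω) : ℝ≥0 := min (T i ω) (C i ω)

/-- The filtration generated by the observed events `{Xᵢ ≤ s, Δᵢ = 1}` and `{Xᵢ ≤ s, Δᵢ = 0}`,
`s ≤ t`, together with the null sets of the underlying σ-algebra. -/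
def obsFiltration (P : Measure Ω) (T C : Fin n → Ω → ℝ≥0)
    (hT : ∀ i, Measurable (T i)) (hC : ∀ i, Measurable (C i)) : Filtration ℝ≥0 mΩ where
  seq t := MeasurableSpace.generateFrom
    ({A | ∃ i, ∃ s ≤ t, A = {ω | obsTime T C i ω ≤ s ∧ T i ω ≤ C i ω}} ∪
      {A | ∃ i, ∃ s ≤ t, A = {ω | obsTime T C i ω ≤ s ∧ ¬ T i ω ≤ C i ω}} ∪
      {A | MeasurableSet A ∧ P A = 0})
  mono' := by
    intro s t hst
    refine MeasurableSpace.generateFrom_mono ?_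
    refine union_subset_union (union_subset_union ?_ ?_) subset_rfl
    · rintro A ⟨i, r, hr, rfl⟩
      exact ⟨i, r, hr.trans hst, rfl⟩
    · rintro A ⟨i, r, hr, rfl⟩
      exact ⟨i, r, hr.trans hst, rfl⟩
  le' := by
    intro t
    refine MeasurableSpace.generateFrom_le ?_
    have hX : ∀ i r, MeasurableSet {ω | obsTime T C i ω ≤ r} := fun i r =>
      measurableSet_le ((hT i).min (hC i)) measurable_const
    have hD : ∀ i, MeasurableSet {ω | T i ω ≤ C i ω} := fun i => measurableSet_le (hT i) (hC i)
    rintro A ((⟨i, r, -, rfl⟩ | ⟨i, r, -, rfl⟩) | ⟨hA, -⟩)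
    · exact (hX i r).inter (hD i)
    · exact (hX i r).inter (hD i).compl
    · exact hA

/-- The pooled risk function `Y(t) = #{i : Xᵢ ≥ t}`. -/
def atRisk (T C : Fin n → Ω → ℝ≥0) (t : ℝ≥0) (ω : Ω) : ℕ :=
  ∑ i, if t ≤ obsTime T C i ω then 1 else 0

/-- The pooled counting process `N(t) = #{i : Xᵢ ≤ t, Δᵢ = 1}`. -/
def counting (T C : Fin n → Ω → ℝ≥0) (t : ℝ≥0) (ω : Ω) : ℕ :=
  ∑ i, if obsTime T C i ω ≤ t ∧ T i ω ≤ C i ω then 1 else 0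

/-- The pooled martingale `M(t) = N(t) - ∫_{(0,t]} Y(s) dΛ(s)`. -/
def pooledM (F : Measure ℝ≥0) (T C : Fin n → Ω → ℝ≥0) (t : ℝ≥0) (ω : Ω) : ℝ :=
  counting T C t ω - ∫ s in Ioc 0 t, (atRisk T C s ω : ℝ) ∂(hazard F)

/-- The measure `dN` along a path: a unit mass at every uncensored observation. -/
def countingMeasure (T C : Fin n → Ω → ℝ≥0) (ω : Ω) : Measure ℝ≥0 :=
  ∑ i, if T i ω ≤ C i ω then Measure.dirac (obsTime T C i ω) else 0

instance (T C : Fin n → Ω → ℝ≥0) (ω : Ω) : IsFiniteMeasure (countingMeasure T C ω) := by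
  constructor
  simp only [countingMeasure, Measure.coe_finsetSum, Finset.sum_apply]
  refine ENNReal.sum_lt_top.2 fun i _ => ?_
  split_ifs <;> simp

/-- The measure `Y dΛ` along a path. It is finite for almost every path. -/
def compensatorMeasure (F : Measure ℝ≥0) (T C : Fin n → Ω → ℝ≥0) (ω : Ω) : Measure ℝ≥0 :=
  (hazard F).withDensity fun s => (atRisk T C s ω : ℝ≥0∞)

open Classical in
/-- The signed measure `dM = dN - Y dΛ` along a path, `0` by convention on the null set of paths
for which `Y dΛ` has infinite mass. -/
def dM (F : Measure ℝ≥0) (T C : Fin n → Ω → ℝ≥0) (ω : Ω) : SignedMeasure ℝ≥0 :=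
  if h : IsFiniteMeasure (compensatorMeasure F T C ω) then
    (countingMeasure T C ω).toSignedMeasure -
      @Measure.toSignedMeasure _ _ (compensatorMeasure F T C ω) h
  else 0

/-- `dM` is the Stieltjes measure of the path of `M`. -/
theorem dM_Iic (F : Measure ℝ≥0) (T C : Fin n → Ω → ℝ≥0) (ω : Ω)
    (hA : IsFiniteMeasure (compensatorMeasure F T C ω)) (t : ℝ≥0) :
    dM F T C ω (Iic t) = pooledM F T C t ω := by
  classical
  have hY : Measurable fun s => (atRisk T C s ω : ℝ≥0∞) := by
    simp only [atRisk, Nat.cast_sum]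
    refine Finset.measurable_sum _ fun i _ => ?_
    refine (measurable_from_top (f := fun k : ℕ => (k : ℝ≥0∞))).comp ?_
    exact Measurable.ite (measurableSet_le measurable_id measurable_const)
      measurable_const measurable_const
  have h0 : hazard F {0} = 0 := by
    refine withDensity_absolutelyContinuous _ _ ?_
    simp
  have hI : compensatorMeasure F T C ω (Iic t) = compensatorMeasure F T C ω (Ioc 0 t) := by
    have hc : compensatorMeasure F T C ω {0} = 0 := withDensity_absolutelyContinuous _ _ h0
    refine le_antisymm ?_ (measure_mono Ioc_subset_Iic_self)
    calc compensatorMeasure F T C ω (Iic t)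
        ≤ compensatorMeasure F T C ω ({0} ∪ Ioc 0 t) := by
          refine measure_mono fun s hs => ?_
          rcases eq_or_ne s 0 with h | h
          · exact Or.inl h
          · exact Or.inr ⟨pos_iff_ne_zero.2 h, hs⟩
      _ ≤ _ := (measure_union_le _ _).trans (by simp [hc])
  have hN : (countingMeasure T C ω).real (Iic t) = counting T C t ω := by
    have : countingMeasure T C ω (Iic t) = (counting T C t ω : ℝ≥0∞) := by
      simp only [countingMeasure, counting, Measure.coe_finsetSum, Finset.sum_apply, Nat.cast_sum]
      refine Finset.sum_congr rfl fun i _ => ?_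
      by_cases h1 : T i ω ≤ C i ω <;> by_cases h2 : obsTime T C i ω ≤ t <;> simp [h1, h2]
    simp [Measure.real, this]
  have hC : (compensatorMeasure F T C ω).real (Iic t)
      = ∫ s in Ioc 0 t, (atRisk T C s ω : ℝ) ∂(hazard F) := by
    rw [Measure.real, hI, compensatorMeasure, withDensity_apply _ measurableSet_Ioc,
      ← integral_toReal hY.aemeasurable (by simp)]
    simp
  rw [dM, dif_pos hA, pooledM, ← hN, ← hC]
  simp [Measure.toSignedMeasure_apply_measurable measurableSet_Iic]

/-- The measure `d⟨M⟩ = (1 - ΔΛ) Y dΛ` along a path. -/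
def varM (F : Measure ℝ≥0) (T C : Fin n → Ω → ℝ≥0) (ω : Ω) : Measure ℝ≥0 :=
  (hazard F).withDensity fun y => (1 - hazard F {y}) * (atRisk T C y ω : ℝ≥0∞)

/-- The domain `C_t = {(x, y) : 0 < x < y ≤ t}`. -/
def domC (t : ℝ≥0) : Set (ℝ≥0 × ℝ≥0) := {p | 0 < p.1 ∧ p.1 < p.2 ∧ p.2 ≤ t}

/-- The double integral `W(t) = ∫_{C_t} h(x, y) dM(x) dM(y)`, taken path by path with respect to
the product of the signed measure `dM` with itself. -/
def doubleIntegral (F : Measure ℝ≥0) (T C : Fin n → Ω → ℝ≥0) (h : ℝ≥0 → ℝ≥0 → Ω → ℝ)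
    (t : ℝ≥0) (ω : Ω) : ℝ :=
  ∫ᵛ p in domC t, h p.1 p.2 ω
    ∂•((dM F T C ω).prod (dM F T C ω) (ContinuousLinearMap.mul ℝ ℝ))

/-- The process `∫_{(0,t]} (∫_{(0,y)} h(x, y) dM(x))² Y(y) S(y) / S(y-)² dF(y)`. -/
def doubleVariation (F : Measure ℝ≥0) (T C : Fin n → Ω → ℝ≥0) (h : ℝ≥0 → ℝ≥0 → Ω → ℝ)
    (t : ℝ≥0) (ω : Ω) : ℝ :=
  ∫ y in Ioc 0 t, (∫ᵛ x in Ioo 0 y, h x y ω ∂•(dM F T C ω)) ^ 2 *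
    ((atRisk T C y ω : ℝ) * survival F y / survivalLeft F y ^ 2) ∂F

end Data

end Censored

end

/-!
Along almost every path `W(t) = ∫_{(0,t]} H dM` with `H(y) = ∫_{(0,y)} h(x,y) dM(x)`, and `H` is
predictable because it only sees `dM` strictly before `y`.

Up to time `Xⱼ` a predictable process depends on `ω` only through the other individuals, and these,
together with `Cⱼ`, are independent of `Tⱼ`. Hence `E ∫ f dNⱼ = E ∫_{(0,Xⱼ]} f dΛ` for predictable
`f ≥ 0`, which makes the integral of a predictable process with finite absolute moment a martingale.

For bounded predictable `K`, expand `(∫ K dM)²` at the diagonal. The off-diagonal part has a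
predictable inner integral, hence mean zero, and the diagonal gives `E (∫ K dM)² = E ∫ K² d⟨M⟩`;
the factor `1 - ΔΛ` in `d⟨M⟩` comes from the common atoms of `dN` and of its compensator. Truncation
of `K` and completeness of `L²` extend the isometry to all `K` with both moments finite, and applied
to `K` times the indicator of `(s, t] × A`, `A ∈ 𝓕ₛ`, it identifies `⟨W⟩`, since
`(1 - ΔΛ) dΛ = S / S(·-)² dF`.
-/

noncomputable section

namespace Censored

section SignedDensity

variable {X : Type*} {mX : MeasurableSpace X} {μ : Measure X} {ρ : X → ℝ}

lemma integral_lsmul_toSignedMeasure [IsFiniteMeasure μ] (f : X → ℝ) :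
    ∫ᵛ x, f x ∂•μ.toSignedMeasure = ∫ x, f x ∂μ := by
  have hflip : (ContinuousLinearMap.lsmul ℝ ℝ : ℝ →L[ℝ] ℝ →L[ℝ] ℝ).flip =
      ContinuousLinearMap.lsmul ℝ ℝ := by ext; simp
  rw [← VectorMeasure.integral_toSignedMeasure, hflip]

instance (ν : SignedMeasure X) : IsFiniteMeasure ν.variation := by
  rw [← SignedMeasure.totalVariation_eq_variation]
  infer_instance

lemma enorm_integral_lsmul_le_lintegral_enorm (ν : SignedMeasure X) (f : X → ℝ) :
    ‖∫ᵛ x, f x ∂•ν‖ₑ ≤ ∫⁻ x, ‖f x‖ₑ ∂ν.variation := by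
  simpa [VectorMeasure.variation_transpose_lsmul] using
    VectorMeasure.enorm_integral_le_lintegral_enorm_transpose (μ := ν) (f := f)
      (B := ContinuousLinearMap.lsmul ℝ ℝ)

lemma enorm_setIntegral_lsmul_le_lintegral_enorm (ν : SignedMeasure X) (f : X → ℝ) (s : Set X) :
    ‖∫ᵛ x in s, f x ∂•ν‖ₑ ≤ ∫⁻ x in s, ‖f x‖ₑ ∂ν.variation := by
  simpa [VectorMeasure.variation_transpose_lsmul] using
    VectorMeasure.enorm_setIntegral_le_lintegral_enorm_transpose (μ := ν) (f := f) (s := s)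
      (B := ContinuousLinearMap.lsmul ℝ ℝ)

lemma integrable_withDensity_enorm_iff (hρ : Measurable ρ) (f : X → ℝ) :
    Integrable f (μ.withDensity fun x => ‖ρ x‖ₑ) ↔ Integrable (fun x => f x * ρ x) μ := by
  have hcast : Monotone ((↑) : SignType → ℝ) := by
    intro a b hab
    cases a <;> cases b <;> first | exact absurd hab (by decide) | norm_num
  have hmono : Monotone fun r : ℝ => (SignType.sign r : ℝ) := hcast.comp SignType.sign.monotone
  have hsign : AEStronglyMeasurable (fun x => (SignType.sign (ρ x) : ℝ)) μ :=
    (hmono.measurable.comp hρ).aestronglyMeasurable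
  have hbound : ∀ᵐ x ∂μ, ‖(SignType.sign (ρ x) : ℝ)‖ ≤ 1 := ae_of_all _ fun x => by
    cases SignType.sign (ρ x) <;> simp
  have habs (x : X) : (SignType.sign (ρ x) : ℝ) * (f x * ρ x) = ‖ρ x‖₊ • f x := by
    rw [mul_left_comm, sign_mul_self, NNReal.smul_def, coe_nnnorm, Real.norm_eq_abs, smul_eq_mul,
      mul_comm]
  have hself (x : X) : (SignType.sign (ρ x) : ℝ) * (‖ρ x‖₊ • f x) = f x * ρ x := by
    rw [NNReal.smul_def, coe_nnnorm, Real.norm_eq_abs, smul_eq_mul, ← mul_assoc, sign_mul_abs,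
      mul_comm]
  rw [show (fun x => ‖ρ x‖ₑ) = fun x => (‖ρ x‖₊ : ℝ≥0∞) from rfl,
    integrable_withDensity_iff_integrable_smul hρ.nnnorm]
  exact ⟨fun h => (h.bdd_mul hsign hbound).congr (ae_of_all _ hself),
    fun h => (h.bdd_mul hsign hbound).congr (ae_of_all _ habs)⟩

lemma integrable_withDensityᵥ_iff (hρ : Measurable ρ) (hρi : Integrable ρ μ) (f : X → ℝ) :
    (μ.withDensityᵥ ρ).Integrable f ↔ Integrable (fun x => f x * ρ x) μ := by
  rw [VectorMeasure.Integrable, Measure.variation_withDensityᵥ hρi,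
    integrable_withDensity_enorm_iff hρ]

lemma integral_withDensityᵥ_nnreal {σ : X → ℝ≥0} (hσ : Measurable σ)
    (hσi : Integrable (fun x => (σ x : ℝ)) μ) (f : X → ℝ) :
    ∫ᵛ x, f x ∂•(μ.withDensityᵥ fun x => (σ x : ℝ)) = ∫ x, f x * σ x ∂μ := by
  have hfin : ∫⁻ x, (σ x : ℝ≥0∞) ∂μ ≠ ∞ := by simpa using hσi.lintegral_lt_top.ne
  have : IsFiniteMeasure (μ.withDensity fun x => (σ x : ℝ≥0∞)) := isFiniteMeasure_withDensity hfin
  have hdens : (μ.withDensityᵥ fun x => (σ x : ℝ)) =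
      (μ.withDensity fun x => (σ x : ℝ≥0∞)).toSignedMeasure :=
    withDensityᵥ_toReal hσ.coe_nnreal_ennreal.aemeasurable hfin
  rw [hdens, integral_lsmul_toSignedMeasure, integral_withDensity_eq_integral_smul hσ]
  simp only [NNReal.smul_def, smul_eq_mul, mul_comm]

lemma integral_withDensityᵥ (hρ : Measurable ρ) (hρi : Integrable ρ μ) (f : X → ℝ) :
    ∫ᵛ x, f x ∂•(μ.withDensityᵥ ρ) = ∫ x, f x * ρ x ∂μ := by
  by_cases hf : Integrable (fun x => f x * ρ x) μ
  swap
  · rw [integral_undef hf,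
      VectorMeasure.integral_undef ((integrable_withDensityᵥ_iff hρ hρi f).not.2 hf)]
  have hpos : Measurable fun x => (ρ x).toNNReal := hρ.real_toNNReal
  have hneg : Measurable fun x => (-ρ x).toNNReal := hρ.neg.real_toNNReal
  have hposi : Integrable (fun x => ((ρ x).toNNReal : ℝ)) μ := hρi.real_toNNReal
  have hnegi : Integrable (fun x => ((-ρ x).toNNReal : ℝ)) μ := hρi.neg.real_toNNReal
  have hdecomp (x : X) : ((ρ x).toNNReal : ℝ) - (-ρ x).toNNReal = ρ x := by
    rw [Real.coe_toNNReal', Real.coe_toNNReal', max_zero_sub_eq_self]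
  have hdom {σ : X → ℝ≥0} (hσ : Measurable σ) (hle : ∀ x, (σ x : ℝ) ≤ |ρ x|) :
      Integrable (fun x => f x * σ x) μ := by
    have hf' := (integrable_withDensity_enorm_iff hρ f).2 hf
    refine (integrable_withDensity_enorm_iff hσ.coe_nnreal_real f).1 (hf'.mono_measure ?_)
    refine withDensity_mono (ae_of_all _ fun x => ?_)
    rw [enorm_le_iff_norm_le]
    simpa using hle x
  have hfpos := hdom hpos fun x => by simp [Real.coe_toNNReal', le_abs_self]
  have hfneg := hdom hneg fun x => by simp [Real.coe_toNNReal', neg_le_abs]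
  calc ∫ᵛ x, f x ∂•(μ.withDensityᵥ ρ)
      = ∫ᵛ x, f x ∂•((μ.withDensityᵥ fun x => ((ρ x).toNNReal : ℝ)) -
          μ.withDensityᵥ fun x => ((-ρ x).toNNReal : ℝ)) := by
        rw [← withDensityᵥ_sub' hposi hnegi]
        simp only [hdecomp]
    _ = ∫ x, f x * (ρ x).toNNReal ∂μ - ∫ x, f x * (-ρ x).toNNReal ∂μ := by
        rw [VectorMeasure.integral_sub_vectorMeasure
            ((integrable_withDensityᵥ_iff hpos.coe_nnreal_real hposi f).2 hfpos)
            ((integrable_withDensityᵥ_iff hneg.coe_nnreal_real hnegi f).2 hfneg),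
          integral_withDensityᵥ_nnreal hpos hposi, integral_withDensityᵥ_nnreal hneg hnegi]
    _ = ∫ x, f x * ρ x ∂μ := by
        rw [← integral_sub hfpos hfneg]
        simp only [← mul_sub, hdecomp]

lemma prod_withDensityᵥ {Y : Type*} {mY : MeasurableSpace Y} {ν : Measure Y} [SFinite μ]
    [SFinite ν] {σ : Y → ℝ} (hρ : Integrable ρ μ) (hσ : Integrable σ ν) :
    (μ.withDensityᵥ ρ).prod (ν.withDensityᵥ σ) (ContinuousLinearMap.mul ℝ ℝ) =
      (μ.prod ν).withDensityᵥ fun p => ρ p.1 * σ p.2 := by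
  refine VectorMeasure.prod_eq_of_forall_apply_prod fun s t hs ht => ?_
  rw [withDensityᵥ_apply (hρ.mul_prod hσ) (hs.prod ht), withDensityᵥ_apply hρ hs,
    withDensityᵥ_apply hσ ht, setIntegral_prod_mul]
  rfl

lemma integral_prod_withDensityᵥ_symm {Y : Type*} {mY : MeasurableSpace Y} {ν : Measure Y}
    [SFinite μ] [SFinite ν] {σ : Y → ℝ} (hρ : Measurable ρ) (hρi : Integrable ρ μ)
    (hσ : Measurable σ) (hσi : Integrable σ ν) {f : X × Y → ℝ}
    (hf : Integrable f ((μ.withDensityᵥ ρ).variation.prod (ν.withDensityᵥ σ).variation)) :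
    ∫ᵛ p, f p ∂•((μ.withDensityᵥ ρ).prod (ν.withDensityᵥ σ) (ContinuousLinearMap.mul ℝ ℝ)) =
      ∫ᵛ y, ∫ᵛ x, f (x, y) ∂•(μ.withDensityᵥ ρ) ∂•(ν.withDensityᵥ σ) := by
  have hρσ : Measurable fun p : X × Y => ρ p.1 * σ p.2 :=
    (hρ.comp measurable_fst).mul (hσ.comp measurable_snd)
  have hfi : Integrable (fun p : X × Y => f p * (ρ p.1 * σ p.2)) (μ.prod ν) := by
    rw [Measure.variation_withDensityᵥ hρi, Measure.variation_withDensityᵥ hσi,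
      prod_withDensity hρ.enorm hσ.enorm] at hf
    rw [← integrable_withDensity_enorm_iff hρσ]
    simpa only [enorm_mul] using hf
  rw [prod_withDensityᵥ hρi hσi, integral_withDensityᵥ hρσ (hρi.mul_prod hσi),
    integral_prod_symm _ hfi, integral_withDensityᵥ hσ hσi]
  simp only [integral_withDensityᵥ hρ hρi, ← integral_mul_const, mul_assoc]

end SignedDensity

section Martingale

variable {ι Ω : Type*} [Preorder ι] {mΩ : MeasurableSpace Ω} {P : Measure Ω}
  {𝓕 : Filtration ι mΩ} {V W : ι → Ω → ℝ}

lemma martingale_of_setIntegral_sub_eq_zero [SigmaFiniteFiltration P 𝓕]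
    (hW : ∀ t, StronglyMeasurable[𝓕 t] (W t)) (hWi : ∀ t, Integrable (W t) P)
    (h : ∀ s t, s ≤ t → ∀ A, MeasurableSet[𝓕 s] A → ∫ ω in A, (W t ω - W s ω) ∂P = 0) :
    Martingale W 𝓕 P := by
  refine ⟨hW, fun s t hst => ?_⟩
  refine (ae_eq_condExp_of_forall_setIntegral_eq (𝓕.le s) (hWi t)
    (fun A _ _ => (hWi s).integrableOn) (fun A hA _ => ?_) (hW s).aestronglyMeasurable).symm
  have hsub := h s t hst A hA
  rw [integral_sub (hWi t).integrableOn (hWi s).integrableOn] at hsub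
  exact (sub_eq_zero.1 hsub).symm

lemma integral_mul_sub_eq_zero_of_martingale [SigmaFiniteFiltration P 𝓕] (hW : Martingale W 𝓕 P)
    {s t : ι} (hst : s ≤ t) {f : Ω → ℝ} (hf : StronglyMeasurable[𝓕 s] f)
    (hi : Integrable (fun ω => f ω * (W t ω - W s ω)) P) :
    ∫ ω, f ω * (W t ω - W s ω) ∂P = 0 := by
  have hincr : P[W t - W s|𝓕 s] =ᵐ[P] 0 := by
    refine (condExp_sub (hW.integrable t) (hW.integrable s) _).trans ?_
    filter_upwards [hW.condExp_ae_eq hst, hW.condExp_ae_eq (le_refl s)] with ω ht hs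
    simp [ht, hs]
  have hpull : P[f * (W t - W s)|𝓕 s] =ᵐ[P] f * P[W t - W s|𝓕 s] :=
    condExp_mul_of_stronglyMeasurable_left hf hi ((hW.integrable t).sub (hW.integrable s))
  calc ∫ ω, f ω * (W t ω - W s ω) ∂P = ∫ ω, P[f * (W t - W s)|𝓕 s] ω ∂P :=
        (integral_condExp (𝓕.le s)).symm
    _ = 0 := integral_eq_zero_of_ae (by
        filter_upwards [hpull, hincr] with ω h₁ h₂
        simp [h₁, h₂])

lemma setIntegral_mul_sub_eq_zero_of_martingale [SigmaFiniteFiltration P 𝓕]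
    (hW : Martingale W 𝓕 P) (hW2 : ∀ t, MemLp (W t) 2 P) {s t : ι} (hst : s ≤ t) {A : Set Ω}
    (hA : MeasurableSet[𝓕 s] A) : ∫ ω in A, W s ω * (W t ω - W s ω) ∂P = 0 := by
  have hind : A.indicator (fun ω => W s ω * (W t ω - W s ω)) =
      fun ω => A.indicator (W s) ω * (W t ω - W s ω) :=
    funext fun ω => indicator_mul_left A (W s) _
  have hi : Integrable (fun ω => W s ω * (W t ω - W s ω)) P :=
    (hW2 s).integrable_mul ((hW2 t).sub (hW2 s))
  rw [← integral_indicator (𝓕.le s A hA), hind]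
  exact integral_mul_sub_eq_zero_of_martingale hW hst ((hW.stronglyMeasurable s).indicator hA)
    (hind ▸ hi.indicator (𝓕.le s A hA))

lemma martingale_sq_sub [SigmaFiniteFiltration P 𝓕] (hW : Martingale W 𝓕 P)
    (hW2 : ∀ t, MemLp (W t) 2 P) (hV : ∀ t, StronglyMeasurable[𝓕 t] (V t))
    (hVi : ∀ t, Integrable (V t) P)
    (h : ∀ s t, s ≤ t → ∀ A, MeasurableSet[𝓕 s] A →
      ∫ ω in A, (W t ω - W s ω) ^ 2 ∂P = ∫ ω in A, (V t ω - V s ω) ∂P) :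
    Martingale (fun t ω => W t ω ^ 2 - V t ω) 𝓕 P := by
  refine martingale_of_setIntegral_sub_eq_zero
    (fun t => ((hW.stronglyMeasurable t).pow 2).sub (hV t))
    (fun t => (hW2 t).integrable_sq.sub (hVi t)) fun s t hst A hA => ?_
  have hcross : Integrable (fun ω => W s ω * (W t ω - W s ω)) P :=
    (hW2 s).integrable_mul ((hW2 t).sub (hW2 s))
  have hsq : Integrable (fun ω => (W t ω - W s ω) ^ 2) P := ((hW2 t).sub (hW2 s)).integrable_sq
  have hVsub : Integrable (fun ω => V t ω - V s ω) P := (hVi t).sub (hVi s)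
  have hdiff : Integrable (fun ω => (W t ω - W s ω) ^ 2 - (V t ω - V s ω)) P := hsq.sub hVsub
  calc ∫ ω in A, (W t ω ^ 2 - V t ω - (W s ω ^ 2 - V s ω)) ∂P
      = ∫ ω in A, ((W t ω - W s ω) ^ 2 - (V t ω - V s ω) + 2 * (W s ω * (W t ω - W s ω))) ∂P :=
        integral_congr_ae (ae_of_all _ fun ω => by ring)
    _ = ∫ ω in A, (W t ω - W s ω) ^ 2 ∂P - ∫ ω in A, (V t ω - V s ω) ∂P +
          2 * ∫ ω in A, W s ω * (W t ω - W s ω) ∂P := by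
        rw [integral_add hdiff.integrableOn (hcross.const_mul 2).integrableOn,
          integral_sub hsq.integrableOn hVsub.integrableOn, integral_const_mul]
    _ = 0 := by
        rw [h s t hst A hA, setIntegral_mul_sub_eq_zero_of_martingale hW hW2 hst hA]
        ring

end Martingale

section DistributionFunction

variable {α : Type*} [LinearOrder α] {mα : MeasurableSpace α} {ν : Measure α} {a : α}

lemma monotone_measureReal_Ioc (hν : ∀ t, ν (Ioc a t) ≠ ∞) :
    Monotone fun t => ν.real (Ioc a t) := fun _ t hst =>
  measureReal_mono (Ioc_subset_Ioc_right hst) (hν t)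

lemma iInter_Ioc_of_gt [DenselyOrdered α] [NoMaxOrder α] (a t : α) :
    ⋂ r > t, Ioc a r = Ioc a t := by
  ext x
  simp only [mem_iInter, mem_Ioc]
  refine ⟨fun h => ?_, fun hx r hr => ⟨hx.1, hx.2.trans hr.le⟩⟩
  obtain ⟨r, hr⟩ := exists_gt t
  exact ⟨(h r hr).1, le_of_forall_gt_imp_ge_of_dense fun r hr => (h r hr).2⟩

lemma continuousWithinAt_Ici_measureReal_Ioc [TopologicalSpace α] [OrderTopology α]
    [DenselyOrdered α] [NoMaxOrder α] [FirstCountableTopology α] [OpensMeasurableSpace α]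
    (hν : ∀ t, ν (Ioc a t) ≠ ∞) (t : α) :
    ContinuousWithinAt (fun t => ν.real (Ioc a t)) (Ici t) t := by
  obtain ⟨r, hr⟩ := exists_gt t
  have hlim := tendsto_measure_biInter_gt (μ := ν) (s := fun r => Ioc a r) (a := t)
    (fun r _ => measurableSet_Ioc.nullMeasurableSet)
    (fun _ _ _ hij => Ioc_subset_Ioc_right hij) ⟨r, hr, hν r⟩
  rw [iInter_Ioc_of_gt] at hlim
  rw [← continuousWithinAt_Ioi_iff_Ici]
  exact (ENNReal.tendsto_toReal (hν t)).comp hlim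

end DistributionFunction

section Measurability

variable {α β γ : Type*} {mα : MeasurableSpace α} {mγ : MeasurableSpace γ}

lemma measurable_indicator_of_restrict [Zero γ] {D : Set α} (hD : MeasurableSet D) {f : α → γ}
    (hf : Measurable (D.domRestrict f)) : Measurable (D.indicator f) := by
  classical
  rw [← piecewise_eq_indicator]
  refine measurable_of_restrict_of_restrict_compl hD ?_ ?_
  · rwa [domRestrict_piecewise]
  · rw [domRestrict_piecewise_compl]
    exact measurable_const

lemma measurable_indicator_comp_of_generateFrom [Zero γ] {D : Set α} (hD : MeasurableSet D)
    {g : α → β} {S : Set (Set β)} (hg : ∀ s ∈ S, MeasurableSet (D ∩ g ⁻¹' s)) {f : β → γ}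
    (hf : Measurable[MeasurableSpace.generateFrom S] f) :
    Measurable (D.indicator fun a => f (g a)) := by
  refine measurable_indicator_of_restrict hD ?_
  have hgD : Measurable[_, MeasurableSpace.generateFrom S] (D.domRestrict g) :=
    measurable_generateFrom fun s hs =>
      ⟨D ∩ g ⁻¹' s, hg s hs, Subtype.preimage_coe_self_inter D (g ⁻¹' s)⟩
  exact hf.comp hgD

lemma measurable_setLIntegral_comp_of_isPiSystem {X : Type*} [MeasurableSpace X] (μ : Measure X)
    [IsFiniteMeasure μ] {D : α → Set X} (hD : Measurable fun a => μ (D a)) {g : α → X → β}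
    {mβ : MeasurableSpace β} (hg : ∀ a, Measurable (g a)) {S : Set (Set β)}
    (hgen : mβ = MeasurableSpace.generateFrom S) (hpi : IsPiSystem S)
    (hS : ∀ s ∈ S, Measurable fun a => μ (g a ⁻¹' s ∩ D a)) {f : β → ℝ≥0∞} (hf : Measurable f) :
    Measurable fun a => ∫⁻ x in D a, f (g a x) ∂μ := by
  have hmap : ∀ a s, MeasurableSet s → (μ.restrict (D a)).map (g a) s = μ (g a ⁻¹' s ∩ D a) :=
    fun a s hs => by rw [Measure.map_apply (hg a) hs, Measure.restrict_apply (hg a hs)]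
  have hκ : Measurable fun a => (μ.restrict (D a)).map (g a) := by
    refine Measurable.measure_of_isPiSystem hgen hpi (fun s hs => ?_) ?_
    · simpa only [hmap _ s (hgen ▸ MeasurableSpace.measurableSet_generateFrom hs)] using hS s hs
    · simpa only [hmap _ univ MeasurableSet.univ, preimage_univ, univ_inter] using hD
  simpa only [Function.comp_def, lintegral_map hf (hg _)] using
    (Measure.measurable_lintegral hf).comp hκ

end Measurability

section Predictable

variable {Ω : Type*} {mΩ : MeasurableSpace Ω} {𝓕 : Filtration ℝ≥0 mΩ}

lemma exists_denseSeq_between {x y : ℝ≥0} (h : x < y) :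
    ∃ m, x < TopologicalSpace.denseSeq ℝ≥0 m ∧ TopologicalSpace.denseSeq ℝ≥0 m < y := by
  obtain ⟨_, ⟨m, rfl⟩, hm⟩ := (TopologicalSpace.denseRange_denseSeq ℝ≥0).exists_between h
  exact ⟨m, hm⟩

lemma predictable_le_prod : 𝓕.predictable ≤ (inferInstance : MeasurableSpace (ℝ≥0 × Ω)) :=
  measurableSpace_le_predictable_of_measurableSet
    (fun _ hA => (measurableSet_singleton _).prod (𝓕.le _ _ hA))
    (fun _ _ hA => measurableSet_Ioi.prod (𝓕.le _ _ hA))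

lemma measurable_fst_predictable : Measurable[𝓕.predictable] (Prod.fst : ℝ≥0 × Ω → ℝ≥0) := by
  refine measurable_of_Ioi fun a => ?_
  rw [← prod_univ]
  exact measurableSet_predictable_Ioi_prod MeasurableSet.univ

lemma measurable_prodMk_predictable (ω : Ω) :
    @Measurable _ _ _ 𝓕.predictable fun y : ℝ≥0 => (y, ω) :=
  measurable_prodMk_right.mono le_rfl predictable_le_prod

lemma isPiSystem_predictable :
    IsPiSystem ({s | ∃ A, MeasurableSet[𝓕 ⊥] A ∧ s = {⊥} ×ˢ A} ∪
      {s | ∃ i A, MeasurableSet[𝓕 i] A ∧ s = Ioi i ×ˢ A} : Set (Set (ℝ≥0 × Ω))) := by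
  rintro _ (⟨A, hA, rfl⟩ | ⟨i, A, hA, rfl⟩) _ (⟨B, hB, rfl⟩ | ⟨j, B, hB, rfl⟩) ⟨⟨y, ω⟩, h1, h2⟩
  · exact Or.inl ⟨A ∩ B, hA.inter hB, by rw [prod_inter_prod, inter_self]⟩
  · exact absurd (mem_Ioi.1 (mem_singleton_iff.1 h1.1 ▸ h2.1)) not_lt_bot
  · exact absurd (mem_Ioi.1 (mem_singleton_iff.1 h2.1 ▸ h1.1)) not_lt_bot
  · exact Or.inr ⟨max i j, A ∩ B, (𝓕.mono (le_max_left i j) _ hA).inter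
      (𝓕.mono (le_max_right i j) _ hB), by rw [prod_inter_prod, Ioi_inter_Ioi]⟩

lemma measurable_lintegral_Ioc_predictable (μ : Measure ℝ≥0) [IsFiniteMeasure μ]
    {g : ℝ≥0 × Ω → ℝ≥0∞} (hg : Measurable[𝓕.predictable] g) :
    Measurable[𝓕.predictable] fun p : ℝ≥0 × Ω => ∫⁻ y in Ioc 0 p.1, g (y, p.2) ∂μ := by
  have hIoc : ∀ a, Measurable[𝓕.predictable] fun p : ℝ≥0 × Ω => μ (Ioc a p.1) := fun a =>
    (Monotone.measurable (f := fun t => μ (Ioc a t)) fun _ _ h =>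
      measure_mono (Ioc_subset_Ioc_right h)).comp measurable_fst_predictable
  refine @measurable_setLIntegral_comp_of_isPiSystem _ _ 𝓕.predictable _ _ μ _ _ (hIoc 0) _
    𝓕.predictable (fun p => measurable_prodMk_predictable p.2) _ rfl isPiSystem_predictable ?_ g hg
  rintro s (⟨A, -, rfl⟩ | ⟨a, A, hA, rfl⟩)
  · have hempty : ∀ p : ℝ≥0 × Ω, (fun y => (y, p.2)) ⁻¹' ({⊥} ×ˢ A) ∩ Ioc 0 p.1 = ∅ := fun p =>
      eq_empty_of_forall_notMem fun y hy => hy.2.1.ne' (mem_singleton_iff.1 hy.1.1)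
    simp only [hempty, measure_empty, measurable_const]
  · have hind : (fun p : ℝ≥0 × Ω => μ ((fun y => (y, p.2)) ⁻¹' (Ioi a ×ˢ A) ∩ Ioc 0 p.1)) =
        (Ioi a ×ˢ A).indicator fun p => μ (Ioc a p.1) := by
      ext p
      by_cases hp : p ∈ Ioi a ×ˢ A
      · rw [indicator_of_mem hp]
        congr 1
        ext y
        exact ⟨fun h => ⟨h.1.1, h.2.2⟩, fun h => ⟨⟨h.1, hp.2⟩, zero_le.trans_lt h.1, h.2⟩⟩
      · rw [indicator_of_notMem hp]
        have : (fun y => (y, p.2)) ⁻¹' (Ioi a ×ˢ A) ∩ Ioc 0 p.1 = ∅ :=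
          eq_empty_of_forall_notMem fun y hy => hp ⟨hy.1.1.trans_le hy.2.2, hy.1.2⟩
        rw [this, measure_empty]
    rw [hind]
    exact (hIoc a).indicator (measurableSet_predictable_Ioi_prod hA)

lemma measurableSet_predictable_lt {τ : Ω → ℝ≥0} {E : Set Ω}
    (hτ : ∀ s, MeasurableSet[𝓕 s] {ω | τ ω ≤ s ∧ ω ∈ E}) :
    MeasurableSet[𝓕.predictable] {p : ℝ≥0 × Ω | τ p.2 < p.1 ∧ p.2 ∈ E} := by
  let d := TopologicalSpace.denseSeq ℝ≥0
  have hcover : {p : ℝ≥0 × Ω | τ p.2 < p.1 ∧ p.2 ∈ E} =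
      ⋃ m : ℕ, Ioi (d m) ×ˢ {ω | τ ω ≤ d m ∧ ω ∈ E} := by
    ext ⟨y, ω⟩
    simp only [mem_ofPred_eq, mem_iUnion, mem_prod, mem_Ioi]
    constructor
    · rintro ⟨hlt, hE⟩
      obtain ⟨m, hm, hm'⟩ := exists_denseSeq_between hlt
      exact ⟨m, hm', hm.le, hE⟩
    · rintro ⟨m, hm, hτm, hE⟩
      exact ⟨hτm.trans_lt hm, hE⟩
  rw [hcover]
  exact MeasurableSet.iUnion fun m => measurableSet_predictable_Ioi_prod (hτ _)

/-- The index domain `{0 < x < y} × Ω` of two-time processes. -/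
def orderedPairs (Ω : Type*) : Set (ℝ≥0 × ℝ≥0 × Ω) := {q | 0 < q.1 ∧ q.1 < q.2.1}

lemma twoTimePredictable_le_prod :
    twoTimePredictable 𝓕 ≤ (inferInstance : MeasurableSpace (ℝ≥0 × ℝ≥0 × Ω)) := by
  refine MeasurableSpace.generateFrom_le ?_
  rintro _ (⟨a₁, b₁, a₂, b₂, A, -, -, -, hA, rfl⟩ | ⟨A, hA, rfl⟩)
  · exact measurableSet_Ioc.prod (measurableSet_Ioc.prod (𝓕.le _ _ hA))
  · exact (measurableSet_singleton _).prod ((measurableSet_singleton _).prod (𝓕.le _ _ hA))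

lemma measurable_prodMk_twoTimePredictable (p : ℝ≥0 × Ω) :
    @Measurable _ _ _ (twoTimePredictable 𝓕) fun x : ℝ≥0 => (x, p) :=
  measurable_prodMk_right.mono le_rfl twoTimePredictable_le_prod

lemma measurableSet_twoTimePredictable_Ioc_prod {a₁ b₁ a₂ b₂ : ℝ≥0} (h : b₁ < a₂) {A : Set Ω}
    (hA : MeasurableSet[𝓕 a₂] A) :
    MeasurableSet[twoTimePredictable 𝓕] (Ioc a₁ b₁ ×ˢ (Ioc a₂ b₂ ×ˢ A)) := by
  rcases le_total b₁ a₁ with h₁ | h₁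
  · simp only [Ioc_eq_empty_of_le h₁, empty_prod, MeasurableSet.empty]
  rcases le_total b₂ a₂ with h₂ | h₂
  · simp only [Ioc_eq_empty_of_le h₂, empty_prod, prod_empty, MeasurableSet.empty]
  exact MeasurableSpace.measurableSet_generateFrom (Or.inl ⟨a₁, b₁, a₂, b₂, A, h₁, h, h₂, hA, rfl⟩)

lemma measurableSet_twoTimePredictable_lt {a b : ℝ≥0} {A : Set Ω}
    (hA : MeasurableSet[𝓕 (max a b)] A) :
    MeasurableSet[twoTimePredictable 𝓕]
      {q : ℝ≥0 × ℝ≥0 × Ω | a < q.1 ∧ q.1 < q.2.1 ∧ b < q.2.1 ∧ q.2.2 ∈ A} := by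
  let d := TopologicalSpace.denseSeq ℝ≥0
  have hcover : {q : ℝ≥0 × ℝ≥0 × Ω | a < q.1 ∧ q.1 < q.2.1 ∧ b < q.2.1 ∧ q.2.2 ∈ A} =
      ⋃ (m : ℕ) (k : ℕ) (l : ℕ) (_ : a ≤ d m) (_ : d m < d k),
        Ioc a (d m) ×ˢ (Ioc (max (d k) b) (d k + l) ×ˢ A) := by
    ext ⟨x, y, ω⟩
    simp only [mem_ofPred_eq, mem_iUnion, mem_prod, mem_Ioc, exists_prop, max_lt_iff]
    constructor
    · rintro ⟨hax, hxy, hby, hω⟩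
      obtain ⟨m, hxm, hmy⟩ := exists_denseSeq_between hxy
      obtain ⟨k, hmk, hky⟩ := exists_denseSeq_between hmy
      obtain ⟨l, hl⟩ := exists_nat_ge y
      exact ⟨m, k, l, (hax.trans hxm).le, hmk, ⟨hax, hxm.le⟩,
        ⟨⟨hky, hby⟩, hl.trans le_add_self⟩, hω⟩
    · rintro ⟨m, k, l, -, hmk, ⟨hax, hxm⟩, ⟨⟨hky, hby⟩, -⟩, hω⟩
      exact ⟨hax, hxm.trans_lt (hmk.trans hky), hby, hω⟩
  rw [hcover]
  refine MeasurableSet.iUnion fun m => MeasurableSet.iUnion fun k => MeasurableSet.iUnion fun l =>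
    MeasurableSet.iUnion fun hm => MeasurableSet.iUnion fun hk => ?_
  refine measurableSet_twoTimePredictable_Ioc_prod (hk.trans_le (le_max_left _ _)) ?_
  exact 𝓕.mono (max_le_max (hm.trans hk.le) le_rfl) _ hA

lemma measurableSet_orderedPairs :
    MeasurableSet[twoTimePredictable 𝓕] (orderedPairs Ω) := by
  convert measurableSet_twoTimePredictable_lt (𝓕 := 𝓕) (a := 0) (b := 0) MeasurableSet.univ using 1
  ext q
  exact ⟨fun h => ⟨h.1, h.2, h.1.trans h.2, mem_univ _⟩, fun h => ⟨h.1, h.2.1⟩⟩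

lemma measurable_orderedPairs_fst {β : Type*} [MeasurableSpace β] [Zero β] {f : ℝ≥0 × Ω → β}
    (hf : Measurable[𝓕.predictable] f) :
    Measurable[twoTimePredictable 𝓕] ((orderedPairs Ω).indicator fun q => f (q.1, q.2.2)) := by
  refine measurable_indicator_comp_of_generateFrom measurableSet_orderedPairs ?_ hf
  rintro s (⟨A, -, rfl⟩ | ⟨a, A, hA, rfl⟩)
  · convert @MeasurableSet.empty _ (twoTimePredictable 𝓕)
    exact eq_empty_of_forall_notMem fun q hq => not_lt_bot (mem_singleton_iff.1 hq.2.1 ▸ hq.1.1)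
  · convert measurableSet_twoTimePredictable_lt (𝓕 := 𝓕) (a := a) (b := 0) (A := A)
      (𝓕.mono (le_max_left _ _) _ hA) using 1
    ext q
    exact ⟨fun h => ⟨h.2.1, h.1.2, h.1.1.trans h.1.2, h.2.2⟩,
      fun h => ⟨⟨zero_le.trans_lt h.1, h.2.1⟩, h.1, h.2.2.2⟩⟩

lemma IsTwoTimePredictable.measurable_indicator {h : ℝ≥0 → ℝ≥0 → Ω → ℝ}
    (hh : IsTwoTimePredictable 𝓕 h) :
    Measurable[twoTimePredictable 𝓕]
      ((orderedPairs Ω).indicator fun q => h q.1 q.2.1 q.2.2) :=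
  measurable_indicator_of_restrict measurableSet_orderedPairs hh

lemma isPiSystem_twoTimePredictable :
    IsPiSystem ({s | ∃ (a₁ b₁ a₂ b₂ : ℝ≥0) (A : Set Ω), a₁ ≤ b₁ ∧ b₁ < a₂ ∧ a₂ ≤ b₂ ∧
        MeasurableSet[𝓕 a₂] A ∧ s = Ioc a₁ b₁ ×ˢ (Ioc a₂ b₂ ×ˢ A)} ∪
      {s | ∃ A : Set Ω, MeasurableSet[𝓕 0] A ∧ s = {0} ×ˢ ({0} ×ˢ A)} :
      Set (Set (ℝ≥0 × ℝ≥0 × Ω))) := by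
  rintro _ (⟨a₁, b₁, a₂, b₂, A, -, hba, -, hA, rfl⟩ | ⟨A, hA, rfl⟩) _
    (⟨c₁, d₁, c₂, d₂, B, -, -, -, hB, rfl⟩ | ⟨B, hB, rfl⟩) ⟨⟨x, y, ω⟩, h1, h2⟩
  · refine Or.inl ⟨max a₁ c₁, min b₁ d₁, max a₂ c₂, min b₂ d₂, A ∩ B, ?_, ?_, ?_, ?_, ?_⟩
    · exact (max_lt h1.1.1 h2.1.1).le.trans (le_min h1.1.2 h2.1.2)
    · exact (min_le_left _ _).trans_lt (hba.trans_le (le_max_left _ _))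
    · exact (max_lt h1.2.1.1 h2.2.1.1).le.trans (le_min h1.2.1.2 h2.2.1.2)
    · exact (𝓕.mono (le_max_left _ _) _ hA).inter (𝓕.mono (le_max_right _ _) _ hB)
    · rw [prod_inter_prod, prod_inter_prod, Ioc_inter_Ioc, Ioc_inter_Ioc]
  · exact absurd (mem_singleton_iff.1 h2.1 ▸ h1.1.1) not_lt_bot
  · exact absurd (mem_singleton_iff.1 h1.1 ▸ h2.1.1) not_lt_bot
  · exact Or.inr ⟨A ∩ B, hA.inter hB, by simp only [prod_inter_prod, inter_self]⟩

lemma measurable_lintegral_Ioo_predictable (μ : Measure ℝ≥0) [IsFiniteMeasure μ]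
    {f : ℝ≥0 × ℝ≥0 × Ω → ℝ≥0∞} (hf : Measurable[twoTimePredictable 𝓕] f) :
    Measurable[𝓕.predictable] fun p : ℝ≥0 × Ω => ∫⁻ x in Ioo 0 p.1, f (x, p) ∂μ := by
  have hIoo : Measurable[𝓕.predictable] fun p : ℝ≥0 × Ω => μ (Ioo 0 p.1) :=
    (Monotone.measurable (f := fun t => μ (Ioo 0 t)) fun _ _ h =>
      measure_mono (Ioo_subset_Ioo_right h)).comp measurable_fst_predictable
  refine @measurable_setLIntegral_comp_of_isPiSystem _ _ 𝓕.predictable _ _ μ _ _ hIoo _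
    (twoTimePredictable 𝓕) measurable_prodMk_twoTimePredictable _ rfl isPiSystem_twoTimePredictable
    ?_ f hf
  rintro s (⟨a₁, b₁, a₂, b₂, A, -, hba, -, hA, rfl⟩ | ⟨A, -, rfl⟩)
  · have hind : (fun p => μ ((fun x => (x, p)) ⁻¹' (Ioc a₁ b₁ ×ˢ (Ioc a₂ b₂ ×ˢ A)) ∩ Ioo 0 p.1)) =
        (Ioc a₂ b₂ ×ˢ A).indicator fun _ => μ (Ioc a₁ b₁) := by
      ext p
      by_cases hp : p ∈ Ioc a₂ b₂ ×ˢ A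
      · rw [indicator_of_mem hp]
        congr 1
        ext x
        exact ⟨fun h => h.1.1,
          fun h => ⟨⟨h, hp⟩, zero_le.trans_lt h.1, h.2.trans_lt (hba.trans hp.1.1)⟩⟩
      · rw [indicator_of_notMem hp]
        have : (fun x => (x, p)) ⁻¹' (Ioc a₁ b₁ ×ˢ (Ioc a₂ b₂ ×ˢ A)) ∩ Ioo 0 p.1 = ∅ :=
          eq_empty_of_forall_notMem fun x hx => hp hx.1.2
        rw [this, measure_empty]
    rw [hind]
    exact measurable_const.indicator (measurableSet_predictable_Ioc_prod _ _ hA)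
  · have hempty : ∀ p : ℝ≥0 × Ω, (fun x => (x, p)) ⁻¹' ({0} ×ˢ ({0} ×ˢ A)) ∩ Ioo 0 p.1 = ∅ :=
      fun p => eq_empty_of_forall_notMem fun x hx => hx.2.1.ne' (mem_singleton_iff.1 hx.1.1)
    simp only [hempty, measure_empty, measurable_const]

lemma measurable_eval_predictable {β : Type*} [MeasurableSpace β] [Zero β] {τ : Ω → ℝ≥0}
    {E : Set Ω} (hτ : ∀ s, MeasurableSet[𝓕 s] {ω | τ ω ≤ s ∧ ω ∈ E}) {f : ℝ≥0 × ℝ≥0 × Ω → β}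
    (hf : Measurable[twoTimePredictable 𝓕] f) :
    Measurable[𝓕.predictable] ({p : ℝ≥0 × Ω | τ p.2 < p.1 ∧ p.2 ∈ E}.indicator
      fun p => f (τ p.2, p)) := by
  refine measurable_indicator_comp_of_generateFrom (measurableSet_predictable_lt hτ)
    (g := fun p => (τ p.2, p)) ?_ hf
  rintro s (⟨a₁, b₁, a₂, b₂, A, hab, hba, -, hA, rfl⟩ | ⟨A, -, rfl⟩)
  · have hprod : {p : ℝ≥0 × Ω | τ p.2 < p.1 ∧ p.2 ∈ E} ∩
        (fun p => (τ p.2, p)) ⁻¹' (Ioc a₁ b₁ ×ˢ (Ioc a₂ b₂ ×ˢ A)) =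
        Ioc a₂ b₂ ×ˢ (A ∩ ({ω | τ ω ≤ b₁ ∧ ω ∈ E} \ {ω | τ ω ≤ a₁ ∧ ω ∈ E})) := by
      ext ⟨y, ω⟩
      constructor
      · rintro ⟨⟨-, hE⟩, hτ, hy, hω⟩
        exact ⟨hy, hω, ⟨hτ.2, hE⟩, fun h => absurd hτ.1 (not_lt.2 h.1)⟩
      · rintro ⟨hy, hω, ⟨hτb, hE⟩, hτa⟩
        exact ⟨⟨hτb.trans_lt (hba.trans hy.1), hE⟩,
          ⟨not_le.1 fun h => hτa ⟨h, hE⟩, hτb⟩, hy, hω⟩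
    rw [hprod]
    refine measurableSet_predictable_Ioc_prod _ _ (hA.inter ?_)
    exact (𝓕.mono hba.le _ (hτ _)).diff (𝓕.mono (hab.trans hba.le) _ (hτ _))
  · convert @MeasurableSet.empty _ 𝓕.predictable
    refine eq_empty_of_forall_notMem fun p hp => not_lt_bot (?_ : τ p.2 < 0)
    exact mem_singleton_iff.1 hp.2.2.1 ▸ hp.1.1

end Predictable

section Hazard

variable {F : Measure ℝ≥0}

lemma measurable_measure_Ici (μ : Measure ℝ≥0) : Measurable fun y => μ (Ici y) :=
  Antitone.measurable fun _ _ h => measure_mono (Ici_subset_Ici.2 h)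

lemma measurable_measure_Iic (μ : Measure ℝ≥0) : Measurable fun y => μ (Iic y) :=
  Monotone.measurable fun _ _ h => measure_mono (Iic_subset_Iic.2 h)

lemma measurable_measure_singleton (μ : Measure ℝ≥0) [SFinite μ] : Measurable fun y => μ {y} := by
  convert measurable_measure_prodMk_left (ν := μ) (measurableSet_diagonal (α := ℝ≥0)) using 3 with y
  ext x
  simp [eq_comm]

instance [IsFiniteMeasure F] : SFinite (hazard F) := by
  rw [hazard]
  infer_instance

lemma hazard_zero (F : Measure ℝ≥0) : hazard F {0} = 0 :=
  withDensity_absolutelyContinuous _ _ (by simp)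

lemma ae_hazard_pos (F : Measure ℝ≥0) : ∀ᵐ y ∂(hazard F), 0 < y := by
  filter_upwards [compl_mem_ae_iff.2 (hazard_zero F)] with y hy
  exact pos_iff_ne_zero.2 hy

lemma setLIntegral_hazard (F : Measure ℝ≥0) {g : ℝ≥0 → ℝ≥0∞} (hg : Measurable g) {s : Set ℝ≥0}
    (hs : MeasurableSet s) :
    ∫⁻ y in s, g y ∂(hazard F) = ∫⁻ y in s ∩ Ioi 0, (F (Ici y))⁻¹ * g y ∂F := by
  have hw : Measurable fun y => (F (Ici y))⁻¹ := (measurable_measure_Ici F).inv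
  rw [hazard, setLIntegral_withDensity_eq_setLIntegral_mul _ hw hg hs,
    Measure.restrict_restrict hs]
  rfl

lemma hazard_singleton_le_one (F : Measure ℝ≥0) (y : ℝ≥0) : hazard F {y} ≤ 1 := by
  rw [hazard, withDensity_apply _ (measurableSet_singleton y), lintegral_singleton]
  calc (F (Ici y))⁻¹ * F.restrict (Ioi 0) {y}
      ≤ (F (Ici y))⁻¹ * F (Ici y) := by
        gcongr _ * ?_
        exact (Measure.restrict_apply_le _ _).trans
          (measure_mono (singleton_subset_iff.2 (self_mem_Ici (a := y))))
    _ ≤ 1 := ENNReal.inv_mul_le_one _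

lemma hazard_singleton (F : Measure ℝ≥0) {y : ℝ≥0} (hy : 0 < y) :
    hazard F {y} = F {y} * (F (Ici y))⁻¹ := by
  rw [hazard, withDensity_apply _ (measurableSet_singleton y), lintegral_singleton,
    Measure.restrict_eq_self _ (singleton_subset_iff.2 (mem_Ioi.2 hy)), mul_comm]

lemma one_sub_hazard_singleton [IsFiniteMeasure F] {y : ℝ≥0} (hy : 0 < y) (hFy : F (Ici y) ≠ 0) :
    1 - hazard F {y} = F (Ioi y) * (F (Ici y))⁻¹ := by
  have hsplit : F (Ici y) = F (Ioi y) + F {y} := by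
    rw [← measure_union (by simp) (measurableSet_singleton y), union_comm, singleton_union,
      Ioi_insert]
  refine ENNReal.sub_eq_of_eq_add
    (ne_top_of_le_ne_top ENNReal.one_ne_top (hazard_singleton_le_one F y)) ?_
  rw [hazard_singleton F hy, ← add_mul, ← hsplit, ENNReal.mul_inv_cancel hFy (measure_ne_top _ _)]

lemma toReal_hazard_singleton_mem (F : Measure ℝ≥0) (y : ℝ≥0) :
    (hazard F {y}).toReal ∈ Icc (0 : ℝ) 1 :=
  ⟨ENNReal.toReal_nonneg, ENNReal.toReal_le_of_le_ofReal zero_le_one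
    (by simpa using hazard_singleton_le_one F y)⟩

lemma ae_measure_Ici_ne_zero (μ : Measure ℝ≥0) : ∀ᵐ y ∂μ, μ (Ici y) ≠ 0 := by
  rw [ae_iff]
  simp only [ne_eq, not_not]
  refine measure_null_of_locally_null _ fun x hx => ?_
  by_cases h : ∃ z < x, μ (Ici z) = 0
  · obtain ⟨z, hzx, hz⟩ := h
    exact ⟨Ici z, mem_nhdsWithin_of_mem_nhds (Ici_mem_nhds hzx), hz⟩
  · push Not at h
    refine ⟨Ici x, Filter.mem_of_superset self_mem_nhdsWithin fun z hz => ?_, hx⟩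
    exact not_lt.1 fun hzx => h z hzx hz

lemma lintegral_lintegral_hazard (F : Measure ℝ≥0) [IsFiniteMeasure F] {k : ℝ≥0 → ℝ≥0∞}
    (hk : Measurable k) :
    ∫⁻ u, ∫⁻ y in Iic u, k y ∂(hazard F) ∂F = ∫⁻ y in Ioi 0, k y ∂F := by
  have hm : Measurable ({q : ℝ≥0 × ℝ≥0 | q.2 ≤ q.1}.indicator fun q => k q.2) :=
    (hk.comp measurable_snd).indicator (measurableSet_le measurable_snd measurable_fst)
  calc ∫⁻ u, ∫⁻ y in Iic u, k y ∂(hazard F) ∂F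
      = ∫⁻ u, ∫⁻ y, {q : ℝ≥0 × ℝ≥0 | q.2 ≤ q.1}.indicator (fun q => k q.2) (u, y) ∂(hazard F) ∂F :=
        lintegral_congr fun u => (lintegral_indicator measurableSet_Iic k).symm
    _ = ∫⁻ y, ∫⁻ u, {q : ℝ≥0 × ℝ≥0 | q.2 ≤ q.1}.indicator (fun q => k q.2) (u, y) ∂F ∂(hazard F) :=
        lintegral_lintegral_swap (f := fun u y => indicator _ _ (u, y)) hm.aemeasurable
    _ = ∫⁻ y, k y * F (Ici y) ∂(hazard F) :=
        lintegral_congr fun y => lintegral_indicator_const (measurableSet_Ici (a := y)) (k y)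
    _ = ∫⁻ y in Ioi 0, (F (Ici y))⁻¹ * (k y * F (Ici y)) ∂F := by
        have hm' : Measurable fun y => k y * F (Ici y) := hk.mul (measurable_measure_Ici F)
        rw [← setLIntegral_univ, setLIntegral_hazard F hm' .univ, univ_inter]
    _ = ∫⁻ y in Ioi 0, k y ∂F := by
        refine lintegral_congr_ae (ae_restrict_of_ae ?_)
        filter_upwards [ae_measure_Ici_ne_zero F] with y hy
        rw [mul_left_comm, ENNReal.inv_mul_cancel hy (measure_ne_top _ _), mul_one]

lemma lintegral_hazard_Iic_le (F : Measure ℝ≥0) [IsProbabilityMeasure F] :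
    ∫⁻ u, hazard F (Iic u) ∂F ≤ 1 := by
  calc ∫⁻ u, hazard F (Iic u) ∂F = F (Ioi 0) := by
        simpa using lintegral_lintegral_hazard F (measurable_const (a := 1))
    _ ≤ 1 := prob_le_one

lemma measure_Iic_sq_le (μ : Measure ℝ≥0) [SFinite μ] (x : ℝ≥0) :
    μ (Iic x) ^ 2 ≤ 2 * ∫⁻ y in Iic x, μ (Iic y) ∂μ := by
  let ν := μ.restrict (Iic x)
  have hle : (ν.prod ν) {p | p.2 ≤ p.1} ≤ ∫⁻ y in Iic x, μ (Iic y) ∂μ := by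
    rw [Measure.prod_apply (measurableSet_le measurable_snd measurable_fst)]
    exact lintegral_mono fun y => Measure.restrict_apply_le _ _
  have hge : (ν.prod ν) {p | p.1 ≤ p.2} ≤ ∫⁻ y in Iic x, μ (Iic y) ∂μ := by
    rw [Measure.prod_apply_symm (measurableSet_le measurable_fst measurable_snd)]
    exact lintegral_mono fun y => Measure.restrict_apply_le _ _
  calc μ (Iic x) ^ 2 = (ν.prod ν) univ := by
        rw [← univ_prod_univ, Measure.prod_prod, Measure.restrict_apply_univ, sq]
    _ ≤ (ν.prod ν) ({p | p.2 ≤ p.1} ∪ {p | p.1 ≤ p.2}) :=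
        measure_mono fun p _ => le_total p.2 p.1
    _ ≤ _ := (measure_union_le _ _).trans (add_le_add hle hge)
    _ = _ := (two_mul _).symm

lemma lintegral_hazard_Iic_sq_le (F : Measure ℝ≥0) [IsProbabilityMeasure F] :
    ∫⁻ u, hazard F (Iic u) ^ 2 ∂F ≤ 2 := by
  calc ∫⁻ u, hazard F (Iic u) ^ 2 ∂F
      ≤ ∫⁻ u, 2 * ∫⁻ y in Iic u, hazard F (Iic y) ∂(hazard F) ∂F :=
        lintegral_mono fun u => measure_Iic_sq_le _ u
    _ = 2 * ∫⁻ y in Ioi 0, hazard F (Iic y) ∂F := by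
        rw [lintegral_const_mul' _ _ ENNReal.ofNat_ne_top,
          lintegral_lintegral_hazard F (measurable_measure_Iic _)]
    _ ≤ 2 * 1 := by
        gcongr
        exact (setLIntegral_le_lintegral _ _).trans (lintegral_hazard_Iic_le F)
    _ = 2 := mul_one 2

end Hazard

lemma setIntegral_add_of_finset {X : Type*} [MeasurableSpace X] [MeasurableSingletonClass X]
    {μ ν : Measure X} [IsFiniteMeasure μ] [IsFiniteMeasure ν] (A : Finset X)
    (hA : μ (A : Set X)ᶜ = 0) {ρ : X → ℝ} (hρi : Integrable ρ (μ + ν))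
    (hoff : ∀ x ∉ A, ρ x = -1)
    (hon : ∀ x ∈ A, ρ x * (μ.real {x} + ν.real {x}) = μ.real {x} - ν.real {x})
    {s : Set X} (hs : MeasurableSet s) :
    ∫ x in s, ρ x ∂(μ + ν) = μ.real s - ν.real s := by
  classical
  have hAm : MeasurableSet (A : Set X) := A.measurableSet
  have hμ : μ.real (s \ A) = 0 := by
    simp [measureReal_def, measure_mono_null (fun _ hx => hx.2 : s \ A ⊆ (A : Set X)ᶜ) hA]
  have h_off : ∫ x in s \ A, ρ x ∂(μ + ν) = -ν.real (s \ A) := by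
    rw [setIntegral_congr_fun (g := fun _ => (-1 : ℝ)) (hs.diff hAm) fun _ hx =>
      hoff _ (by simpa using hx.2), integral_const, measureReal_restrict_apply_univ,
      measureReal_add_apply, hμ]
    simp
  have h_on : ∫ x in s ∩ A, ρ x ∂(μ + ν) = μ.real (s ∩ A) - ν.real (s ∩ A) := by
    have h : s ∩ A = ((A.filter (· ∈ s) : Finset X) : Set X) := by
      ext x
      simp [and_comm]
    rw [h, setIntegral_finset _ hρi.integrableOn, ← sum_measureReal_singleton,
      ← sum_measureReal_singleton, ← Finset.sum_sub_distrib]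
    refine Finset.sum_congr rfl fun x hx => ?_
    rw [← hon x (Finset.mem_filter.1 hx).1, measureReal_add_apply, smul_eq_mul, mul_comm]
  rw [← integral_inter_add_sdiff hAm hρi.integrableOn, h_off, h_on,
    ← measureReal_inter_add_sdiff (μ := μ) hAm (s := s),
    ← measureReal_inter_add_sdiff (μ := ν) hAm (s := s), hμ]
  ring

section Paths

variable {Ω : Type*} {mΩ : MeasurableSpace Ω} {n : ℕ} {F : Measure ℝ≥0} {T C : Fin n → Ω → ℝ≥0}

lemma measurable_obsTime (hT : ∀ i, Measurable (T i)) (hC : ∀ i, Measurable (C i)) (i : Fin n) :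
    Measurable (obsTime T C i) := (hT i).min (hC i)

lemma measurableSet_uncensored (hT : ∀ i, Measurable (T i)) (hC : ∀ i, Measurable (C i))
    (i : Fin n) : MeasurableSet {ω | T i ω ≤ C i ω} := measurableSet_le (hT i) (hC i)

lemma measurable_atRisk (hT : ∀ i, Measurable (T i)) (hC : ∀ i, Measurable (C i)) :
    Measurable fun p : ℝ≥0 × Ω => atRisk T C p.1 p.2 := by
  unfold atRisk
  refine Finset.measurable_sum _ fun i _ => Measurable.ite ?_ measurable_const measurable_const
  exact measurableSet_le measurable_fst ((measurable_obsTime hT hC i).comp measurable_snd)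

lemma measurable_atRisk_apply (T C : Fin n → Ω → ℝ≥0) (ω : Ω) :
    Measurable fun y => (atRisk T C y ω : ℝ≥0∞) := by
  simp only [atRisk, Nat.cast_sum, Nat.cast_ite, Nat.cast_one, Nat.cast_zero]
  exact Finset.measurable_sum _ fun i _ =>
    Measurable.ite measurableSet_Iic measurable_const measurable_const

lemma lintegral_countingMeasure (T C : Fin n → Ω → ℝ≥0) (ω : Ω) (g : ℝ≥0 → ℝ≥0∞) :
    ∫⁻ y, g y ∂(countingMeasure T C ω) =
      ∑ i, if T i ω ≤ C i ω then g (obsTime T C i ω) else 0 := by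
  rw [countingMeasure, lintegral_finsetSum_measure]
  refine Finset.sum_congr rfl fun i _ => ?_
  split_ifs <;> simp

lemma countingMeasure_apply (T C : Fin n → Ω → ℝ≥0) (ω : Ω) {s : Set ℝ≥0} (hs : MeasurableSet s) :
    countingMeasure T C ω s =
      ∑ i, if T i ω ≤ C i ω then s.indicator 1 (obsTime T C i ω) else 0 := by
  rw [← lintegral_indicator_one hs, lintegral_countingMeasure]

lemma countingMeasure_univ_le (T C : Fin n → Ω → ℝ≥0) (ω : Ω) :
    countingMeasure T C ω univ ≤ n := by
  rw [countingMeasure_apply T C ω .univ]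
  calc _ ≤ ∑ _i : Fin n, (1 : ℝ≥0∞) := Finset.sum_le_sum fun i _ => by split_ifs <;> simp
    _ = n := by simp

lemma compensatorMeasure_eq_sum (F : Measure ℝ≥0) (T C : Fin n → Ω → ℝ≥0) (ω : Ω) :
    compensatorMeasure F T C ω = ∑ i, (hazard F).restrict (Iic (obsTime T C i ω)) := by
  have hY : (fun y => (atRisk T C y ω : ℝ≥0∞)) =
      ∑' i, (Iic (obsTime T C i ω)).indicator (1 : ℝ≥0 → ℝ≥0∞) := by
    ext y
    simp [atRisk, indicator_apply, tsum_fintype]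
  rw [compensatorMeasure, hY, withDensity_tsum fun i => measurable_one.indicator measurableSet_Iic,
    Measure.sum_fintype]
  simp_rw [withDensity_indicator_one measurableSet_Iic]

lemma lintegral_compensatorMeasure (F : Measure ℝ≥0) (T C : Fin n → Ω → ℝ≥0) (ω : Ω)
    (g : ℝ≥0 → ℝ≥0∞) :
    ∫⁻ y, g y ∂(compensatorMeasure F T C ω) =
      ∑ i, ∫⁻ y in Iic (obsTime T C i ω), g y ∂(hazard F) := by
  rw [compensatorMeasure_eq_sum, lintegral_finsetSum_measure]

/-- The measures `dN` along the paths, as a kernel. -/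
def countingKernel (hT : ∀ i, Measurable (T i)) (hC : ∀ i, Measurable (C i)) : Kernel Ω ℝ≥0 where
  toFun := countingMeasure T C
  measurable' := by
    refine Measure.measurable_of_measurable_coe _ fun s hs => ?_
    simp_rw [countingMeasure_apply T C _ hs]
    refine Finset.measurable_sum _ fun i _ => Measurable.ite (measurableSet_uncensored hT hC i) ?_
      measurable_const
    exact (measurable_one.indicator hs).comp (measurable_obsTime hT hC i)

instance (hT : ∀ i, Measurable (T i)) (hC : ∀ i, Measurable (C i)) :
    IsFiniteKernel (countingKernel hT hC) :=
  ⟨n, by simp, fun ω => countingMeasure_univ_le T C ω⟩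

/-- The measures `Y dΛ` along the paths, as a kernel. -/
def compensatorKernel {Ω : Type*} [MeasurableSpace Ω] (F : Measure ℝ≥0) [IsFiniteMeasure F]
    (T C : Fin n → Ω → ℝ≥0) : Kernel Ω ℝ≥0 :=
  (Kernel.const Ω (hazard F)).withDensity fun ω y => (atRisk T C y ω : ℝ≥0∞)

instance [IsFiniteMeasure F] : IsSFiniteKernel (compensatorKernel F T C) :=
  Kernel.IsSFiniteKernel.withDensity _ fun _ _ => ENNReal.natCast_ne_top _

lemma compensatorKernel_apply [IsFiniteMeasure F] (hT : ∀ i, Measurable (T i))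
    (hC : ∀ i, Measurable (C i)) (ω : Ω) :
    compensatorKernel F T C ω = compensatorMeasure F T C ω := by
  have hY : Measurable fun p : Ω × ℝ≥0 => (atRisk T C p.2 p.1 : ℝ≥0∞) :=
    (measurable_from_top (f := Nat.cast)).comp ((measurable_atRisk hT hC).comp measurable_swap)
  rw [compensatorKernel, Kernel.withDensity_apply _ hY]
  rfl

/-- The paths along which `Y dΛ` has finite mass, that is, those for which `dM` is not set to `0` by
convention. -/
def finitePaths (F : Measure ℝ≥0) (T C : Fin n → Ω → ℝ≥0) : Set Ω :=
  {ω | IsFiniteMeasure (compensatorMeasure F T C ω)}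

lemma measurableSet_finitePaths [IsFiniteMeasure F] (hT : ∀ i, Measurable (T i))
    (hC : ∀ i, Measurable (C i)) : MeasurableSet (finitePaths F T C) := by
  have : finitePaths F T C = {ω | compensatorKernel F T C ω univ < ∞} := by
    ext ω
    rw [mem_ofPred_eq, compensatorKernel_apply hT hC]
    exact isFiniteMeasure_iff _
  rw [this]
  exact measurableSet_lt (Kernel.measurable_coe _ MeasurableSet.univ) measurable_const

open Classical in
/-- The measure `dN + Y dΛ` along a path, which dominates `dM`. As for `dM`, it is `0` by convention
where `Y dΛ` has infinite mass. -/
def pathMeasure (F : Measure ℝ≥0) (T C : Fin n → Ω → ℝ≥0) (ω : Ω) : Measure ℝ≥0 :=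
  if ω ∈ finitePaths F T C then countingMeasure T C ω + compensatorMeasure F T C ω else 0

instance (ω : Ω) : IsFiniteMeasure (pathMeasure F T C ω) := by
  rw [pathMeasure]
  split_ifs with hω
  · have : IsFiniteMeasure (compensatorMeasure F T C ω) := hω
    infer_instance
  · infer_instance

lemma pathMeasure_of_mem {ω : Ω} (hω : ω ∈ finitePaths F T C) :
    pathMeasure F T C ω = countingMeasure T C ω + compensatorMeasure F T C ω := if_pos hω

lemma pathMeasure_of_notMem {ω : Ω} (hω : ω ∉ finitePaths F T C) : pathMeasure F T C ω = 0 :=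
  if_neg hω

lemma pathMeasure_univ_le (F : Measure ℝ≥0) (T C : Fin n → Ω → ℝ≥0) (ω : Ω) :
    pathMeasure F T C ω univ ≤ n + ∑ j, hazard F (Iic (obsTime T C j ω)) := by
  rw [pathMeasure]
  split_ifs
  · rw [Measure.add_apply, compensatorMeasure_eq_sum, Measure.finsetSum_apply]
    simpa using add_le_add_left (countingMeasure_univ_le T C ω) _
  · simp

open Classical in
/-- The measures `dN + Y dΛ` along the paths, as a kernel. -/
def pathKernel (F : Measure ℝ≥0) [IsFiniteMeasure F] (hT : ∀ i, Measurable (T i))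
    (hC : ∀ i, Measurable (C i)) : Kernel Ω ℝ≥0 :=
  Kernel.piecewise (measurableSet_finitePaths (F := F) hT hC)
    (countingKernel hT hC + compensatorKernel F T C) 0

instance [IsFiniteMeasure F] (hT : ∀ i, Measurable (T i)) (hC : ∀ i, Measurable (C i)) :
    IsSFiniteKernel (pathKernel F hT hC) := by
  rw [pathKernel]
  infer_instance

lemma pathKernel_apply [IsFiniteMeasure F] (hT : ∀ i, Measurable (T i))
    (hC : ∀ i, Measurable (C i)) (ω : Ω) : pathKernel F hT hC ω = pathMeasure F T C ω := by
  classical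
  rw [pathKernel, Kernel.piecewise_apply, pathMeasure, ← compensatorKernel_apply hT hC]
  rfl

/-- The jump at `y` of the individual martingale `1{Xᵢ ≤ y, Δᵢ = 1} - Λ(y ∧ Xᵢ)`. -/
def jumpAt (F : Measure ℝ≥0) (T C : Fin n → Ω → ℝ≥0) (i : Fin n) (p : ℝ≥0 × Ω) : ℝ :=
  (if obsTime T C i p.2 = p.1 ∧ T i p.2 ≤ C i p.2 then 1 else 0) -
    (hazard F {p.1}).toReal * (if p.1 ≤ obsTime T C i p.2 then 1 else 0)

/-- The jump `ΔN(y)`, the number of uncensored observations at `y`. -/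
def atomCount (T C : Fin n → Ω → ℝ≥0) (y : ℝ≥0) (ω : Ω) : ℕ :=
  ∑ i, if obsTime T C i ω = y ∧ T i ω ≤ C i ω then 1 else 0

/-- The density of `dM` with respect to `dN + Y dΛ`: it is `(ΔN - Y ΔΛ) / (ΔN + Y ΔΛ)` at the jump
times of `N` and `-1` elsewhere. -/
def signDensity (F : Measure ℝ≥0) (T C : Fin n → Ω → ℝ≥0) (ω : Ω) (y : ℝ≥0) : ℝ :=
  if atomCount T C y ω = 0 then -1 else
    (atomCount T C y ω - (hazard F {y}).toReal * atRisk T C y ω) /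
      (atomCount T C y ω + (hazard F {y}).toReal * atRisk T C y ω)

lemma measurableSet_obsTime_eq (hT : ∀ i, Measurable (T i)) (hC : ∀ i, Measurable (C i))
    (i : Fin n) :
    MeasurableSet {p : ℝ≥0 × Ω | obsTime T C i p.2 = p.1 ∧ T i p.2 ≤ C i p.2} :=
  (measurableSet_eq_fun ((measurable_obsTime hT hC i).comp measurable_snd) measurable_fst).inter
    ((measurableSet_uncensored hT hC i).preimage measurable_snd)

lemma measurable_toReal_hazard_singleton (F : Measure ℝ≥0) [IsFiniteMeasure F] :
    Measurable fun y => (hazard F {y}).toReal :=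
  (measurable_measure_singleton _).ennreal_toReal

lemma measurable_jumpAt [IsFiniteMeasure F] (hT : ∀ i, Measurable (T i))
    (hC : ∀ i, Measurable (C i)) (i : Fin n) : Measurable (jumpAt F T C i) :=
  (Measurable.ite (measurableSet_obsTime_eq hT hC i) measurable_const measurable_const).sub
    (((measurable_toReal_hazard_singleton F).comp measurable_fst).mul
      (Measurable.ite (measurableSet_le measurable_fst
        ((measurable_obsTime hT hC i).comp measurable_snd)) measurable_const measurable_const))

lemma measurable_atomCount (hT : ∀ i, Measurable (T i)) (hC : ∀ i, Measurable (C i)) :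
    Measurable fun p : ℝ≥0 × Ω => atomCount T C p.1 p.2 :=
  Finset.measurable_sum _ fun i _ =>
    Measurable.ite (measurableSet_obsTime_eq hT hC i) measurable_const measurable_const

lemma measurable_signDensity [IsFiniteMeasure F] (hT : ∀ i, Measurable (T i))
    (hC : ∀ i, Measurable (C i)) : Measurable fun p : ℝ≥0 × Ω => signDensity F T C p.2 p.1 := by
  have hN := measurable_atomCount hT hC
  have hN' : Measurable fun p : ℝ≥0 × Ω => (atomCount T C p.1 p.2 : ℝ) :=
    (measurable_from_top (f := Nat.cast)).comp hN
  have hA : Measurable fun p : ℝ≥0 × Ω => (hazard F {p.1}).toReal * (atRisk T C p.1 p.2 : ℝ) :=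
    ((measurable_toReal_hazard_singleton F).comp measurable_fst).mul
      ((measurable_from_top (f := Nat.cast)).comp (measurable_atRisk hT hC))
  exact Measurable.ite (hN (measurableSet_singleton 0)) measurable_const
    ((hN'.sub hA).div (hN'.add hA))

lemma abs_signDensity_le_one (F : Measure ℝ≥0) (T C : Fin n → Ω → ℝ≥0) (ω : Ω) (y : ℝ≥0) :
    |signDensity F T C ω y| ≤ 1 := by
  unfold signDensity
  split_ifs
  · simp
  · have h1 : (0 : ℝ) ≤ atomCount T C y ω := Nat.cast_nonneg _
    have h2 : 0 ≤ (hazard F {y}).toReal * (atRisk T C y ω : ℝ) := by positivity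
    rw [abs_div, abs_of_nonneg (add_nonneg h1 h2)]
    refine div_le_one_of_le₀ ?_ (add_nonneg h1 h2)
    rw [abs_le]
    constructor <;> linarith

lemma enorm_signDensity_le_one (F : Measure ℝ≥0) (T C : Fin n → Ω → ℝ≥0) (ω : Ω) (y : ℝ≥0) :
    ‖signDensity F T C ω y‖ₑ ≤ 1 := by
  rw [Real.enorm_eq_ofReal_abs]
  exact ENNReal.ofReal_le_one.2 (abs_signDensity_le_one F T C ω y)

lemma measureReal_countingMeasure_singleton (T C : Fin n → Ω → ℝ≥0) (ω : Ω) (y : ℝ≥0) :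
    (countingMeasure T C ω).real {y} = atomCount T C y ω := by
  have h : countingMeasure T C ω {y} = (atomCount T C y ω : ℝ≥0∞) := by
    rw [countingMeasure_apply T C ω (measurableSet_singleton y), atomCount, Nat.cast_sum]
    refine Finset.sum_congr rfl fun i _ => ?_
    by_cases h1 : T i ω ≤ C i ω <;> by_cases h2 : obsTime T C i ω = y <;> simp [h1, h2]
  simp [measureReal_def, h]

lemma measureReal_compensatorMeasure_singleton (F : Measure ℝ≥0) (T C : Fin n → Ω → ℝ≥0) (ω : Ω)
    (y : ℝ≥0) :
    (compensatorMeasure F T C ω).real {y} = (hazard F {y}).toReal * atRisk T C y ω := by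
  rw [measureReal_def, compensatorMeasure, withDensity_apply _ (measurableSet_singleton y),
    lintegral_singleton, ENNReal.toReal_mul, mul_comm, ENNReal.toReal_natCast]

lemma sum_jumpAt (F : Measure ℝ≥0) (T C : Fin n → Ω → ℝ≥0) (y : ℝ≥0) (ω : Ω) :
    ∑ i, jumpAt F T C i (y, ω) = atomCount T C y ω - (hazard F {y}).toReal * atRisk T C y ω := by
  simp only [jumpAt, Finset.sum_sub_distrib, ← Finset.mul_sum, atomCount, atRisk, Nat.cast_sum,
    Nat.cast_ite, Nat.cast_one, Nat.cast_zero]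

/-- The finite set of the jump times of `N` along a path. -/
def jumpTimes (T C : Fin n → Ω → ℝ≥0) (ω : Ω) : Finset ℝ≥0 :=
  (Finset.univ.filter fun i => T i ω ≤ C i ω).image fun i => obsTime T C i ω

lemma mem_jumpTimes {ω : Ω} {y : ℝ≥0} : y ∈ jumpTimes T C ω ↔ atomCount T C y ω ≠ 0 := by
  simp [jumpTimes, atomCount, and_comm]

lemma countingMeasure_compl_jumpTimes (T C : Fin n → Ω → ℝ≥0) (ω : Ω) :
    countingMeasure T C ω (jumpTimes T C ω : Set ℝ≥0)ᶜ = 0 := by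
  rw [countingMeasure_apply T C ω (jumpTimes T C ω).measurableSet.compl]
  refine Finset.sum_eq_zero fun i _ => ite_eq_right_iff.2 fun hi => indicator_of_notMem ?_ _
  rw [notMem_compl_iff, Finset.mem_coe, jumpTimes]
  exact Finset.mem_image_of_mem (fun i => obsTime T C i ω)
    (Finset.mem_filter.2 ⟨Finset.mem_univ i, hi⟩)

lemma signDensity_of_notMem_jumpTimes {ω : Ω} {y : ℝ≥0} (hy : y ∉ jumpTimes T C ω) :
    signDensity F T C ω y = -1 := by
  rw [mem_jumpTimes, not_not] at hy
  simp [signDensity, hy]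

lemma measurable_signDensity_apply [IsFiniteMeasure F] (hT : ∀ i, Measurable (T i))
    (hC : ∀ i, Measurable (C i)) (ω : Ω) : Measurable (signDensity F T C ω) :=
  (measurable_signDensity hT hC).comp measurable_prodMk_right

lemma integrable_signDensity [IsFiniteMeasure F] (hT : ∀ i, Measurable (T i))
    (hC : ∀ i, Measurable (C i)) (μ : Measure ℝ≥0) [IsFiniteMeasure μ] (ω : Ω) :
    Integrable (signDensity F T C ω) μ :=
  Integrable.of_bound (measurable_signDensity_apply hT hC ω).aestronglyMeasurable 1
    (ae_of_all _ fun y => abs_signDensity_le_one F T C ω y)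

lemma setIntegral_signDensity [IsFiniteMeasure F] (hT : ∀ i, Measurable (T i))
    (hC : ∀ i, Measurable (C i)) {ω : Ω} (hω : ω ∈ finitePaths F T C) {s : Set ℝ≥0}
    (hs : MeasurableSet s) :
    ∫ y in s, signDensity F T C ω y ∂(pathMeasure F T C ω) =
      (countingMeasure T C ω).real s - (compensatorMeasure F T C ω).real s := by
  have : IsFiniteMeasure (compensatorMeasure F T C ω) := hω
  rw [pathMeasure_of_mem hω]
  refine setIntegral_add_of_finset (jumpTimes T C ω) (countingMeasure_compl_jumpTimes T C ω)
    (integrable_signDensity hT hC _ ω) (fun y hy => signDensity_of_notMem_jumpTimes hy)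
    (fun y hy => ?_) hs
  have hN : atomCount T C y ω ≠ 0 := mem_jumpTimes.1 hy
  have : (0 : ℝ) < atomCount T C y ω := Nat.cast_pos.2 (Nat.pos_of_ne_zero hN)
  rw [measureReal_countingMeasure_singleton, measureReal_compensatorMeasure_singleton, signDensity,
    if_neg hN, div_mul_cancel₀]
  positivity

lemma dM_eq_withDensityᵥ [IsFiniteMeasure F] (hT : ∀ i, Measurable (T i))
    (hC : ∀ i, Measurable (C i)) (ω : Ω) :
    dM F T C ω = (pathMeasure F T C ω).withDensityᵥ (signDensity F T C ω) := by
  ext s hs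
  rw [withDensityᵥ_apply (integrable_signDensity hT hC _ ω) hs, dM]
  split_ifs with hω
  · rw [setIntegral_signDensity hT hC hω hs]
    simp [Measure.toSignedMeasure_apply_measurable hs]
  · rw [pathMeasure_of_notMem hω]
    simp

lemma variation_dM [IsFiniteMeasure F] (hT : ∀ i, Measurable (T i)) (hC : ∀ i, Measurable (C i))
    (ω : Ω) :
    (dM F T C ω).variation =
      (pathMeasure F T C ω).withDensity fun y => ‖signDensity F T C ω y‖ₑ := by
  rw [dM_eq_withDensityᵥ hT hC, Measure.variation_withDensityᵥ (integrable_signDensity hT hC _ ω)]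

end Paths

section Compensation

variable {Ω : Type*} {mΩ : MeasurableSpace Ω} {P : Measure Ω} {F : Measure ℝ≥0}

lemma indepFun_prodMk_of_indepFun [IsFiniteMeasure P] {α β γ : Type*} [MeasurableSpace α]
    [MeasurableSpace β] [MeasurableSpace γ] {X : Ω → α} {Y : Ω → β} {Z : Ω → γ}
    (hX : Measurable X) (hY : Measurable Y) (hZ : Measurable Z) (hXY : IndepFun X Y P)
    (hXYZ : IndepFun (fun ω => (X ω, Y ω)) Z P) : IndepFun X (fun ω => (Y ω, Z ω)) P := by
  have hYZ : IndepFun Y Z P := hXYZ.comp measurable_snd measurable_id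
  rw [indepFun_iff_map_prod_eq_prod_map_map (by fun_prop) (by fun_prop)] at hXY hXYZ hYZ ⊢
  rw [hYZ, ← Measure.prodAssoc_prod, ← hXY, ← hXYZ,
    Measure.map_map (MeasurableEquiv.measurable _) (by fun_prop)]
  rfl

lemma lintegral_lintegral_hazard_of_indepFun [IsFiniteMeasure P] [IsFiniteMeasure F] {β : Type*}
    [MeasurableSpace β] {U : Ω → ℝ≥0} {V : Ω → β} (hU : Measurable U) (hV : Measurable V)
    (hUF : P.map U = F) (hF : F {0} = 0) (hUV : IndepFun U V P) {k : ℝ≥0 × β → ℝ≥0∞}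
    (hk : Measurable k) :
    ∫⁻ ω, ∫⁻ y in Iic (U ω), k (y, V ω) ∂(hazard F) ∂P = ∫⁻ ω, k (U ω, V ω) ∂P := by
  have hset : MeasurableSet {q : (ℝ≥0 × β) × ℝ≥0 | q.2 ≤ q.1.1} :=
    measurableSet_le measurable_snd measurable_fst.fst
  have hinner : Measurable fun q : ℝ≥0 × β => ∫⁻ y in Iic q.1, k (y, q.2) ∂(hazard F) := by
    simp_rw [← lintegral_indicator measurableSet_Iic]
    exact ((hk.comp (measurable_snd.prodMk measurable_fst.snd)).indicator
      hset).lintegral_prod_right'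
  have hlaw := (indepFun_iff_map_prod_eq_prod_map_map hU.aemeasurable hV.aemeasurable).1 hUV
  calc ∫⁻ ω, ∫⁻ y in Iic (U ω), k (y, V ω) ∂(hazard F) ∂P
      = ∫⁻ v, ∫⁻ u, ∫⁻ y in Iic u, k (y, v) ∂(hazard F) ∂F ∂(P.map V) := by
        rw [← lintegral_map hinner (hU.prodMk hV), hlaw, hUF,
          lintegral_prod_symm _ hinner.aemeasurable]
    _ = ∫⁻ v, ∫⁻ u, k (u, v) ∂F ∂(P.map V) := by
        refine lintegral_congr fun v => ?_
        have hpos : Ioi (0 : ℝ≥0) =ᵐ[F] univ := by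
          rw [ae_eq_univ, compl_Ioi, ← bot_eq_zero, Iic_bot]
          exact hF
        rw [lintegral_lintegral_hazard F (k := fun y => k (y, v))
            (hk.comp measurable_prodMk_right),
          setLIntegral_congr hpos, setLIntegral_univ]
    _ = ∫⁻ ω, k (U ω, V ω) ∂P := by
        rw [← lintegral_map hk (hU.prodMk hV), hlaw, hUF, lintegral_prod_symm _ hk.aemeasurable]

variable {n : ℕ} {T C : Fin n → Ω → ℝ≥0} {j : Fin n}

/-- Survival times which are independent with law `F` on `(0, ∞)`, and independent of the censoring
times. -/
structure IsSample (P : Measure Ω) (F : Measure ℝ≥0) (T C : Fin n → Ω → ℝ≥0) : Prop where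
  measurable_T : ∀ i, Measurable (T i)
  measurable_C : ∀ i, Measurable (C i)
  map_T : ∀ i, P.map (T i) = F
  singleton_zero : F {0} = 0
  iIndepFun_T : iIndepFun T P
  indepFun_T_C : IndepFun (fun ω i => T i ω) (fun ω i => C i ω) P

lemma IsSample.measurable_obsTime (hS : IsSample P F T C) (i : Fin n) :
    Measurable (obsTime T C i) :=
  Censored.measurable_obsTime hS.measurable_T hS.measurable_C i

/-- The survival and censoring times of the individuals other than `j`. -/
def others (T C : Fin n → Ω → ℝ≥0) (j : Fin n) (ω : Ω) (i : ({j}ᶜ : Finset (Fin n))) :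
    ℝ≥0 × ℝ≥0 := (T i ω, C i ω)

lemma measurable_others (hT : ∀ i, Measurable (T i)) (hC : ∀ i, Measurable (C i)) (j : Fin n) :
    Measurable (others T C j) :=
  measurable_pi_lambda _ fun i => (hT i).prodMk (hC i)

lemma IsSample.indepFun_others [IsFiniteMeasure P] (hS : IsSample P F T C) (j : Fin n) :
    IndepFun (T j) (fun ω => (C j ω, others T C j ω)) P := by
  let restT : Ω → ({j}ᶜ : Finset (Fin n)) → ℝ≥0 := fun ω i => T i ω
  have hrest : Measurable restT := measurable_pi_lambda _ fun i => hS.measurable_T i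
  have hTrest : IndepFun (T j) restT P :=
    (hS.iIndepFun_T.indepFun_finset {j} {j}ᶜ disjoint_compl_right hS.measurable_T).comp
      (φ := fun z : ({j} : Finset (Fin n)) → ℝ≥0 => z ⟨j, by simp⟩) (by fun_prop) measurable_id
  have hTC : IndepFun (fun ω => (T j ω, restT ω)) (fun ω i => C i ω) P :=
    hS.indepFun_T_C.comp (φ := fun z => (z j, fun i : ({j}ᶜ : Finset (Fin n)) => z i))
      (by fun_prop) measurable_id
  exact (indepFun_prodMk_of_indepFun (hS.measurable_T j) hrest
    (measurable_pi_lambda _ hS.measurable_C) hTrest hTC).comp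
    (ψ := fun z => (z.2 j, fun i : ({j}ᶜ : Finset (Fin n)) => (z.1 i, z.2 i)))
    measurable_id (by fun_prop)

/-- The Campbell measure of the counting process of individual `j`: a set `A` of pairs `(y, ω)` has
mass `E ∫ 1_A dNⱼ`. -/
def countingCampbell (P : Measure Ω) (T C : Fin n → Ω → ℝ≥0) (j : Fin n) : Measure (ℝ≥0 × Ω) :=
  (P.restrict {ω | T j ω ≤ C j ω}).map fun ω => (obsTime T C j ω, ω)

/-- The Campbell measure of the compensator of the counting process of individual `j`: a set `A` of
pairs `(y, ω)` has mass `E ∫_{(0, Xⱼ]} 1_A dΛ`. -/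
def compensatorCampbell (P : Measure Ω) (F : Measure ℝ≥0) (T C : Fin n → Ω → ℝ≥0) (j : Fin n) :
    Measure (ℝ≥0 × Ω) :=
  ((hazard F).prod P).restrict {p | p.1 ≤ obsTime T C j p.2}

lemma measurableSet_le_obsTime (hT : ∀ i, Measurable (T i)) (hC : ∀ i, Measurable (C i))
    (j : Fin n) : MeasurableSet {p : ℝ≥0 × Ω | p.1 ≤ obsTime T C j p.2} :=
  measurableSet_le measurable_fst ((measurable_obsTime hT hC j).comp measurable_snd)

lemma measurable_obsTime_prodMk (hT : ∀ i, Measurable (T i)) (hC : ∀ i, Measurable (C i))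
    (j : Fin n) : Measurable fun ω => (obsTime T C j ω, ω) :=
  (measurable_obsTime hT hC j).prodMk measurable_id

lemma lintegral_countingCampbell (hT : ∀ i, Measurable (T i)) (hC : ∀ i, Measurable (C i))
    (j : Fin n) {f : ℝ≥0 × Ω → ℝ≥0∞} (hf : Measurable f) :
    ∫⁻ p, f p ∂(countingCampbell P T C j) =
      ∫⁻ ω, if T j ω ≤ C j ω then f (obsTime T C j ω, ω) else 0 ∂P := by
  rw [countingCampbell, lintegral_map hf (measurable_obsTime_prodMk hT hC j),
    ← lintegral_indicator (measurableSet_uncensored hT hC j)]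
  rfl

lemma integral_countingCampbell (hT : ∀ i, Measurable (T i)) (hC : ∀ i, Measurable (C i))
    (j : Fin n) {f : ℝ≥0 × Ω → ℝ} (hf : Measurable f) :
    ∫ p, f p ∂(countingCampbell P T C j) =
      ∫ ω, if T j ω ≤ C j ω then f (obsTime T C j ω, ω) else 0 ∂P := by
  rw [countingCampbell, integral_map (measurable_obsTime_prodMk hT hC j).aemeasurable
    hf.aestronglyMeasurable, ← integral_indicator (measurableSet_uncensored hT hC j)]
  rfl

lemma lintegral_compensatorCampbell [SFinite P] [IsFiniteMeasure F] (hT : ∀ i, Measurable (T i))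
    (hC : ∀ i, Measurable (C i)) (j : Fin n) {f : ℝ≥0 × Ω → ℝ≥0∞} (hf : Measurable f) :
    ∫⁻ p, f p ∂(compensatorCampbell P F T C j) =
      ∫⁻ ω, ∫⁻ y in Iic (obsTime T C j ω), f (y, ω) ∂(hazard F) ∂P := by
  have hset := measurableSet_le_obsTime hT hC j
  rw [compensatorCampbell, ← lintegral_indicator hset,
    lintegral_prod_symm _ (hf.indicator hset).aemeasurable]
  simp_rw [← lintegral_indicator measurableSet_Iic]
  rfl

lemma integrable_compensatorCampbell [SFinite P] [IsFiniteMeasure F] (hT : ∀ i, Measurable (T i))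
    (hC : ∀ i, Measurable (C i)) {f : ℝ≥0 × Ω → ℝ}
    (hf : Integrable f (compensatorCampbell P F T C j)) :
    Integrable (fun ω => ∫ y in Iic (obsTime T C j ω), f (y, ω) ∂(hazard F)) P := by
  simp_rw [← integral_indicator measurableSet_Iic]
  exact (IntegrableOn.integrable_indicator hf
    (measurableSet_le_obsTime hT hC j)).integral_prod_right

lemma integral_compensatorCampbell [SFinite P] [IsFiniteMeasure F] (hT : ∀ i, Measurable (T i))
    (hC : ∀ i, Measurable (C i)) {f : ℝ≥0 × Ω → ℝ}
    (hf : Integrable f (compensatorCampbell P F T C j)) :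
    ∫ p, f p ∂(compensatorCampbell P F T C j) =
      ∫ ω, ∫ y in Iic (obsTime T C j ω), f (y, ω) ∂(hazard F) ∂P := by
  have hset := measurableSet_le_obsTime hT hC j
  rw [compensatorCampbell, ← integral_indicator hset,
    integral_prod_symm _ (IntegrableOn.integrable_indicator hf hset)]
  simp_rw [← integral_indicator measurableSet_Iic]
  rfl

/-- The compensation formula `E ∫ f dNⱼ = E ∫_{(0, Xⱼ]} f dΛ` for the integrands that depend on
`ω` only through the other individuals, as an identity of Campbell measures. -/
lemma IsSample.map_others_countingCampbell [IsFiniteMeasure P] [IsFiniteMeasure F]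
    (hS : IsSample P F T C) (j : Fin n) :
    (countingCampbell P T C j).map (fun p => (p.1, others T C j p.2)) =
      (compensatorCampbell P F T C j).map (fun p => (p.1, others T C j p.2)) := by
  have ho := measurable_others hS.measurable_T hS.measurable_C j
  have hπ : Measurable fun p : ℝ≥0 × Ω => (p.1, others T C j p.2) :=
    measurable_fst.prodMk (ho.comp measurable_snd)
  refine Measure.ext_of_lintegral _ fun k hk => ?_
  rw [lintegral_map hk hπ, lintegral_map hk hπ,
    lintegral_countingCampbell hS.measurable_T hS.measurable_C j
      (f := fun p => k (p.1, others T C j p.2)) (hk.comp hπ),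
    lintegral_compensatorCampbell hS.measurable_T hS.measurable_C j
      (f := fun p => k (p.1, others T C j p.2)) (hk.comp hπ)]
  let k' : ℝ≥0 × ℝ≥0 × (({j}ᶜ : Finset (Fin n)) → ℝ≥0 × ℝ≥0) → ℝ≥0∞ := fun q =>
    if q.1 ≤ q.2.1 then k (q.1, q.2.2) else 0
  have hk' : Measurable k' := Measurable.ite (measurableSet_le measurable_fst measurable_snd.fst)
    (hk.comp (measurable_fst.prodMk measurable_snd.snd)) measurable_const
  have key := lintegral_lintegral_hazard_of_indepFun (hS.measurable_T j)
    ((hS.measurable_C j).prodMk ho) (hS.map_T j) hS.singleton_zero (hS.indepFun_others j) hk'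
  convert key.symm using 3 with ω ω
  · by_cases h : T j ω ≤ C j ω
    · simp [k', h, obsTime]
    · simp [k', h]
  · rw [← lintegral_indicator measurableSet_Iic, ← lintegral_indicator measurableSet_Iic]
    refine lintegral_congr fun y => ?_
    by_cases h1 : y ≤ T j ω <;> by_cases h2 : y ≤ C j ω <;> simp [k', h1, h2, obsTime]

/-- `f` does not look at the observation with index `j` up to the time at which it is made. -/
def IsFreeOf (P : Measure Ω) (T C : Fin n → Ω → ℝ≥0) (j : Fin n) {β : Type*} [MeasurableSpace β]
    (f : ℝ≥0 × Ω → β) : Prop :=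
  ∃ k : ℝ≥0 × (({j}ᶜ : Finset (Fin n)) → ℝ≥0 × ℝ≥0) → β, Measurable k ∧
    ∀ᵐ ω ∂P, ∀ y, 0 < y → y ≤ obsTime T C j ω → f (y, ω) = k (y, others T C j ω)

lemma isFreeOf_fst {β : Type*} [MeasurableSpace β] {g : ℝ≥0 → β} (hg : Measurable g) :
    IsFreeOf P T C j fun p => g p.1 :=
  ⟨fun q => g q.1, hg.comp measurable_fst, ae_of_all _ fun _ _ _ _ => rfl⟩

lemma IsFreeOf.comp₂ {β γ δ : Type*} [MeasurableSpace β] [MeasurableSpace γ]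
    [MeasurableSpace δ] {f : ℝ≥0 × Ω → β} {g : ℝ≥0 × Ω → γ} (hf : IsFreeOf P T C j f)
    (hg : IsFreeOf P T C j g) {u : β × γ → δ} (hu : Measurable u) :
    IsFreeOf P T C j fun p => u (f p, g p) := by
  obtain ⟨k, hk, hkf⟩ := hf
  obtain ⟨l, hl, hlg⟩ := hg
  refine ⟨fun q => u (k q, l q), hu.comp (hk.prodMk hl), ?_⟩
  filter_upwards [hkf, hlg] with ω h1 h2 y hy hyX
  rw [h1 y hy hyX, h2 y hy hyX]

lemma isFreeOf_jumpAt [IsFiniteMeasure F] {i : Fin n} (hij : i ≠ j) :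
    IsFreeOf P T C j (jumpAt F T C i) := by
  let i' : ({j}ᶜ : Finset (Fin n)) := ⟨i, by simpa using hij⟩
  refine ⟨fun q => (if min (q.2 i').1 (q.2 i').2 = q.1 ∧ (q.2 i').1 ≤ (q.2 i').2 then 1 else 0) -
    (hazard F {q.1}).toReal * (if q.1 ≤ min (q.2 i').1 (q.2 i').2 then 1 else 0), ?_,
    ae_of_all _ fun _ _ _ _ => rfl⟩
  have hi : Measurable fun q : ℝ≥0 × (({j}ᶜ : Finset (Fin n)) → ℝ≥0 × ℝ≥0) => q.2 i' :=
    (measurable_pi_apply i').comp measurable_snd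
  have hmin := hi.fst.min hi.snd
  exact (Measurable.ite ((measurableSet_eq_fun hmin measurable_fst).inter
    (measurableSet_le hi.fst hi.snd)) measurable_const measurable_const).sub
    (((measurable_toReal_hazard_singleton F).comp measurable_fst).mul
      (Measurable.ite (measurableSet_le measurable_fst hmin) measurable_const measurable_const))

lemma IsSample.ae_T_pos (hS : IsSample P F T C) (j : Fin n) : ∀ᵐ ω ∂P, 0 < T j ω := by
  refine ae_of_ae_map (p := fun t => 0 < t) (hS.measurable_T j).aemeasurable ?_
  rw [hS.map_T, ae_iff]
  simpa using hS.singleton_zero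

lemma IsSample.map_countingCampbell [IsFiniteMeasure P] [IsFiniteMeasure F]
    (hS : IsSample P F T C) {β : Type*} [MeasurableSpace β] {f : ℝ≥0 × Ω → β}
    (hf : IsFreeOf P T C j f) (hfm : Measurable f) :
    (countingCampbell P T C j).map f = (compensatorCampbell P F T C j).map f := by
  obtain ⟨k, hk, hfk⟩ := hf
  have hT := hS.measurable_T
  have hC := hS.measurable_C
  have hπ : Measurable fun p : ℝ≥0 × Ω => (p.1, others T C j p.2) :=
    measurable_fst.prodMk ((measurable_others hT hC j).comp measurable_snd)
  have hX := measurable_obsTime_prodMk hT hC j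
  have hcount : (countingCampbell P T C j).map f =
      (countingCampbell P T C j).map (k ∘ fun p => (p.1, others T C j p.2)) := by
    rw [countingCampbell, Measure.map_map hfm hX, Measure.map_map (hk.comp hπ) hX]
    refine Measure.map_congr ((ae_restrict_iff' (measurableSet_uncensored hT hC j)).2 ?_)
    filter_upwards [hfk, hS.ae_T_pos j] with ω h hpos hΔ
    have hXT : obsTime T C j ω = T j ω := min_eq_left hΔ
    exact h _ (hXT ▸ hpos) le_rfl
  have hcomp : f =ᵐ[compensatorCampbell P F T C j] k ∘ fun p => (p.1, others T C j p.2) := by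
    refine (ae_restrict_iff' (measurableSet_le_obsTime hT hC j)).2 ?_
    filter_upwards [Measure.quasiMeasurePreserving_snd.ae hfk,
      Measure.quasiMeasurePreserving_fst.ae (ae_hazard_pos F)] with p h hpos hp
    exact h _ hpos hp
  rw [hcount, Measure.map_congr hcomp, ← Measure.map_map hk hπ, ← Measure.map_map hk hπ,
    hS.map_others_countingCampbell]

lemma IsSample.integral_countingCampbell_eq [IsFiniteMeasure P] [IsFiniteMeasure F]
    (hS : IsSample P F T C) {f : ℝ≥0 × Ω → ℝ} (hf : IsFreeOf P T C j f) (hfm : Measurable f) :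
    ∫ p, f p ∂(countingCampbell P T C j) = ∫ p, f p ∂(compensatorCampbell P F T C j) := by
  calc _ = ∫ x, x ∂((countingCampbell P T C j).map f) :=
        (integral_map hfm.aemeasurable aestronglyMeasurable_id).symm
    _ = ∫ x, x ∂((compensatorCampbell P F T C j).map f) := by rw [hS.map_countingCampbell hf hfm]
    _ = _ := integral_map hfm.aemeasurable aestronglyMeasurable_id

lemma IsSample.lintegral_countingCampbell_eq [IsFiniteMeasure P] [IsFiniteMeasure F]
    (hS : IsSample P F T C) {f : ℝ≥0 × Ω → ℝ≥0∞} (hf : IsFreeOf P T C j f) (hfm : Measurable f) :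
    ∫⁻ p, f p ∂(countingCampbell P T C j) = ∫⁻ p, f p ∂(compensatorCampbell P F T C j) := by
  calc _ = ∫⁻ x, x ∂((countingCampbell P T C j).map f) := (lintegral_map measurable_id hfm).symm
    _ = ∫⁻ x, x ∂((compensatorCampbell P F T C j).map f) := by rw [hS.map_countingCampbell hf hfm]
    _ = _ := lintegral_map measurable_id hfm

instance [IsFiniteMeasure P] : IsFiniteMeasure (countingCampbell P T C j) := by
  rw [countingCampbell]
  infer_instance

lemma IsSample.isFiniteMeasure_compensatorCampbell [IsFiniteMeasure P] [IsFiniteMeasure F]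
    (hS : IsSample P F T C) (j : Fin n) : IsFiniteMeasure (compensatorCampbell P F T C j) := by
  constructor
  rw [← lintegral_one, ← hS.lintegral_countingCampbell_eq (isFreeOf_fst measurable_const)
    measurable_const, lintegral_one]
  exact measure_lt_top _ _

lemma IsSample.lintegral_comp_T (hS : IsSample P F T C) (j : Fin n) {f : ℝ≥0 → ℝ≥0∞}
    (hf : Measurable f) : ∫⁻ ω, f (T j ω) ∂P = ∫⁻ u, f u ∂F := by
  rw [← lintegral_map hf (hS.measurable_T j), hS.map_T]

lemma IsSample.lintegral_hazard_Iic_le [IsProbabilityMeasure F] (hS : IsSample P F T C)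
    (j : Fin n) : ∫⁻ ω, hazard F (Iic (obsTime T C j ω)) ∂P ≤ 1 := by
  calc _ ≤ ∫⁻ ω, hazard F (Iic (T j ω)) ∂P := by gcongr; exact min_le_left _ _
    _ = _ := hS.lintegral_comp_T j (measurable_measure_Iic _)
    _ ≤ 1 := Censored.lintegral_hazard_Iic_le F

lemma IsSample.lintegral_hazard_Iic_sq_le [IsProbabilityMeasure F] (hS : IsSample P F T C)
    (j : Fin n) : ∫⁻ ω, hazard F (Iic (obsTime T C j ω)) ^ 2 ∂P ≤ 2 := by
  calc _ ≤ ∫⁻ ω, hazard F (Iic (T j ω)) ^ 2 ∂P := by gcongr; exact min_le_left _ _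
    _ = _ := hS.lintegral_comp_T j ((measurable_measure_Iic _).pow_const 2)
    _ ≤ 2 := Censored.lintegral_hazard_Iic_sq_le F

lemma IsSample.ae_hazard_Iic_lt_top [IsProbabilityMeasure F] (hS : IsSample P F T C) :
    ∀ᵐ ω ∂P, ∀ j, hazard F (Iic (obsTime T C j ω)) < ∞ := by
  refine ae_all_iff.2 fun j => ae_lt_top
    ((measurable_measure_Iic _).comp (hS.measurable_obsTime j)) ?_
  exact ((hS.lintegral_hazard_Iic_le j).trans_lt ENNReal.one_lt_top).ne

lemma IsSample.ae_finitePaths [IsProbabilityMeasure F] (hS : IsSample P F T C) :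
    ∀ᵐ ω ∂P, ω ∈ finitePaths F T C := by
  filter_upwards [hS.ae_hazard_Iic_lt_top] with ω h
  constructor
  rw [compensatorMeasure_eq_sum, Measure.finsetSum_apply]
  exact ENNReal.sum_lt_top.2 fun i _ => by simpa using h i

end Compensation

section Observed

variable {Ω : Type*} {mΩ : MeasurableSpace Ω} {n : ℕ} {P : Measure Ω} {T C : Fin n → Ω → ℝ≥0}
  {hT : ∀ i, Measurable (T i)} {hC : ∀ i, Measurable (C i)}

lemma measurableSet_obsFiltration_of_null {t : ℝ≥0} {A : Set Ω} (hA : MeasurableSet A)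
    (hA0 : P A = 0) : MeasurableSet[obsFiltration P T C hT hC t] A :=
  MeasurableSpace.measurableSet_generateFrom (Or.inr ⟨hA, hA0⟩)

lemma measurableSet_obsFiltration_of_ae {t : ℝ≥0} {A : Set Ω} (hA : MeasurableSet A)
    (hA0 : ∀ᵐ ω ∂P, ω ∈ A) : MeasurableSet[obsFiltration P T C hT hC t] A := by
  rw [← compl_compl A]
  exact (measurableSet_obsFiltration_of_null hA.compl hA0).compl

lemma measurableSet_obsFiltration_uncensored (i : Fin n) (s : ℝ≥0) :
    MeasurableSet[obsFiltration P T C hT hC s]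
      {ω | obsTime T C i ω ≤ s ∧ ω ∈ {ω | T i ω ≤ C i ω}} :=
  MeasurableSpace.measurableSet_generateFrom (Or.inl (Or.inl ⟨i, s, le_rfl, rfl⟩))

lemma measurableSet_obsFiltration_obsTime (i : Fin n) (s : ℝ≥0) :
    MeasurableSet[obsFiltration P T C hT hC s] {ω | obsTime T C i ω ≤ s ∧ ω ∈ univ} := by
  have hcensored : MeasurableSet[obsFiltration P T C hT hC s]
      {ω | obsTime T C i ω ≤ s ∧ ¬ T i ω ≤ C i ω} :=
    MeasurableSpace.measurableSet_generateFrom (Or.inl (Or.inr ⟨i, s, le_rfl, rfl⟩))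
  convert (measurableSet_obsFiltration_uncensored i s).union hcensored using 1
  ext ω
  simp only [mem_ofPred_eq, mem_union, mem_univ, and_true]
  tauto

lemma measurable_obsFiltration_congr {t : ℝ≥0} {f g : Ω → ℝ}
    (hf : Measurable[obsFiltration P T C hT hC t] f) (hg : Measurable g) (hfg : f =ᵐ[P] g) :
    Measurable[obsFiltration P T C hT hC t] g := by
  have hf' : Measurable f := hf.mono ((obsFiltration P T C hT hC).le t) le_rfl
  intro s hs
  have hne : MeasurableSet {ω | f ω ≠ g ω} := (measurableSet_eq_fun hf' hg).compl
  have hnull : P {ω | f ω ≠ g ω} = 0 := hfg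
  have hsplit : g ⁻¹' s = (f ⁻¹' s \ {ω | f ω ≠ g ω}) ∪ (g ⁻¹' s ∩ {ω | f ω ≠ g ω}) := by
    ext ω
    by_cases h : f ω = g ω <;> simp [h]
  rw [hsplit]
  exact ((hf hs).diff (measurableSet_obsFiltration_of_null hne hnull)).union
    (measurableSet_obsFiltration_of_null ((hg hs).inter hne)
      (measure_mono_null inter_subset_right hnull))

/-- The event `A` is decided by the individuals other than `j` as long as `j` has not been observed
by time `a`. -/
def IsDecidedByOthers (P : Measure Ω) (T C : Fin n → Ω → ℝ≥0) (j : Fin n) (a : ℝ≥0)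
    (A : Set Ω) : Prop :=
  ∃ B : Set (({j}ᶜ : Finset (Fin n)) → ℝ≥0 × ℝ≥0), MeasurableSet B ∧
    ∀ᵐ ω ∂P, a < obsTime T C j ω → (ω ∈ A ↔ others T C j ω ∈ B)

lemma isDecidedByOthers_of_le {j : Fin n} {s a : ℝ≥0} (hs : s ≤ a) (i : Fin n)
    {V : Set (ℝ≥0 × ℝ≥0)} (hV : MeasurableSet V) :
    IsDecidedByOthers P T C j a {ω | obsTime T C i ω ≤ s ∧ (T i ω, C i ω) ∈ V} := by
  rcases eq_or_ne i j with rfl | hij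
  · refine ⟨∅, MeasurableSet.empty, ae_of_all _ fun ω hω => ?_⟩
    simp [(hs.trans_lt hω).not_ge]
  · let i' : ({j}ᶜ : Finset (Fin n)) := ⟨i, by simpa using hij⟩
    refine ⟨{z | min (z i').1 (z i').2 ≤ s} ∩ {z | z i' ∈ V}, ?_, ae_of_all _ fun ω _ => Iff.rfl⟩
    have hi : Measurable fun z : (({j}ᶜ : Finset (Fin n)) → ℝ≥0 × ℝ≥0) => z i' :=
      measurable_pi_apply i'
    exact (measurableSet_le (hi.fst.min hi.snd) measurable_const).inter (hi hV)

lemma isDecidedByOthers_of_measurableSet (j : Fin n) {a : ℝ≥0} {A : Set Ω}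
    (hA : MeasurableSet[obsFiltration P T C hT hC a] A) : IsDecidedByOthers P T C j a A := by
  have hle : MeasurableSet {p : ℝ≥0 × ℝ≥0 | p.1 ≤ p.2} :=
    measurableSet_le measurable_fst measurable_snd
  induction A, hA using MeasurableSpace.generateFrom_induction with
  | hC A hA _ =>
    obtain (⟨i, s, hs, rfl⟩ | ⟨i, s, hs, rfl⟩) | ⟨-, hA0⟩ := hA
    · exact isDecidedByOthers_of_le hs i hle
    · exact isDecidedByOthers_of_le hs i hle.compl
    · refine ⟨∅, MeasurableSet.empty, ?_⟩
      filter_upwards [measure_eq_zero_iff_ae_notMem.1 hA0] with ω hω _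
      simp [hω]
  | empty => exact ⟨∅, MeasurableSet.empty, ae_of_all _ fun _ _ => by simp⟩
  | compl A _ ih =>
    obtain ⟨B, hB, h⟩ := ih
    refine ⟨Bᶜ, hB.compl, ?_⟩
    filter_upwards [h] with ω h hω
    simp [h hω]
  | iUnion s _ ih =>
    choose B hB h using ih
    refine ⟨⋃ k, B k, MeasurableSet.iUnion hB, ?_⟩
    filter_upwards [ae_all_iff.2 h] with ω h hω
    simp only [mem_iUnion]
    exact exists_congr fun k => h k hω

lemma exists_others_of_measurableSet_predictable (j : Fin n) {S : Set (ℝ≥0 × Ω)}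
    (hS : MeasurableSet[(obsFiltration P T C hT hC).predictable] S) :
    ∃ S' : Set (ℝ≥0 × (({j}ᶜ : Finset (Fin n)) → ℝ≥0 × ℝ≥0)), MeasurableSet S' ∧
      ∀ᵐ ω ∂P, ∀ y, 0 < y → y ≤ obsTime T C j ω → ((y, ω) ∈ S ↔ (y, others T C j ω) ∈ S') := by
  induction S, hS using MeasurableSpace.generateFrom_induction with
  | hC S hS _ =>
    obtain ⟨A, -, rfl⟩ | ⟨a, A, hA, rfl⟩ := hS
    · refine ⟨∅, MeasurableSet.empty, ae_of_all _ fun ω y hy _ => ?_⟩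
      simp only [mem_prod, mem_singleton_iff, mem_empty_iff_false, iff_false, not_and]
      rintro rfl
      exact absurd hy not_lt_bot
    · obtain ⟨B, hB, h⟩ := isDecidedByOthers_of_measurableSet j hA
      refine ⟨Ioi a ×ˢ B, measurableSet_Ioi.prod hB, ?_⟩
      filter_upwards [h] with ω h y _ hyX
      simp only [mem_prod, mem_Ioi, and_congr_right_iff]
      exact fun hay => h (hay.trans_le hyX)
  | empty => exact ⟨∅, MeasurableSet.empty, ae_of_all _ fun _ _ _ _ => by simp⟩
  | compl A _ ih =>
    obtain ⟨B, hB, h⟩ := ih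
    refine ⟨Bᶜ, hB.compl, ?_⟩
    filter_upwards [h] with ω h y hy hyX
    simp [h y hy hyX]
  | iUnion s _ ih =>
    choose B hB h using ih
    refine ⟨⋃ k, B k, MeasurableSet.iUnion hB, ?_⟩
    filter_upwards [ae_all_iff.2 h] with ω h y hy hyX
    simp only [mem_iUnion]
    exact exists_congr fun k => h k y hy hyX

lemma isFreeOf_of_predictable_ennreal (j : Fin n) {f : ℝ≥0 × Ω → ℝ≥0∞}
    (hf : Measurable[(obsFiltration P T C hT hC).predictable] f) : IsFreeOf P T C j f := by
  refine @Measurable.ennreal_induction _ (obsFiltration P T C hT hC).predictable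
    (fun f => IsFreeOf P T C j f) ?_ ?_ ?_ f hf
  · intro c S hS
    obtain ⟨S', hS', h⟩ := exists_others_of_measurableSet_predictable j hS
    refine ⟨S'.indicator fun _ => c, measurable_const.indicator hS', ?_⟩
    filter_upwards [h] with ω h y hy hyX
    by_cases hm : (y, ω) ∈ S
    · rw [indicator_of_mem hm, indicator_of_mem ((h y hy hyX).1 hm)]
    · rw [indicator_of_notMem hm, indicator_of_notMem fun h' => hm ((h y hy hyX).2 h')]
  · intro f g _ _ _ hf hg
    exact hf.comp₂ hg (u := fun q => q.1 + q.2) (measurable_fst.add measurable_snd)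
  · intro f _ _ hf
    choose k hk h using hf
    refine ⟨fun q => ⨆ n, k n q, Measurable.iSup hk, ?_⟩
    filter_upwards [ae_all_iff.2 h] with ω h y hy hyX
    exact iSup_congr fun n => h n y hy hyX

lemma isFreeOf_of_predictable (j : Fin n) {f : ℝ≥0 × Ω → ℝ}
    (hf : Measurable[(obsFiltration P T C hT hC).predictable] f) : IsFreeOf P T C j f := by
  have hpos : IsFreeOf P T C j fun p => ENNReal.ofReal (f p) :=
    isFreeOf_of_predictable_ennreal (hT := hT) (hC := hC) j hf.ennreal_ofReal
  have hneg : IsFreeOf P T C j fun p => ENNReal.ofReal (-f p) :=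
    isFreeOf_of_predictable_ennreal (hT := hT) (hC := hC) j hf.neg.ennreal_ofReal
  convert hpos.comp₂ hneg (u := fun q => q.1.toReal - q.2.toReal)
    (measurable_fst.ennreal_toReal.sub measurable_snd.ennreal_toReal) using 2 with p
  rw [ENNReal.toReal_ofReal', ENNReal.toReal_ofReal', max_zero_sub_eq_self]

lemma measurableSet_predictable_univ_prod {𝓕 : Filtration ℝ≥0 mΩ} {A : Set Ω}
    (hA : MeasurableSet[𝓕 0] A) : MeasurableSet[𝓕.predictable] {p : ℝ≥0 × Ω | p.2 ∈ A} := by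
  convert (measurableSet_predictable_singleton_bot_prod (𝓕 := 𝓕) hA).union
    (measurableSet_predictable_Ioi_prod (𝓕 := 𝓕) (i := 0) hA) using 1
  ext p
  rcases eq_or_ne p.1 0 with h | h
  · simp [h]
  · simp [h, pos_iff_ne_zero]

lemma measurable_atRisk_predictable (i : Fin n) :
    Measurable[(obsFiltration P T C hT hC).predictable] fun p : ℝ≥0 × Ω =>
      if p.1 ≤ obsTime T C i p.2 then (1 : ℝ≥0∞) else 0 := by
  have h := measurableSet_predictable_lt
    (measurableSet_obsFiltration_obsTime (P := P) (hT := hT) (hC := hC) i)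
  refine Measurable.ite ?_ measurable_const measurable_const
  convert h.compl using 1
  ext p
  simp

end Observed

section InnerIntegral

variable {Ω : Type*} {mΩ : MeasurableSpace Ω} {n : ℕ} {P : Measure Ω} {F : Measure ℝ≥0}
  {T C : Fin n → Ω → ℝ≥0} {hT : ∀ i, Measurable (T i)} {hC : ∀ i, Measurable (C i)} {ω : Ω}
  {g : ℝ≥0 → ℝ}

lemma integrable_ite_dirac_obsTime (g : ℝ≥0 → ℝ) (i : Fin n) :
    Integrable g (if T i ω ≤ C i ω then Measure.dirac (obsTime T C i ω) else 0) := by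
  split_ifs
  · exact integrable_dirac enorm_lt_top
  · exact integrable_zero_measure

lemma integrable_countingMeasure (g : ℝ≥0 → ℝ) : Integrable g (countingMeasure T C ω) :=
  integrable_finsetSum_measure.2 fun i _ => integrable_ite_dirac_obsTime g i

lemma integral_countingMeasure (g : ℝ≥0 → ℝ) :
    ∫ y, g y ∂(countingMeasure T C ω) =
      ∑ i, if T i ω ≤ C i ω then g (obsTime T C i ω) else 0 := by
  rw [countingMeasure, integral_finsetSum_measure fun i _ => integrable_ite_dirac_obsTime g i]
  refine Finset.sum_congr rfl fun i _ => ?_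
  split_ifs <;> simp

lemma integral_dM (hω : ω ∈ finitePaths F T C)
    (hg : Integrable g (compensatorMeasure F T C ω)) :
    ∫ᵛ y, g y ∂•(dM F T C ω) = (∑ i, if T i ω ≤ C i ω then g (obsTime T C i ω) else 0) -
      ∫ y, g y ∂(compensatorMeasure F T C ω) := by
  have : IsFiniteMeasure (compensatorMeasure F T C ω) := hω
  rw [dM, dif_pos this, VectorMeasure.integral_sub_vectorMeasure, integral_lsmul_toSignedMeasure,
    integral_lsmul_toSignedMeasure, integral_countingMeasure]
  · rw [VectorMeasure.Integrable, Measure.variation_toSignedMeasure]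
    exact integrable_countingMeasure g
  · rwa [VectorMeasure.Integrable, Measure.variation_toSignedMeasure]

/-- The cancellation between the atoms of `dN` and of `Y dΛ` is confined to the finitely many jump
times of `N`, so it cannot make a function integrable. -/
lemma integrable_dM_iff [IsFiniteMeasure F] (hT : ∀ i, Measurable (T i))
    (hC : ∀ i, Measurable (C i)) (hω : ω ∈ finitePaths F T C) :
    (dM F T C ω).Integrable g ↔ Integrable g (compensatorMeasure F T C ω) := by
  have : IsFiniteMeasure (compensatorMeasure F T C ω) := hω
  rw [VectorMeasure.Integrable, variation_dM hT hC, pathMeasure_of_mem hω]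
  constructor
  · intro h
    have hjump : IntegrableOn g (jumpTimes T C ω) (compensatorMeasure F T C ω) := by
      refine IntegrableOn.finset
    have hcompl : IntegrableOn g (jumpTimes T C ω : Set ℝ≥0)ᶜ (compensatorMeasure F T C ω) := by
      refine h.mono_measure (Measure.le_iff.2 fun s hs => ?_)
      have hS := (jumpTimes T C ω).measurableSet.compl
      rw [Measure.restrict_apply hs, withDensity_apply _ hs]
      calc compensatorMeasure F T C ω (s ∩ (jumpTimes T C ω : Set ℝ≥0)ᶜ)
          = ∫⁻ y in s ∩ (jumpTimes T C ω : Set ℝ≥0)ᶜ, ‖signDensity F T C ω y‖ₑ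
              ∂(compensatorMeasure F T C ω) := by
            rw [← setLIntegral_one]
            refine setLIntegral_congr_fun (hs.inter hS) fun y hy => ?_
            simp [signDensity_of_notMem_jumpTimes (F := F) hy.2]
        _ ≤ ∫⁻ y in s, ‖signDensity F T C ω y‖ₑ
              ∂(countingMeasure T C ω + compensatorMeasure F T C ω) :=
            lintegral_mono' (Measure.restrict_mono inter_subset_left
              (Measure.le_add_left le_rfl)) le_rfl
    rw [← integrableOn_univ, ← union_compl_self (jumpTimes T C ω : Set ℝ≥0)]
    exact hjump.union hcompl
  · intro h
    refine ((integrable_countingMeasure (T := T) (C := C) (ω := ω) g).add_measure h).mono_measure ?_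
    conv_rhs => rw [← withDensity_one (μ := countingMeasure T C ω + compensatorMeasure F T C ω)]
    exact withDensity_mono (ae_of_all _ fun y => enorm_signDensity_le_one F T C ω y)

lemma measurable_lintegral_compensatorMeasure_predictable [IsFiniteMeasure F]
    {f : ℝ≥0 × ℝ≥0 × Ω → ℝ≥0∞} (hf : Measurable[twoTimePredictable (obsFiltration P T C hT hC)] f)
    (hf0 : ∀ q ∉ orderedPairs Ω, f q = 0) :
    Measurable[(obsFiltration P T C hT hC).predictable] fun p : ℝ≥0 × Ω =>
      ∫⁻ x, f (x, p) ∂(compensatorMeasure F T C p.2) := by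
  simp_rw [lintegral_compensatorMeasure]
  refine Finset.measurable_sum _ fun i _ => ?_
  have hw : Measurable[(obsFiltration P T C hT hC).predictable] fun p : ℝ≥0 × Ω =>
      (F (Ici p.1))⁻¹ * if p.1 ≤ obsTime T C i p.2 then (1 : ℝ≥0∞) else 0 :=
    ((measurable_measure_Ici F).inv.comp measurable_fst_predictable).mul
      (measurable_atRisk_predictable i)
  convert measurable_lintegral_Ioo_predictable F ((measurable_orderedPairs_fst hw).mul hf)
    using 2 with p
  have hfm : Measurable fun x => f (x, p) := hf.comp (measurable_prodMk_twoTimePredictable p)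
  rw [setLIntegral_hazard F hfm measurableSet_Iic,
    ← lintegral_indicator (measurableSet_Iic.inter measurableSet_Ioi),
    ← lintegral_indicator measurableSet_Ioo]
  refine lintegral_congr fun x => ?_
  by_cases hq : ((x, p) : ℝ≥0 × ℝ≥0 × Ω) ∈ orderedPairs Ω
  · have hx : x ∈ Ioo 0 p.1 := hq
    simp [indicator_apply, hq, hx, hx.1]
  · simp [indicator_apply, hf0 _ hq]

lemma measurable_sum_uncensored_predictable {f : ℝ≥0 × ℝ≥0 × Ω → ℝ}
    (hf : Measurable[twoTimePredictable (obsFiltration P T C hT hC)] f)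
    (hf0 : ∀ q ∉ orderedPairs Ω, f q = 0) :
    Measurable[(obsFiltration P T C hT hC).predictable] fun p : ℝ≥0 × Ω =>
      ∑ i, if T i p.2 ≤ C i p.2 then f (obsTime T C i p.2, p) else 0 := by
  refine Finset.measurable_sum _ fun i _ => ?_
  convert measurable_eval_predictable
    (measurableSet_obsFiltration_uncensored (P := P) (hT := hT) (hC := hC) i) hf using 2 with p
  by_cases hq : ((obsTime T C i p.2, p) : ℝ≥0 × ℝ≥0 × Ω) ∈ orderedPairs Ω
  · simp [indicator_apply, show obsTime T C i p.2 < p.1 from hq.2]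
  · simp [indicator_apply, hf0 _ hq]

open Classical in
lemma integral_dM_eq_ite [IsFiniteMeasure F] (hT : ∀ i, Measurable (T i))
    (hC : ∀ i, Measurable (C i)) (hg : Measurable g) :
    ∫ᵛ y, g y ∂•(dM F T C ω) =
      if ω ∈ finitePaths F T C ∧ ∫⁻ y, ‖g y‖ₑ ∂(compensatorMeasure F T C ω) < ∞ then
        (∑ i, if T i ω ≤ C i ω then g (obsTime T C i ω) else 0) -
          ((∫⁻ y, ENNReal.ofReal (g y) ∂(compensatorMeasure F T C ω)).toReal -
            (∫⁻ y, ENNReal.ofReal (-g y) ∂(compensatorMeasure F T C ω)).toReal)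
      else 0 := by
  by_cases hω : ω ∈ finitePaths F T C
  · by_cases hi : ∫⁻ y, ‖g y‖ₑ ∂(compensatorMeasure F T C ω) < ∞
    · have hint : Integrable g (compensatorMeasure F T C ω) := ⟨hg.aestronglyMeasurable, hi⟩
      rw [if_pos ⟨hω, hi⟩, integral_dM hω hint,
        integral_eq_lintegral_pos_part_sub_lintegral_neg_part hint]
    · rw [if_neg fun h => hi h.2, VectorMeasure.integral_undef]
      rw [integrable_dM_iff hT hC hω]
      exact fun h => hi h.2
  · have hinf : ¬ IsFiniteMeasure (compensatorMeasure F T C ω) := hω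
    rw [if_neg fun h => hω h.1, dM, dif_neg hinf, VectorMeasure.integral_zero_vectorMeasure]

lemma IsSample.measurable_integral_dM_predictable [IsProbabilityMeasure P]
    [IsProbabilityMeasure F] (hS : IsSample P F T C) {f : ℝ≥0 × ℝ≥0 × Ω → ℝ}
    (hf : Measurable[twoTimePredictable (obsFiltration P T C hT hC)] f)
    (hf0 : ∀ q ∉ orderedPairs Ω, f q = 0) :
    Measurable[(obsFiltration P T C hT hC).predictable] fun p : ℝ≥0 × Ω =>
      ∫ᵛ x, f (x, p) ∂•(dM F T C p.2) := by
  have hcomp {φ : ℝ → ℝ≥0∞} (hφ : Measurable φ) (hφ0 : φ 0 = 0) :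
      Measurable[(obsFiltration P T C hT hC).predictable] fun p : ℝ≥0 × Ω =>
        ∫⁻ x, φ (f (x, p)) ∂(compensatorMeasure F T C p.2) :=
    measurable_lintegral_compensatorMeasure_predictable (hφ.comp hf)
      fun q hq => by simp [hf0 q hq, hφ0]
  have hfinite : MeasurableSet[(obsFiltration P T C hT hC).predictable]
      {p : ℝ≥0 × Ω | p.2 ∈ finitePaths F T C} :=
    measurableSet_predictable_univ_prod
      (measurableSet_obsFiltration_of_ae (measurableSet_finitePaths hT hC) hS.ae_finitePaths)
  have hev := measurable_sum_uncensored_predictable hf hf0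
  convert Measurable.ite
    (hfinite.inter (measurableSet_lt (hcomp measurable_enorm (by simp)) measurable_const))
    (hev.sub ((hcomp ENNReal.measurable_ofReal (by simp)).ennreal_toReal.sub
      (hcomp measurable_neg.ennreal_ofReal (by simp)).ennreal_toReal)) measurable_const with p
  exact integral_dM_eq_ite hT hC (hf.comp (measurable_prodMk_twoTimePredictable p))

lemma setIntegral_Ioo_eq_integral_orderedPairs (h : ℝ≥0 → ℝ≥0 → Ω → ℝ) (ν : SignedMeasure ℝ≥0)
    (p : ℝ≥0 × Ω) :
    ∫ᵛ x in Ioo 0 p.1, h x p.1 p.2 ∂•ν =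
      ∫ᵛ x, (orderedPairs Ω).indicator (fun q => h q.1 q.2.1 q.2.2) (x, p) ∂•ν := by
  rw [← VectorMeasure.integral_indicator measurableSet_Ioo]
  rfl

/-- The inner integral only sees `dM` on `(0, y)`, which is known strictly before time `y`. -/
lemma IsSample.measurable_setIntegral_Ioo_predictable [IsProbabilityMeasure P]
    [IsProbabilityMeasure F] (hS : IsSample P F T C) {h : ℝ≥0 → ℝ≥0 → Ω → ℝ}
    (hh : IsTwoTimePredictable (obsFiltration P T C hT hC) h) :
    Measurable[(obsFiltration P T C hT hC).predictable] fun p : ℝ≥0 × Ω =>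
      ∫ᵛ x in Ioo 0 p.1, h x p.1 p.2 ∂•(dM F T C p.2) := by
  simp_rw [setIntegral_Ioo_eq_integral_orderedPairs]
  exact hS.measurable_integral_dM_predictable hh.measurable_indicator
    fun q hq => indicator_of_notMem hq _

end InnerIntegral

section StochIntegral

variable {Ω : Type*} {mΩ : MeasurableSpace Ω} {n : ℕ} {P : Measure Ω} {F : Measure ℝ≥0}
  {T C : Fin n → Ω → ℝ≥0} {K : ℝ≥0 × Ω → ℝ}

/-- The integral `∫ K dM` along each path. -/
def stochIntegral (F : Measure ℝ≥0) (T C : Fin n → Ω → ℝ≥0) (K : ℝ≥0 × Ω → ℝ) (ω : Ω) : ℝ :=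
  ∫ᵛ y, K (y, ω) ∂•(dM F T C ω)

/-- The absolute moment `E ∫ |K| |dM|`. -/
def absMoment (P : Measure Ω) (F : Measure ℝ≥0) (T C : Fin n → Ω → ℝ≥0) (K : ℝ≥0 × Ω → ℝ) :
    ℝ≥0∞ :=
  ∫⁻ ω, ∫⁻ y, ‖K (y, ω)‖ₑ ∂(dM F T C ω).variation ∂P

/-- The second moment `E ∫ K² d⟨M⟩`. -/
def varMoment (P : Measure Ω) (F : Measure ℝ≥0) (T C : Fin n → Ω → ℝ≥0) (K : ℝ≥0 × Ω → ℝ) :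
    ℝ≥0∞ :=
  ∫⁻ ω, ∫⁻ y, ‖K (y, ω)‖ₑ ^ 2 ∂(varM F T C ω) ∂P

lemma absMoment_mono {K L : ℝ≥0 × Ω → ℝ} (hKL : ∀ p, |K p| ≤ |L p|) :
    absMoment P F T C K ≤ absMoment P F T C L :=
  lintegral_mono fun _ => lintegral_mono fun _ => enorm_le_iff_norm_le.2 (hKL _)

lemma varMoment_mono {K L : ℝ≥0 × Ω → ℝ} (hKL : ∀ p, |K p| ≤ |L p|) :
    varMoment P F T C K ≤ varMoment P F T C L := by
  unfold varMoment
  gcongr with ω y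
  exact enorm_le_iff_norm_le.2 (hKL _)

section Paths

variable [IsFiniteMeasure F] (hT : ∀ i, Measurable (T i)) (hC : ∀ i, Measurable (C i))
include hT hC

lemma stochIntegral_eq_integral_pathMeasure (K : ℝ≥0 × Ω → ℝ) (ω : Ω) :
    stochIntegral F T C K ω =
      ∫ y, K (y, ω) * signDensity F T C ω y ∂(pathMeasure F T C ω) := by
  rw [stochIntegral, dM_eq_withDensityᵥ hT hC, integral_withDensityᵥ
    (measurable_signDensity_apply hT hC ω) (integrable_signDensity hT hC _ ω)]

lemma integrable_dM_iff_integrable_pathMeasure (g : ℝ≥0 → ℝ) (ω : Ω) :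
    (dM F T C ω).Integrable g ↔
      Integrable (fun y => g y * signDensity F T C ω y) (pathMeasure F T C ω) := by
  rw [dM_eq_withDensityᵥ hT hC, integrable_withDensityᵥ_iff
    (measurable_signDensity_apply hT hC ω) (integrable_signDensity hT hC _ ω)]

lemma lintegral_variation_dM (hK : Measurable K) (ω : Ω) :
    ∫⁻ y, ‖K (y, ω)‖ₑ ∂(dM F T C ω).variation =
      ∫⁻ y, ‖K (y, ω) * signDensity F T C ω y‖ₑ ∂(pathMeasure F T C ω) := by
  have hKω : Measurable fun y => K (y, ω) := hK.comp measurable_prodMk_right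
  rw [variation_dM hT hC, lintegral_withDensity_eq_lintegral_mul _
    (measurable_signDensity_apply hT hC ω).enorm hKω.enorm]
  simp only [Pi.mul_apply, enorm_mul, mul_comm]

lemma measurable_mul_signDensity (hK : Measurable K) :
    Measurable fun q : Ω × ℝ≥0 => K (q.2, q.1) * signDensity F T C q.1 q.2 :=
  (hK.mul (measurable_signDensity hT hC)).comp measurable_swap

lemma measurable_stochIntegral (hK : Measurable K) : Measurable (stochIntegral F T C K) := by
  have h := (StronglyMeasurable.integral_kernel_prod_right' (κ := pathKernel F hT hC)
    (measurable_mul_signDensity (F := F) hT hC hK).stronglyMeasurable).measurable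
  simp only [pathKernel_apply, ← stochIntegral_eq_integral_pathMeasure hT hC] at h
  exact h

lemma integrable_stochIntegral (hK : Measurable K) (hi : absMoment P F T C K < ∞) :
    Integrable (stochIntegral F T C K) P := by
  refine ⟨(measurable_stochIntegral hT hC hK).aestronglyMeasurable, lt_of_le_of_lt ?_ hi⟩
  exact lintegral_mono fun ω => enorm_integral_lsmul_le_lintegral_enorm _ _

section Moments

variable [SFinite P]

lemma absMoment_eq_lintegral_compProd (hK : Measurable K) :
    absMoment P F T C K = ∫⁻ q, ‖K (q.2, q.1) * signDensity F T C q.1 q.2‖ₑ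
      ∂(P ⊗ₘ pathKernel F hT hC) := by
  rw [Measure.lintegral_compProd (measurable_mul_signDensity hT hC hK).enorm]
  refine lintegral_congr fun ω => ?_
  rw [lintegral_variation_dM hT hC hK, pathKernel_apply]

lemma integrable_compProd_of_absMoment_lt_top (hK : Measurable K)
    (hi : absMoment P F T C K < ∞) :
    Integrable (fun q : Ω × ℝ≥0 => K (q.2, q.1) * signDensity F T C q.1 q.2)
      (P ⊗ₘ pathKernel F hT hC) := by
  refine ⟨(measurable_mul_signDensity hT hC hK).aestronglyMeasurable, ?_⟩
  rwa [hasFiniteIntegral_iff_enorm, ← absMoment_eq_lintegral_compProd hT hC hK]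

lemma integral_stochIntegral (hK : Measurable K) (hi : absMoment P F T C K < ∞) :
    ∫ ω, stochIntegral F T C K ω ∂P =
      ∫ q, K (q.2, q.1) * signDensity F T C q.1 q.2 ∂(P ⊗ₘ pathKernel F hT hC) := by
  rw [Measure.integral_compProd (integrable_compProd_of_absMoment_lt_top hT hC hK hi)]
  simp only [pathKernel_apply, stochIntegral_eq_integral_pathMeasure hT hC]

lemma ae_integrable_dM (hK : Measurable K) (hi : absMoment P F T C K < ∞) :
    ∀ᵐ ω ∂P, (dM F T C ω).Integrable fun y => K (y, ω) := by
  have h := integrable_compProd_of_absMoment_lt_top hT hC hK hi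
  filter_upwards [((Measure.integrable_compProd_iff h.1).1 h).1] with ω hω
  rwa [integrable_dM_iff_integrable_pathMeasure hT hC, ← pathKernel_apply hT hC]

end Moments

end Paths

lemma IsSample.memLp_one_add_pathMeasure_univ [IsFiniteMeasure P] [IsProbabilityMeasure F]
    (hS : IsSample P F T C) : MemLp (fun ω => 1 + pathMeasure F T C ω univ) 2 P := by
  have hT := hS.measurable_T
  have hC := hS.measurable_C
  have hhaz (j : Fin n) : MemLp (fun ω => hazard F (Iic (obsTime T C j ω))) 2 P := by
    have hm : Measurable fun ω => hazard F (Iic (obsTime T C j ω)) :=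
      (measurable_measure_Iic _).comp (hS.measurable_obsTime j)
    refine ⟨hm.aestronglyMeasurable, ?_⟩
    rw [eLpNorm_lt_top_iff_lintegral_rpow_enorm_lt_top two_ne_zero ENNReal.ofNat_ne_top]
    simpa using (hS.lintegral_hazard_Iic_sq_le j).trans_lt ENNReal.ofNat_lt_top
  have hmeas : Measurable fun ω => pathMeasure F T C ω univ := by
    simp_rw [← pathKernel_apply hT hC]
    exact Kernel.measurable_coe _ MeasurableSet.univ
  have hsum := (memLp_const_enorm (μ := P) (p := 2) (c := (1 + n : ℝ≥0∞)) (by simp)).add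
    (memLp_finsetSum Finset.univ fun j _ => hhaz j)
  refine hsum.of_le_enorm (measurable_const.add hmeas).aestronglyMeasurable
    (ae_of_all _ fun ω => ?_)
  simpa [add_assoc] using add_le_add_right (pathMeasure_univ_le F T C ω) 1

lemma IsSample.absMoment_lt_top_of_le [IsFiniteMeasure P] [IsProbabilityMeasure F]
    (hS : IsSample P F T C) (hK : Measurable K) {c : ℝ≥0∞} (hc : c ≠ ∞)
    (hKc : ∀ p, ‖K p‖ₑ ≤ c * (1 + pathMeasure F T C p.2 univ)) : absMoment P F T C K < ∞ := by
  have hsq : ∫⁻ ω, (1 + pathMeasure F T C ω univ) ^ 2 ∂P < ∞ := by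
    simpa using (eLpNorm_lt_top_iff_lintegral_rpow_enorm_lt_top two_ne_zero
      ENNReal.ofNat_ne_top).1 hS.memLp_one_add_pathMeasure_univ.2
  refine lt_of_le_of_lt ?_ (ENNReal.mul_lt_top hc.lt_top hsq)
  rw [← lintegral_const_mul' _ _ hc]
  refine lintegral_mono fun ω => ?_
  rw [lintegral_variation_dM hS.measurable_T hS.measurable_C hK]
  calc ∫⁻ y, ‖K (y, ω) * signDensity F T C ω y‖ₑ ∂(pathMeasure F T C ω)
      ≤ ∫⁻ _, c * (1 + pathMeasure F T C ω univ) ∂(pathMeasure F T C ω) := by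
        gcongr with y
        rw [enorm_mul]
        exact (mul_le_of_le_one_right' (enorm_signDensity_le_one F T C ω y)).trans (hKc (y, ω))
    _ = c * ((1 + pathMeasure F T C ω univ) * pathMeasure F T C ω univ) := by
        rw [lintegral_const, mul_assoc]
    _ ≤ c * (1 + pathMeasure F T C ω univ) ^ 2 := by
        rw [sq]
        gcongr
        exact le_add_self

lemma IsSample.absMoment_lt_top_of_bound [IsFiniteMeasure P] [IsProbabilityMeasure F]
    (hS : IsSample P F T C) (hK : Measurable K) {c : ℝ} (hc : ∀ p, |K p| ≤ c) :
    absMoment P F T C K < ∞ := by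
  refine hS.absMoment_lt_top_of_le hK (c := ENNReal.ofReal c) ENNReal.ofReal_ne_top fun p => ?_
  rw [Real.enorm_eq_ofReal_abs]
  exact (ENNReal.ofReal_le_ofReal (hc p)).trans (le_mul_of_one_le_right' le_self_add)

lemma IsSample.integral_stochIntegral_eq_sum [IsFiniteMeasure P] [IsProbabilityMeasure F]
    (hS : IsSample P F T C) (hK : Measurable K) {c : ℝ} (hc : ∀ p, |K p| ≤ c) :
    ∫ ω, stochIntegral F T C K ω ∂P =
      ∑ j, (∫ p, K p ∂(countingCampbell P T C j) - ∫ p, K p ∂(compensatorCampbell P F T C j)) := by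
  have hT := hS.measurable_T
  have hC := hS.measurable_C
  have hcount (j : Fin n) :
      Integrable (fun ω => if T j ω ≤ C j ω then K (obsTime T C j ω, ω) else 0) P :=
    Integrable.of_bound (Measurable.ite (measurableSet_uncensored hT hC j)
      (hK.comp (measurable_obsTime_prodMk hT hC j)) measurable_const).aestronglyMeasurable |c|
      (ae_of_all _ fun ω => by
        split_ifs
        · exact (hc _).trans (le_abs_self c)
        · simp)
  have hcomp (j : Fin n) : Integrable K (compensatorCampbell P F T C j) :=
    have := hS.isFiniteMeasure_compensatorCampbell j
    Integrable.of_bound hK.aestronglyMeasurable c (ae_of_all _ hc)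
  have hsplit : stochIntegral F T C K =ᵐ[P] fun ω =>
      ∑ j, ((if T j ω ≤ C j ω then K (obsTime T C j ω, ω) else 0) -
        ∫ y in Iic (obsTime T C j ω), K (y, ω) ∂(hazard F)) := by
    filter_upwards [hS.ae_finitePaths] with ω hω
    have : IsFiniteMeasure (compensatorMeasure F T C ω) := hω
    have hi : Integrable (fun y => K (y, ω)) (compensatorMeasure F T C ω) :=
      Integrable.of_bound (hK.comp measurable_prodMk_right).aestronglyMeasurable c
        (ae_of_all _ fun y => hc _)
    rw [stochIntegral, integral_dM hω hi, Finset.sum_sub_distrib]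
    rw [compensatorMeasure_eq_sum] at hi ⊢
    rw [integral_finsetSum_measure (integrable_finsetSum_measure.1 hi)]
  have hdiff (j : Fin n) :
      Integrable (fun ω => (if T j ω ≤ C j ω then K (obsTime T C j ω, ω) else 0) -
        ∫ y in Iic (obsTime T C j ω), K (y, ω) ∂(hazard F)) P :=
    (hcount j).sub (integrable_compensatorCampbell hT hC (hcomp j))
  rw [integral_congr_ae hsplit, integral_finsetSum _ fun j _ => hdiff j]
  refine Finset.sum_congr rfl fun j _ => ?_
  rw [integral_sub (hcount j) (integrable_compensatorCampbell hT hC (hcomp j)),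
    integral_countingCampbell hT hC j hK, integral_compensatorCampbell hT hC (hcomp j)]

section Truncation

/-- The process `K` set to `0` where it exceeds `k` in absolute value. -/
def truncate (k : ℕ) (K : ℝ≥0 × Ω → ℝ) (p : ℝ≥0 × Ω) : ℝ := if |K p| ≤ k then K p else 0

lemma abs_truncate_le (k : ℕ) (K : ℝ≥0 × Ω → ℝ) (p : ℝ≥0 × Ω) : |truncate k K p| ≤ k := by
  unfold truncate
  split_ifs with h
  · exact h
  · simp

lemma abs_truncate_le_abs (k : ℕ) (K : ℝ≥0 × Ω → ℝ) (p : ℝ≥0 × Ω) : |truncate k K p| ≤ |K p| := by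
  unfold truncate
  split_ifs
  · exact le_rfl
  · simp

lemma abs_sub_truncate_le_abs (k : ℕ) (K : ℝ≥0 × Ω → ℝ) (p : ℝ≥0 × Ω) :
    |(K - truncate k K) p| ≤ |K p| := by
  rw [Pi.sub_apply, truncate]
  split_ifs <;> simp

lemma measurable_truncate {m : MeasurableSpace (ℝ≥0 × Ω)} (hK : Measurable[m] K) (k : ℕ) :
    Measurable[m] (truncate k K) :=
  Measurable.ite (measurableSet_le hK.abs measurable_const) hK measurable_const

lemma eventually_truncate_eq (K : ℝ≥0 × Ω → ℝ) (p : ℝ≥0 × Ω) :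
    ∀ᶠ k in Filter.atTop, truncate k K p = K p := by
  filter_upwards [tendsto_natCast_atTop_atTop.eventually_ge_atTop |K p|] with k hk
  exact if_pos hk

lemma tendsto_integral_stochIntegral_truncate [SFinite P] [IsFiniteMeasure F]
    (hT : ∀ i, Measurable (T i)) (hC : ∀ i, Measurable (C i)) (hK : Measurable K)
    (hi : absMoment P F T C K < ∞) :
    Filter.Tendsto (fun k => ∫ ω, stochIntegral F T C (truncate k K) ω ∂P) Filter.atTop
      (nhds (∫ ω, stochIntegral F T C K ω ∂P)) := by
  rw [integral_stochIntegral hT hC hK hi]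
  have htrunc (k : ℕ) : absMoment P F T C (truncate k K) < ∞ :=
    (absMoment_mono (abs_truncate_le_abs k K)).trans_lt hi
  simp_rw [fun k => integral_stochIntegral hT hC (measurable_truncate hK k) (htrunc k)]
  refine tendsto_integral_of_dominated_convergence _
    (fun k => (measurable_mul_signDensity hT hC (measurable_truncate hK k)).aestronglyMeasurable)
    (integrable_compProd_of_absMoment_lt_top hT hC hK hi).norm (fun k => ae_of_all _ fun q => ?_)
    (ae_of_all _ fun q => tendsto_const_nhds.congr' ?_)
  · rw [norm_mul, norm_mul]
    gcongr
    exact abs_truncate_le_abs k K _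
  · filter_upwards [eventually_truncate_eq K (q.2, q.1)] with k hk
    rw [hk]

end Truncation

lemma IsSample.integral_stochIntegral_eq_zero [IsProbabilityMeasure P] [IsProbabilityMeasure F]
    {hT : ∀ i, Measurable (T i)} {hC : ∀ i, Measurable (C i)} (hS : IsSample P F T C)
    (hK : Measurable[(obsFiltration P T C hT hC).predictable] K)
    (hi : absMoment P F T C K < ∞) : ∫ ω, stochIntegral F T C K ω ∂P = 0 := by
  refine tendsto_nhds_unique (tendsto_integral_stochIntegral_truncate hT hC
    (hK.mono predictable_le_prod le_rfl) hi) (tendsto_const_nhds.congr fun k => ?_)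
  have hk := measurable_truncate hK k
  have hkm := hk.mono predictable_le_prod le_rfl
  rw [hS.integral_stochIntegral_eq_sum hkm (abs_truncate_le k K)]
  refine (Finset.sum_eq_zero fun j _ => sub_eq_zero.2 ?_).symm
  exact hS.integral_countingCampbell_eq (isFreeOf_of_predictable j hk) hkm

end StochIntegral

section SquareOfIntegral

variable {α : Type*} [LinearOrder α] [TopologicalSpace α] [OrderClosedTopology α]
  [SecondCountableTopology α] [MeasurableSpace α] [OpensMeasurableSpace α] {μ : Measure α}
  [SFinite μ] {g : α → ℝ}

lemma integral_prod_indicator_lt (hg : Integrable g μ) :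
    ∫ p, {p : α × α | p.1 < p.2}.indicator (fun p => g p.1 * g p.2) p ∂(μ.prod μ) =
      ∫ y, (∫ x in Iio y, g x ∂μ) * g y ∂μ := by
  rw [integral_prod_symm _
    ((hg.mul_prod hg).indicator (measurableSet_lt measurable_fst measurable_snd))]
  refine integral_congr_ae (ae_of_all _ fun y => ?_)
  dsimp only
  rw [← integral_mul_const, ← integral_indicator measurableSet_Iio]
  rfl

lemma integral_prod_indicator_gt (hg : Integrable g μ) :
    ∫ p, {p : α × α | p.2 < p.1}.indicator (fun p => g p.1 * g p.2) p ∂(μ.prod μ) =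
      ∫ y, (∫ x in Iio y, g x ∂μ) * g y ∂μ := by
  rw [← integral_prod_indicator_lt hg, ← integral_prod_swap]
  simp [indicator_apply, mul_comm]

lemma integral_prod_indicator_eq (hg : Integrable g μ) :
    ∫ p, {p : α × α | p.1 = p.2}.indicator (fun p => g p.1 * g p.2) p ∂(μ.prod μ) =
      ∫ y, g y * (μ.real {y} * g y) ∂μ := by
  have hdiag : MeasurableSet {p : α × α | p.1 = p.2} :=
    measurableSet_eq_fun measurable_fst measurable_snd
  rw [integral_prod_symm _ ((hg.mul_prod hg).indicator hdiag)]
  refine integral_congr_ae (ae_of_all _ fun y => ?_)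
  have hline (x : α) : {p : α × α | p.1 = p.2}.indicator (fun p => g p.1 * g p.2) (x, y) =
      ({y} : Set α).indicator (fun x => g x * g y) x := rfl
  simp_rw [hline]
  rw [integral_indicator (measurableSet_singleton y), integral_singleton, smul_eq_mul]
  ring

lemma sq_integral_eq (hg : Integrable g μ) :
    (∫ y, g y ∂μ) ^ 2 =
      2 * ∫ y, (∫ x in Iio y, g x ∂μ) * g y ∂μ + ∫ y, g y * (μ.real {y} * g y) ∂μ := by
  have hgg : Integrable (fun p : α × α => g p.1 * g p.2) (μ.prod μ) := hg.mul_prod hg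
  have hlt := hgg.indicator (measurableSet_lt measurable_fst measurable_snd)
  have hgt := hgg.indicator (measurableSet_lt measurable_snd measurable_fst)
  have heq := hgg.indicator (measurableSet_eq_fun measurable_fst measurable_snd)
  have hsplit : (fun p : α × α => g p.1 * g p.2) =
      {p : α × α | p.1 < p.2}.indicator (fun p => g p.1 * g p.2) +
        {p : α × α | p.2 < p.1}.indicator (fun p => g p.1 * g p.2) +
        {p : α × α | p.1 = p.2}.indicator (fun p => g p.1 * g p.2) := by
    ext p
    rcases lt_trichotomy p.1 p.2 with h | h | h
    · simp [h, h.ne, h.le]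
    · simp [h]
    · simp [h, h.ne', h.le]
  rw [sq, ← integral_prod_mul, hsplit, integral_add' (hlt.add hgt) heq,
    integral_add' hlt hgt, integral_prod_indicator_lt hg, integral_prod_indicator_gt hg,
    integral_prod_indicator_eq hg]
  ring

end SquareOfIntegral

section Isometry

variable {Ω : Type*} {mΩ : MeasurableSpace Ω} {n : ℕ} {P : Measure Ω} {F : Measure ℝ≥0}
  {T C : Fin n → Ω → ℝ≥0}

lemma abs_jumpAt_le_one (F : Measure ℝ≥0) (T C : Fin n → Ω → ℝ≥0) (i : Fin n) (p : ℝ≥0 × Ω) :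
    |jumpAt F T C i p| ≤ 1 := by
  obtain ⟨h0, h1⟩ := toReal_hazard_singleton_mem F p.1
  unfold jumpAt
  rw [abs_le]
  split_ifs <;> constructor <;> linarith

lemma IsSample.ae_pathMeasure_zero (hS : IsSample P F T C) :
    ∀ᵐ ω ∂P, pathMeasure F T C ω {0} = 0 := by
  filter_upwards [ae_all_iff.2 hS.ae_T_pos] with ω hpos
  by_cases hω : ω ∈ finitePaths F T C
  · rw [pathMeasure_of_mem hω, Measure.add_apply,
      countingMeasure_apply T C ω (measurableSet_singleton 0), compensatorMeasure,
      withDensity_absolutelyContinuous _ _ (hazard_zero F), add_zero]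
    refine Finset.sum_eq_zero fun i _ => ite_eq_right_iff.2 fun hi => indicator_of_notMem ?_ _
    exact fun h => (hpos i).ne' ((min_eq_left hi).symm.trans h)
  · simp [pathMeasure_of_notMem hω]

section Paths

variable [IsFiniteMeasure F] (hT : ∀ i, Measurable (T i)) (hC : ∀ i, Measurable (C i))
include hT hC

lemma measureReal_pathMeasure_singleton_mul {ω : Ω} (hω : ω ∈ finitePaths F T C) (y : ℝ≥0) :
    (pathMeasure F T C ω).real {y} * signDensity F T C ω y = ∑ i, jumpAt F T C i (y, ω) := by
  rw [← smul_eq_mul, ← integral_singleton,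
    setIntegral_signDensity hT hC hω (measurableSet_singleton y),
    measureReal_countingMeasure_singleton, measureReal_compensatorMeasure_singleton, sum_jumpAt]

lemma sq_integral_dM {ω : Ω} (hω : ω ∈ finitePaths F T C) (h0 : pathMeasure F T C ω {0} = 0)
    {g : ℝ≥0 → ℝ} (hg : (dM F T C ω).Integrable g) :
    (∫ᵛ y, g y ∂•(dM F T C ω)) ^ 2 =
      2 * ∫ᵛ y, g y * (∫ᵛ x in Ioo 0 y, g x ∂•(dM F T C ω)) ∂•(dM F T C ω) +
        ∫ᵛ y, ∑ i, g y ^ 2 * jumpAt F T C i (y, ω) ∂•(dM F T C ω) := by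
  have hIio (y : ℝ≥0) : ∫ᵛ x in Ioo 0 y, g x ∂•(dM F T C ω) =
      ∫ x in Iio y, g x * signDensity F T C ω x ∂(pathMeasure F T C ω) := by
    have hae : Ioo 0 y =ᵐ[pathMeasure F T C ω] Iio y := by
      filter_upwards [compl_mem_ae_iff.2 h0] with x hx
      exact propext (and_iff_right (pos_iff_ne_zero.2 hx))
    rw [← VectorMeasure.integral_indicator measurableSet_Ioo, dM_eq_withDensityᵥ hT hC,
      integral_withDensityᵥ (measurable_signDensity_apply hT hC ω)
        (integrable_signDensity hT hC _ ω), ← setIntegral_congr_set hae,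
      ← integral_indicator measurableSet_Ioo]
    simp only [indicator_mul_left]
  have hdM (f : ℝ≥0 → ℝ) : ∫ᵛ y, f y ∂•(dM F T C ω) =
      ∫ y, f y * signDensity F T C ω y ∂(pathMeasure F T C ω) := by
    rw [dM_eq_withDensityᵥ hT hC, integral_withDensityᵥ (measurable_signDensity_apply hT hC ω)
      (integrable_signDensity hT hC _ ω)]
  simp_rw [hIio, hdM]
  rw [sq_integral_eq ((integrable_dM_iff_integrable_pathMeasure hT hC g ω).1 hg)]
  congr 2
  · exact congrArg _ (funext fun y => by ring)
  · refine funext fun y => ?_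
    rw [← Finset.mul_sum, ← measureReal_pathMeasure_singleton_mul hT hC hω]
    ring

end Paths

section Jumps

variable {hT : ∀ i, Measurable (T i)} {hC : ∀ i, Measurable (C i)} {K : ℝ≥0 × Ω → ℝ} {c : ℝ}

lemma abs_sq_mul_le (hc : ∀ p, |K p| ≤ c) {a : ℝ≥0 × Ω → ℝ} (ha : ∀ p, |a p| ≤ 1) (p : ℝ≥0 × Ω) :
    |K p ^ 2 * a p| ≤ c ^ 2 := by
  rw [abs_mul, abs_of_nonneg (sq_nonneg _)]
  exact (mul_le_of_le_one_right (sq_nonneg _) (ha p)).trans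
    (sq_le_sq' (abs_le.1 (hc p)).1 (abs_le.1 (hc p)).2)

lemma integral_compensatorCampbell_indicator_obsTime [SFinite P] [IsFiniteMeasure F]
    (hT : ∀ i, Measurable (T i)) (hC : ∀ i, Measurable (C i)) (i : Fin n)
    {f : ℝ≥0 × Ω → ℝ} (hf : Measurable f) (hi : Integrable f (compensatorCampbell P F T C i)) :
    ∫ p, f p * (if obsTime T C i p.2 = p.1 ∧ T i p.2 ≤ C i p.2 then 1 else 0)
        ∂(compensatorCampbell P F T C i) =
      ∫ p, f p * (hazard F {p.1}).toReal ∂(countingCampbell P T C i) := by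
  have hset : MeasurableSet {p : ℝ≥0 × Ω | obsTime T C i p.2 = p.1 ∧ T i p.2 ≤ C i p.2} :=
    (measurableSet_eq_fun ((measurable_obsTime hT hC i).comp measurable_snd) measurable_fst).inter
      (measurable_snd (measurableSet_uncensored hT hC i))
  have hind : Integrable (fun p => if obsTime T C i p.2 = p.1 ∧ T i p.2 ≤ C i p.2 then f p else 0)
      (compensatorCampbell P F T C i) :=
    (hi.indicator hset).congr (ae_of_all _ fun p => by simp [indicator_apply])
  have hfΛ : Measurable fun p : ℝ≥0 × Ω => f p * (hazard F {p.1}).toReal :=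
    hf.mul ((measurable_toReal_hazard_singleton F).comp measurable_fst)
  simp only [mul_ite, mul_one, mul_zero]
  rw [integral_compensatorCampbell hT hC hind, integral_countingCampbell hT hC i hfΛ]
  refine integral_congr_ae (ae_of_all _ fun ω => ?_)
  by_cases hΔ : T i ω ≤ C i ω
  · have hpt (y : ℝ≥0) : (if obsTime T C i ω = y ∧ T i ω ≤ C i ω then f (y, ω) else 0) =
        ({obsTime T C i ω} : Set ℝ≥0).indicator (fun y => f (y, ω)) y := by
      simp [indicator_apply, hΔ, eq_comm]
    simp only [hpt, if_pos hΔ]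
    rw [setIntegral_indicator (measurableSet_singleton _),
      inter_eq_right.2 (singleton_subset_iff.2 self_mem_Iic), integral_singleton,
      measureReal_def, smul_eq_mul, mul_comm]
  · simp [hΔ]

lemma integral_countingCampbell_mul_jumpAt [IsFiniteMeasure F] (hT : ∀ i, Measurable (T i))
    (hC : ∀ i, Measurable (C i)) (i : Fin n) {f : ℝ≥0 × Ω → ℝ} (hf : Measurable f) :
    ∫ p, f p * jumpAt F T C i p ∂(countingCampbell P T C i) =
      ∫ p, f p * (1 - (hazard F {p.1}).toReal) ∂(countingCampbell P T C i) := by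
  have hfΛ : Measurable fun p : ℝ≥0 × Ω => f p * (1 - (hazard F {p.1}).toReal) :=
    hf.mul (((measurable_toReal_hazard_singleton F).comp measurable_fst).const_sub 1)
  have hfJ : Measurable fun p => f p * jumpAt F T C i p := hf.mul (measurable_jumpAt hT hC i)
  rw [integral_countingCampbell hT hC i hfJ, integral_countingCampbell hT hC i hfΛ]
  refine integral_congr_ae (ae_of_all _ fun ω => ?_)
  by_cases hΔ : T i ω ≤ C i ω <;> simp [jumpAt, hΔ]

lemma IsSample.integral_compensatorCampbell_mul_jumpAt [IsFiniteMeasure P]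
    [IsProbabilityMeasure F] (hS : IsSample P F T C) (i : Fin n) {f : ℝ≥0 × Ω → ℝ}
    (hf : Measurable f) (hi : Integrable f (compensatorCampbell P F T C i)) :
    ∫ p, f p * jumpAt F T C i p ∂(compensatorCampbell P F T C i) =
      ∫ p, f p * (hazard F {p.1}).toReal ∂(countingCampbell P T C i) -
        ∫ p, f p * (hazard F {p.1}).toReal ∂(compensatorCampbell P F T C i) := by
  have hT := hS.measurable_T
  have hC := hS.measurable_C
  have hΛ : Integrable (fun p : ℝ≥0 × Ω => f p * (hazard F {p.1}).toReal)
      (compensatorCampbell P F T C i) :=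
    hi.mul_bdd (c := 1)
      ((measurable_toReal_hazard_singleton F).comp measurable_fst).aestronglyMeasurable
      (ae_of_all _ fun p => by
        rw [Real.norm_of_nonneg (toReal_hazard_singleton_mem F _).1]
        exact (toReal_hazard_singleton_mem F _).2)
  have hJ : Integrable (fun p => f p * jumpAt F T C i p) (compensatorCampbell P F T C i) :=
    hi.mul_bdd (c := 1) (measurable_jumpAt hT hC i).aestronglyMeasurable
      (ae_of_all _ fun p => abs_jumpAt_le_one F T C i p)
  rw [eq_sub_iff_add_eq, ← integral_add hJ hΛ,
    ← integral_compensatorCampbell_indicator_obsTime hT hC i hf hi]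
  refine integral_congr_ae ((ae_restrict_iff' (measurableSet_le_obsTime hT hC i)).2
    (ae_of_all _ fun p hp => ?_))
  simp only [jumpAt, if_pos (show p.1 ≤ obsTime T C i p.2 from hp)]
  ring

lemma IsSample.integral_stochIntegral_sq_mul_jumpAt [IsProbabilityMeasure P]
    [IsProbabilityMeasure F] (hS : IsSample P F T C)
    (hK : Measurable[(obsFiltration P T C hT hC).predictable] K) (hc : ∀ p, |K p| ≤ c)
    (i : Fin n) :
    ∫ ω, stochIntegral F T C (fun p => K p ^ 2 * jumpAt F T C i p) ω ∂P =
      ∫ p, K p ^ 2 * (1 - (hazard F {p.1}).toReal) ∂(compensatorCampbell P F T C i) := by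
  have hK2 : Measurable fun p => K p ^ 2 := (hK.mono predictable_le_prod le_rfl).pow_const 2
  have hΛ : Measurable fun y => (hazard F {y}).toReal := measurable_toReal_hazard_singleton F
  have hJ : Measurable fun p => K p ^ 2 * jumpAt F T C i p := hK2.mul (measurable_jumpAt hT hC i)
  have hfree (j : Fin n) : IsFreeOf P T C j K := isFreeOf_of_predictable (hT := hT) (hC := hC) j hK
  have hother (j : Fin n) (hij : i ≠ j) :
      ∫ p, K p ^ 2 * jumpAt F T C i p ∂(countingCampbell P T C j) =
        ∫ p, K p ^ 2 * jumpAt F T C i p ∂(compensatorCampbell P F T C j) :=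
    hS.integral_countingCampbell_eq ((hfree j).comp₂ (isFreeOf_jumpAt hij)
      (u := fun q => q.1 ^ 2 * q.2) (by fun_prop)) hJ
  have hown {u : ℝ → ℝ} (hu : Measurable u) :
      ∫ p, K p ^ 2 * u (hazard F {p.1}).toReal ∂(countingCampbell P T C i) =
        ∫ p, K p ^ 2 * u (hazard F {p.1}).toReal ∂(compensatorCampbell P F T C i) :=
    hS.integral_countingCampbell_eq ((hfree i).comp₂ (isFreeOf_fst hΛ)
      (u := fun q => q.1 ^ 2 * u q.2) (by fun_prop)) (hK2.mul (hu.comp (hΛ.comp measurable_fst)))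
  have hi : Integrable (fun p => K p ^ 2) (compensatorCampbell P F T C i) :=
    have := hS.isFiniteMeasure_compensatorCampbell i
    Integrable.of_bound hK2.aestronglyMeasurable (c ^ 2) (ae_of_all _ fun p => by
      simpa using abs_sq_mul_le hc (a := fun _ => 1) (by simp) p)
  rw [hS.integral_stochIntegral_eq_sum hJ (abs_sq_mul_le hc (abs_jumpAt_le_one F T C i)),
    Finset.sum_eq_single_of_mem i (Finset.mem_univ i) fun j _ hji =>
      sub_eq_zero.2 (hother j hji.symm),
    integral_countingCampbell_mul_jumpAt hT hC i hK2,
    hS.integral_compensatorCampbell_mul_jumpAt i hK2 hi, hown (u := fun x => 1 - x) (by fun_prop),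
    hown measurable_id', sub_self, sub_zero]

end Jumps

end Isometry

section Isometry

variable {Ω : Type*} {mΩ : MeasurableSpace Ω} {n : ℕ} {P : Measure Ω} {F : Measure ℝ≥0}
  {T C : Fin n → Ω → ℝ≥0} {K : ℝ≥0 × Ω → ℝ}

/-- The Campbell measure `E ∫ 1_B d⟨M⟩` on `[0,∞) × Ω` of `d⟨M⟩ = (1 - ΔΛ) Y dΛ`: the stochastic
integral is an isometry from its `L²` space. -/
def varCampbell (P : Measure Ω) (F : Measure ℝ≥0) (T C : Fin n → Ω → ℝ≥0) : Measure (ℝ≥0 × Ω) :=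
  ∑ i, (compensatorCampbell P F T C i).withDensity fun p => 1 - hazard F {p.1}

lemma varM_eq_withDensity_compensatorMeasure [IsFiniteMeasure F] (T C : Fin n → Ω → ℝ≥0) (ω : Ω) :
    varM F T C ω = (compensatorMeasure F T C ω).withDensity fun y => 1 - hazard F {y} := by
  rw [compensatorMeasure, ← withDensity_mul _ (measurable_atRisk_apply T C ω)
    ((measurable_measure_singleton _).const_sub 1), varM]
  exact congrArg _ (funext fun y => mul_comm _ _)

lemma lintegral_varCampbell [SFinite P] [IsFiniteMeasure F] (hT : ∀ i, Measurable (T i))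
    (hC : ∀ i, Measurable (C i)) {g : ℝ≥0 × Ω → ℝ≥0∞} (hg : Measurable g) :
    ∫⁻ p, g p ∂(varCampbell P F T C) = ∫⁻ ω, ∫⁻ y, g (y, ω) ∂(varM F T C ω) ∂P := by
  have hw : Measurable fun y => 1 - hazard F {y} := (measurable_measure_singleton _).const_sub 1
  have hw' : Measurable fun p : ℝ≥0 × Ω => 1 - hazard F {p.1} := hw.comp measurable_fst
  have hwg : Measurable fun p : ℝ≥0 × Ω => (1 - hazard F {p.1}) * g p := hw'.mul hg
  have hpath (ω : Ω) : ∫⁻ y, g (y, ω) ∂(varM F T C ω) =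
      ∑ i, ∫⁻ y in Iic (obsTime T C i ω), (1 - hazard F {y}) * g (y, ω) ∂(hazard F) := by
    have hgω : Measurable fun y => g (y, ω) := hg.comp measurable_prodMk_right
    rw [varM_eq_withDensity_compensatorMeasure, lintegral_withDensity_eq_lintegral_mul _ hw hgω,
      lintegral_compensatorMeasure]
    rfl
  have hmeas (i : Fin n) : Measurable fun ω =>
      ∫⁻ y in Iic (obsTime T C i ω), (1 - hazard F {y}) * g (y, ω) ∂(hazard F) := by
    simp_rw [← lintegral_indicator measurableSet_Iic]
    exact (hwg.indicator (measurableSet_le_obsTime hT hC i)).lintegral_prod_left'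
  simp_rw [hpath]
  rw [varCampbell, lintegral_finsetSum_measure, lintegral_finsetSum _ fun i _ => hmeas i]
  refine Finset.sum_congr rfl fun i _ => ?_
  rw [lintegral_withDensity_eq_lintegral_mul _ hw' hg,
    ← lintegral_compensatorCampbell hT hC i hwg]
  rfl

lemma varMoment_eq_lintegral_varCampbell [SFinite P] [IsFiniteMeasure F]
    (hT : ∀ i, Measurable (T i)) (hC : ∀ i, Measurable (C i)) (hK : Measurable K) :
    varMoment P F T C K = ∫⁻ p, ‖K p‖ₑ ^ 2 ∂(varCampbell P F T C) :=
  (lintegral_varCampbell hT hC (hK.enorm.pow_const 2)).symm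

lemma eLpNorm_two_sq {α : Type*} [MeasurableSpace α] (f : α → ℝ) (μ : Measure α) :
    eLpNorm f 2 μ ^ 2 = ∫⁻ x, ‖f x‖ₑ ^ 2 ∂μ := by
  simpa using eLpNorm_nnreal_pow_eq_lintegral (f := f) (μ := μ) (p := 2) two_ne_zero

section Bounded

variable [IsProbabilityMeasure P] [IsProbabilityMeasure F]
  {hT : ∀ i, Measurable (T i)} {hC : ∀ i, Measurable (C i)} {c : ℝ}

lemma IsSample.measurable_mul_stochIntegral_past (hS : IsSample P F T C)
    (hK : Measurable[(obsFiltration P T C hT hC).predictable] K) :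
    Measurable[(obsFiltration P T C hT hC).predictable] fun p : ℝ≥0 × Ω =>
      K p * ∫ᵛ x in Ioo 0 p.1, K (x, p.2) ∂•(dM F T C p.2) := by
  refine hK.mul ?_
  simp_rw [setIntegral_Ioo_eq_integral_orderedPairs fun x _ ω => K (x, ω)]
  exact hS.measurable_integral_dM_predictable (measurable_orderedPairs_fst hK)
    fun q hq => indicator_of_notMem hq _

lemma enorm_mul_stochIntegral_past_le (hT : ∀ i, Measurable (T i)) (hC : ∀ i, Measurable (C i))
    (hK : Measurable K) (hc : ∀ p, |K p| ≤ c) (p : ℝ≥0 × Ω) :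
    ‖K p * ∫ᵛ x in Ioo 0 p.1, K (x, p.2) ∂•(dM F T C p.2)‖ₑ ≤
      ENNReal.ofReal c * ENNReal.ofReal c * (1 + pathMeasure F T C p.2 univ) := by
  have hKc (q : ℝ≥0 × Ω) : ‖K q‖ₑ ≤ ENNReal.ofReal c := by
    rw [Real.enorm_eq_ofReal_abs]
    exact ENNReal.ofReal_le_ofReal (hc q)
  have hpast : ‖∫ᵛ x in Ioo 0 p.1, K (x, p.2) ∂•(dM F T C p.2)‖ₑ ≤
      ENNReal.ofReal c * pathMeasure F T C p.2 univ :=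
    calc ‖∫ᵛ x in Ioo 0 p.1, K (x, p.2) ∂•(dM F T C p.2)‖ₑ
        = ‖∫ᵛ x, (Ioo 0 p.1).indicator (fun x => K (x, p.2)) x ∂•(dM F T C p.2)‖ₑ := by
          rw [VectorMeasure.integral_indicator measurableSet_Ioo]
      _ ≤ ∫⁻ x, ‖(Ioo 0 p.1).indicator (fun x => K (x, p.2)) x‖ₑ ∂(dM F T C p.2).variation :=
          enorm_integral_lsmul_le_lintegral_enorm _ _
      _ ≤ ∫⁻ x, ‖K (x, p.2)‖ₑ ∂(dM F T C p.2).variation :=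
          lintegral_mono fun x => enorm_indicator_le_enorm_self _ _
      _ = ∫⁻ x, ‖K (x, p.2) * signDensity F T C p.2 x‖ₑ ∂(pathMeasure F T C p.2) :=
          lintegral_variation_dM hT hC hK p.2
      _ ≤ ∫⁻ _, ENNReal.ofReal c ∂(pathMeasure F T C p.2) := lintegral_mono fun x => by
          rw [enorm_mul]
          exact mul_le_of_le_of_le_one (hKc _) (enorm_signDensity_le_one F T C _ _)
      _ = ENNReal.ofReal c * pathMeasure F T C p.2 univ := lintegral_const _
  rw [enorm_mul, mul_assoc]
  exact mul_le_mul' (hKc p) (hpast.trans (mul_le_mul_right le_add_self _))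

lemma IsSample.sq_stochIntegral_ae_eq (hS : IsSample P F T C)
    (hK : Measurable[(obsFiltration P T C hT hC).predictable] K) (hc : ∀ p, |K p| ≤ c) :
    (fun ω => stochIntegral F T C K ω ^ 2) =ᵐ[P] fun ω =>
      2 * stochIntegral F T C
          (fun p => K p * ∫ᵛ x in Ioo 0 p.1, K (x, p.2) ∂•(dM F T C p.2)) ω +
        ∑ i, stochIntegral F T C (fun p => K p ^ 2 * jumpAt F T C i p) ω := by
  have hKm := hK.mono predictable_le_prod le_rfl
  have hJm (i : Fin n) : Measurable fun p => K p ^ 2 * jumpAt F T C i p :=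
    (hKm.pow_const 2).mul (measurable_jumpAt hT hC i)
  have hJ (i : Fin n) := ae_integrable_dM hT hC (hJm i)
    (hS.absMoment_lt_top_of_bound (hJm i) (abs_sq_mul_le hc (abs_jumpAt_le_one F T C i)))
  filter_upwards [hS.ae_finitePaths, hS.ae_pathMeasure_zero,
    ae_integrable_dM hT hC hKm (hS.absMoment_lt_top_of_bound hKm hc), ae_all_iff.2 hJ]
    with ω hω h0 hKω hJω
  simp only [stochIntegral]
  rw [sq_integral_dM hT hC hω h0 hKω, VectorMeasure.integral_finsetSum _ fun i _ => hJω i]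

lemma IsSample.integrable_and_integral_sq_stochIntegral (hS : IsSample P F T C)
    (hK : Measurable[(obsFiltration P T C hT hC).predictable] K) (hc : ∀ p, |K p| ≤ c) :
    Integrable (fun ω => stochIntegral F T C K ω ^ 2) P ∧
      ∫ ω, stochIntegral F T C K ω ^ 2 ∂P =
        ∑ i, ∫ p, K p ^ 2 * (1 - (hazard F {p.1}).toReal) ∂(compensatorCampbell P F T C i) := by
  have hKm := hK.mono predictable_le_prod le_rfl
  have hJm (i : Fin n) : Measurable fun p => K p ^ 2 * jumpAt F T C i p :=
    (hKm.pow_const 2).mul (measurable_jumpAt hT hC i)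
  have hJ (i : Fin n) := integrable_stochIntegral hT hC (hJm i)
    (hS.absMoment_lt_top_of_bound (hJm i) (abs_sq_mul_le hc (abs_jumpAt_le_one F T C i)))
  have hH := hS.measurable_mul_stochIntegral_past hK
  have hHm := hS.absMoment_lt_top_of_le (hH.mono predictable_le_prod le_rfl)
    (ENNReal.mul_ne_top ENNReal.ofReal_ne_top ENNReal.ofReal_ne_top)
    (enorm_mul_stochIntegral_past_le hT hC hKm hc)
  have hHi := integrable_stochIntegral hT hC (hH.mono predictable_le_prod le_rfl) hHm
  have hsum := integrable_finsetSum Finset.univ fun i _ => hJ i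
  have hae := hS.sq_stochIntegral_ae_eq hK hc
  refine ⟨((hHi.const_mul 2).add hsum).congr hae.symm, ?_⟩
  rw [integral_congr_ae hae, integral_add (hHi.const_mul 2) hsum, integral_const_mul,
    hS.integral_stochIntegral_eq_zero hH hHm, mul_zero, zero_add,
    integral_finsetSum _ fun i _ => hJ i]
  exact Finset.sum_congr rfl fun i _ => hS.integral_stochIntegral_sq_mul_jumpAt hK hc i

lemma IsSample.eLpNorm_stochIntegral_of_bound (hS : IsSample P F T C)
    (hK : Measurable[(obsFiltration P T C hT hC).predictable] K) (hc : ∀ p, |K p| ≤ c) :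
    eLpNorm (stochIntegral F T C K) 2 P = eLpNorm K 2 (varCampbell P F T C) := by
  have hKm := hK.mono predictable_le_prod le_rfl
  have hw : Measurable fun p : ℝ≥0 × Ω => 1 - hazard F {p.1} :=
    ((measurable_measure_singleton _).comp measurable_fst).const_sub 1
  obtain ⟨hi, hint⟩ := hS.integrable_and_integral_sq_stochIntegral hK hc
  have hsq (x : ℝ) : ‖x‖ₑ ^ 2 = ENNReal.ofReal (x ^ 2) := by
    rw [← enorm_pow, Real.enorm_of_nonneg (sq_nonneg x)]
  have hdens (p : ℝ≥0 × Ω) : 0 ≤ K p ^ 2 * (1 - (hazard F {p.1}).toReal) :=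
    mul_nonneg (sq_nonneg _) (sub_nonneg.2 (toReal_hazard_singleton_mem F p.1).2)
  refine (ENNReal.pow_right_strictMono two_ne_zero).injective ?_
  rw [eLpNorm_two_sq, eLpNorm_two_sq, lintegral_congr fun ω => hsq (stochIntegral F T C K ω),
    ← ofReal_integral_eq_lintegral_ofReal hi (ae_of_all _ fun _ => sq_nonneg _), hint,
    ENNReal.ofReal_sum_of_nonneg fun i _ => integral_nonneg hdens, varCampbell,
    lintegral_finsetSum_measure]
  refine Finset.sum_congr rfl fun i _ => ?_
  have := hS.isFiniteMeasure_compensatorCampbell i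
  rw [ofReal_integral_eq_lintegral_ofReal _ (ae_of_all _ hdens),
    lintegral_withDensity_eq_lintegral_mul _ hw (hKm.enorm.pow_const 2)]
  · refine lintegral_congr fun p => ?_
    rw [ENNReal.ofReal_mul (sq_nonneg _), ← hsq, Pi.mul_apply, mul_comm,
      ENNReal.ofReal_sub _ ENNReal.toReal_nonneg, ENNReal.ofReal_one, ENNReal.ofReal_toReal
        (ne_top_of_le_ne_top ENNReal.one_ne_top (hazard_singleton_le_one F p.1))]
  · exact Integrable.of_bound ((hKm.pow_const 2).mul (measurable_const.sub
      ((measurable_toReal_hazard_singleton F).comp measurable_fst))).aestronglyMeasurable (c ^ 2)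
      (ae_of_all _ (abs_sq_mul_le hc fun p =>
        (abs_of_nonneg (sub_nonneg.2 (toReal_hazard_singleton_mem F p.1).2)).trans_le
          (sub_le_self 1 (toReal_hazard_singleton_mem F p.1).1)))

end Bounded

section Truncation

lemma stochIntegral_sub_ae_eq [SFinite P] [IsFiniteMeasure F] (hT : ∀ i, Measurable (T i))
    (hC : ∀ i, Measurable (C i)) {L : ℝ≥0 × Ω → ℝ} (hK : Measurable K)
    (hKi : absMoment P F T C K < ∞) (hL : Measurable L) (hLi : absMoment P F T C L < ∞) :
    stochIntegral F T C (K - L) =ᵐ[P] stochIntegral F T C K - stochIntegral F T C L := by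
  filter_upwards [ae_integrable_dM hT hC hK hKi, ae_integrable_dM hT hC hL hLi] with ω hKω hLω
  exact VectorMeasure.integral_fun_sub hKω hLω

lemma tendsto_stochIntegral_truncate [SFinite P] [IsFiniteMeasure F]
    (hT : ∀ i, Measurable (T i)) (hC : ∀ i, Measurable (C i)) (hK : Measurable K)
    (hi : absMoment P F T C K < ∞) :
    ∀ᵐ ω ∂P, Filter.Tendsto (fun k => stochIntegral F T C (truncate k K) ω) Filter.atTop
      (nhds (stochIntegral F T C K ω)) := by
  filter_upwards [ae_integrable_dM hT hC hK hi] with ω hω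
  rw [integrable_dM_iff_integrable_pathMeasure hT hC] at hω
  simp_rw [stochIntegral_eq_integral_pathMeasure hT hC]
  refine tendsto_integral_of_dominated_convergence _ (fun k => ?_) hω.norm (fun k => ?_) ?_
  · exact (((measurable_truncate hK k).comp measurable_prodMk_right).mul
      (measurable_signDensity_apply hT hC ω)).aestronglyMeasurable
  · refine ae_of_all _ fun y => ?_
    rw [norm_mul, norm_mul]
    exact mul_le_mul_of_nonneg_right (abs_truncate_le_abs k K _) (norm_nonneg _)
  · refine ae_of_all _ fun y => tendsto_const_nhds.congr' ?_
    filter_upwards [eventually_truncate_eq K (y, ω)] with k hk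
    rw [hk]

lemma tendsto_eLpNorm_sub_truncate {μ : Measure (ℝ≥0 × Ω)} (hK : MemLp K 2 μ)
    (hKm : Measurable K) :
    Filter.Tendsto (fun k => eLpNorm (K - truncate k K) 2 μ) Filter.atTop (nhds 0) := by
  have hbound : ∫⁻ p, ‖K p‖ₑ ^ 2 ∂μ ≠ ∞ := by
    rw [← eLpNorm_two_sq]
    exact ENNReal.pow_ne_top hK.2.ne
  have hsq : Filter.Tendsto (fun k => eLpNorm (K - truncate k K) 2 μ ^ 2) Filter.atTop
      (nhds (∫⁻ _, 0 ∂μ)) := by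
    simp_rw [eLpNorm_two_sq]
    refine tendsto_lintegral_of_dominated_convergence _
      (fun k => (hKm.sub (measurable_truncate hKm k)).enorm.pow_const 2)
      (fun k => ae_of_all _ fun p => ?_) hbound
      (ae_of_all _ fun p => tendsto_const_nhds.congr' ?_)
    · exact pow_le_pow_left' (enorm_le_iff_norm_le.2 (abs_sub_truncate_le_abs k K p)) 2
    · filter_upwards [eventually_truncate_eq K p] with k hk
      simp [hk]
  simpa [← ENNReal.rpow_natCast_mul] using hsq.ennrpow_const (1 / 2)

variable [IsProbabilityMeasure P] [IsProbabilityMeasure F]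
  {hT : ∀ i, Measurable (T i)} {hC : ∀ i, Measurable (C i)}

lemma IsSample.eLpNorm_stochIntegral_le (hS : IsSample P F T C)
    (hK : Measurable[(obsFiltration P T C hT hC).predictable] K)
    (hi : absMoment P F T C K < ∞) :
    eLpNorm (stochIntegral F T C K) 2 P ≤ eLpNorm K 2 (varCampbell P F T C) := by
  have hKm := hK.mono predictable_le_prod le_rfl
  refine (Lp.eLpNorm_lim_le_liminf_eLpNorm (fun k => (measurable_stochIntegral hT hC
    (measurable_truncate hKm k)).aestronglyMeasurable) _
    (tendsto_stochIntegral_truncate hT hC hKm hi)).trans ?_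
  refine Filter.liminf_le_of_le (by isBoundedDefault) fun b hb => ?_
  obtain ⟨k, hk⟩ := hb.exists
  rw [hS.eLpNorm_stochIntegral_of_bound (measurable_truncate hK k) (abs_truncate_le k K)] at hk
  exact hk.trans (eLpNorm_mono (abs_truncate_le_abs k K))

lemma IsSample.eLpNorm_stochIntegral (hS : IsSample P F T C)
    (hK : Measurable[(obsFiltration P T C hT hC).predictable] K)
    (hi : absMoment P F T C K < ∞) (hv : MemLp K 2 (varCampbell P F T C)) :
    eLpNorm (stochIntegral F T C K) 2 P = eLpNorm K 2 (varCampbell P F T C) := by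
  refine (hS.eLpNorm_stochIntegral_le hK hi).antisymm ?_
  have hKm := hK.mono predictable_le_prod le_rfl
  have hrest := tendsto_eLpNorm_sub_truncate hv hKm
  have hlim := (hrest.add hrest).const_add (eLpNorm (stochIntegral F T C K) 2 P)
  rw [add_zero, add_zero] at hlim
  refine ge_of_tendsto' hlim fun k => ?_
  have hTk := measurable_truncate hK k
  have hTkm := measurable_truncate hKm k
  have hD : Measurable[(obsFiltration P T C hT hC).predictable] (K - truncate k K) := hK.sub hTk
  have hDi : absMoment P F T C (K - truncate k K) < ∞ :=
    (absMoment_mono (abs_sub_truncate_le_abs k K)).trans_lt hi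
  have hDm := hD.mono predictable_le_prod le_rfl
  calc eLpNorm K 2 (varCampbell P F T C)
      = eLpNorm (truncate k K + (K - truncate k K)) 2 (varCampbell P F T C) := by
        rw [add_sub_cancel]
    _ ≤ eLpNorm (truncate k K) 2 (varCampbell P F T C) +
          eLpNorm (K - truncate k K) 2 (varCampbell P F T C) :=
        eLpNorm_add_le hTkm.aestronglyMeasurable hDm.aestronglyMeasurable one_le_two
    _ = eLpNorm (stochIntegral F T C K - stochIntegral F T C (K - truncate k K)) 2 P +
          eLpNorm (K - truncate k K) 2 (varCampbell P F T C) := by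
        rw [← hS.eLpNorm_stochIntegral_of_bound hTk (abs_truncate_le k K),
          ← eLpNorm_congr_ae (stochIntegral_sub_ae_eq hT hC hKm hi hDm hDi), sub_sub_cancel]
    _ ≤ eLpNorm (stochIntegral F T C K) 2 P +
          eLpNorm (stochIntegral F T C (K - truncate k K)) 2 P +
          eLpNorm (K - truncate k K) 2 (varCampbell P F T C) := by
        gcongr
        exact eLpNorm_sub_le (measurable_stochIntegral hT hC hKm).aestronglyMeasurable
          (measurable_stochIntegral hT hC hDm).aestronglyMeasurable one_le_two
    _ ≤ eLpNorm (stochIntegral F T C K) 2 P +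
          (eLpNorm (K - truncate k K) 2 (varCampbell P F T C) +
            eLpNorm (K - truncate k K) 2 (varCampbell P F T C)) := by
        rw [add_assoc]
        gcongr
        exact hS.eLpNorm_stochIntegral_le hD hDi

lemma IsSample.lintegral_stochIntegral_sq (hS : IsSample P F T C)
    (hK : Measurable[(obsFiltration P T C hT hC).predictable] K)
    (hi : absMoment P F T C K < ∞) (hv : varMoment P F T C K < ∞) :
    ∫⁻ ω, ‖stochIntegral F T C K ω‖ₑ ^ 2 ∂P = varMoment P F T C K := by
  have hKm := hK.mono predictable_le_prod le_rfl
  rw [varMoment_eq_lintegral_varCampbell hT hC hKm, ← eLpNorm_two_sq] at hv ⊢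
  rw [← eLpNorm_two_sq, hS.eLpNorm_stochIntegral hK hi
    ⟨hKm.aestronglyMeasurable, (ENNReal.pow_lt_top_iff.1 hv).resolve_right two_ne_zero⟩]

end Truncation

end Isometry

section Running

variable {Ω : Type*} {mΩ : MeasurableSpace Ω} {n : ℕ} {P : Measure Ω} {F : Measure ℝ≥0}
  {T C : Fin n → Ω → ℝ≥0} {hT : ∀ i, Measurable (T i)} {hC : ∀ i, Measurable (C i)}
  {K : ℝ≥0 × Ω → ℝ}

lemma measurable_prodMk_left_predictable {𝓕 : Filtration ℝ≥0 mΩ} (t : ℝ≥0) :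
    @Measurable Ω (ℝ≥0 × Ω) (𝓕 t) 𝓕.predictable fun ω => (t, ω) := by
  have hmk : @Measurable Ω (Set.Iic t × Ω) (𝓕 t) (Subtype.instMeasurableSpace.prod (𝓕 t))
      fun ω => (⟨t, self_mem_Iic⟩, ω) := by
    let _ : MeasurableSpace Ω := 𝓕 t
    exact measurable_const.prodMk measurable_id
  exact (measurable_inclusion_predictable (𝓕 := 𝓕) (i := t)).comp hmk

lemma measurable_indicator_Ioc_predictable {𝓕 : Filtration ℝ≥0 mΩ} {s : ℝ≥0} {A : Set Ω}
    (hA : MeasurableSet[𝓕 s] A) (t : ℝ≥0) (hK : Measurable[𝓕.predictable] K) :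
    Measurable[𝓕.predictable] ((Ioc s t ×ˢ A).indicator K) :=
  hK.indicator (measurableSet_predictable_Ioc_prod s t hA)

lemma stochIntegral_indicator_prod {B : Set ℝ≥0} (hB : MeasurableSet B) (A : Set Ω)
    (K : ℝ≥0 × Ω → ℝ) :
    stochIntegral F T C ((B ×ˢ A).indicator K) =
      A.indicator fun ω => ∫ᵛ y in B, K (y, ω) ∂•(dM F T C ω) := by
  ext ω
  by_cases hω : ω ∈ A
  · rw [indicator_of_mem hω, ← VectorMeasure.integral_indicator hB]
    have hind (y : ℝ≥0) : (B ×ˢ A).indicator K (y, ω) = B.indicator (fun y => K (y, ω)) y := by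
      by_cases hy : y ∈ B <;> simp [hy, hω]
    rw [stochIntegral, funext hind]
  · simp [stochIntegral, hω]

lemma dM_singleton {ω : Ω} (hω : ω ∈ finitePaths F T C) (y : ℝ≥0) :
    dM F T C ω {y} = ∑ i, jumpAt F T C i (y, ω) := by
  have : IsFiniteMeasure (compensatorMeasure F T C ω) := hω
  rw [dM, dif_pos this, sub_apply,
    Measure.toSignedMeasure_apply_measurable (measurableSet_singleton y),
    Measure.toSignedMeasure_apply_measurable (measurableSet_singleton y),
    measureReal_countingMeasure_singleton, measureReal_compensatorMeasure_singleton, sum_jumpAt]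

lemma measurable_jumpAt_obsFiltration (i : Fin n) (t : ℝ≥0) :
    Measurable[obsFiltration P T C hT hC t] fun ω => jumpAt F T C i (t, ω) := by
  have hbefore : MeasurableSet[obsFiltration P T C hT hC t]
      {ω | obsTime T C i ω < t ∧ ω ∈ univ} :=
    measurable_prodMk_left_predictable t
      (measurableSet_predictable_lt (measurableSet_obsFiltration_obsTime i))
  simp only [jumpAt]
  refine (Measurable.ite ?_ measurable_const measurable_const).sub
    (measurable_const.mul (Measurable.ite ?_ measurable_const measurable_const))
  · convert (measurableSet_obsFiltration_uncensored i t).diff hbefore using 1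
    ext ω
    simp only [mem_ofPred_eq, mem_sdiff, mem_univ, and_true, not_lt, le_antisymm_iff]
    tauto
  · convert hbefore.compl using 1
    ext ω
    simp

lemma ae_integrableOn_dM [SFinite P] [IsFiniteMeasure F] (hT : ∀ i, Measurable (T i))
    (hC : ∀ i, Measurable (C i)) (hK : Measurable K) {B : Set ℝ≥0} (hB : MeasurableSet B)
    (hi : absMoment P F T C ((B ×ˢ univ).indicator K) < ∞) :
    ∀ᵐ ω ∂P, (dM F T C ω).IntegrableOn (fun y => K (y, ω)) B := by
  have hm := hK.indicator (hB.prod (MeasurableSet.univ (α := Ω)))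
  filter_upwards [ae_integrable_dM hT hC hm hi] with ω hω
  have hind (y : ℝ≥0) : (B ×ˢ univ).indicator K (y, ω) = B.indicator (fun y => K (y, ω)) y := by
    by_cases hy : y ∈ B <;> simp [hy]
  rw [funext hind] at hω
  exact (VectorMeasure.integrable_indicator_iff hB).1 hω

section Adapted

variable [IsProbabilityMeasure P] [IsProbabilityMeasure F]

lemma IsSample.measurable_setIntegral_Ioo (hS : IsSample P F T C)
    (hK : Measurable[(obsFiltration P T C hT hC).predictable] K) (t : ℝ≥0) :
    Measurable[obsFiltration P T C hT hC t] fun ω =>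
      ∫ᵛ y in Ioo 0 t, K (y, ω) ∂•(dM F T C ω) := by
  have hpast := hS.measurable_integral_dM_predictable (measurable_orderedPairs_fst hK)
    fun q hq => indicator_of_notMem hq _
  simpa only [Function.comp_def, ← setIntegral_Ioo_eq_integral_orderedPairs fun y _ ω => K (y, ω)]
    using hpast.comp (measurable_prodMk_left_predictable t)

lemma IsSample.measurable_setIntegral_Ioc (hS : IsSample P F T C)
    (hK : Measurable[(obsFiltration P T C hT hC).predictable] K) {t : ℝ≥0}
    (hi : absMoment P F T C ((Ioc 0 t ×ˢ univ).indicator K) < ∞) {W : Ω → ℝ} (hW : Measurable W)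
    (hWK : W =ᵐ[P] fun ω => ∫ᵛ y in Ioc 0 t, K (y, ω) ∂•(dM F T C ω)) :
    Measurable[obsFiltration P T C hT hC t] W := by
  rcases eq_or_ne t 0 with rfl | ht
  · refine measurable_obsFiltration_congr (measurable_const (a := 0)) hW ?_
    filter_upwards [hWK] with ω hω
    simp [hω]
  have hjump : Measurable[obsFiltration P T C hT hC t] fun ω =>
      K (t, ω) * ∑ i, jumpAt F T C i (t, ω) :=
    (hK.comp (measurable_prodMk_left_predictable t)).mul
      (Finset.measurable_sum _ fun i _ => measurable_jumpAt_obsFiltration i t)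
  refine measurable_obsFiltration_congr ((hS.measurable_setIntegral_Ioo hK t).add hjump) hW ?_
  filter_upwards [hWK, hS.ae_finitePaths, ae_integrableOn_dM hT hC
    (hK.mono predictable_le_prod le_rfl) measurableSet_Ioc hi] with ω hω hfin hint
  rw [hω, ← Ioo_union_right (pos_iff_ne_zero.2 ht), VectorMeasure.setIntegral_union
    (by simp) measurableSet_Ioo (measurableSet_singleton t)
    (hint.mono measurableSet_Ioc Ioo_subset_Ioc_self)
    (hint.mono measurableSet_Ioc (by simp [pos_iff_ne_zero, ht])),
    VectorMeasure.integral_singleton, dM_singleton hfin]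
  rfl

end Adapted

lemma abs_indicator_Ioc_prod_le (K : ℝ≥0 × Ω → ℝ) (s t : ℝ≥0) (A : Set Ω) (p : ℝ≥0 × Ω) :
    |(Ioc s t ×ˢ A).indicator K p| ≤ |(Ioc 0 t ×ˢ univ).indicator K p| := by
  rw [← Real.norm_eq_abs, ← Real.norm_eq_abs]
  exact norm_indicator_le_of_subset
    (prod_mono (Ioc_subset_Ioc_left zero_le) (subset_univ A)) K p

/-- `W` is a measurable version of the running integral `∫_{(0,t]} H dM` of a predictable process
`H` with `E ∫_{(0,t]} |H| |dM|` finite. -/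
structure IsRunningIntegral (P : Measure Ω) (F : Measure ℝ≥0)
    (hT : ∀ i, Measurable (T i)) (hC : ∀ i, Measurable (C i)) (H : ℝ≥0 × Ω → ℝ)
    (W : ℝ≥0 → Ω → ℝ) : Prop where
  predictable : Measurable[(obsFiltration P T C hT hC).predictable] H
  absMoment_lt_top : ∀ t, absMoment P F T C ((Ioc 0 t ×ˢ univ).indicator H) < ∞
  measurable : ∀ t, Measurable (W t)
  ae_eq : ∀ t, W t =ᵐ[P] fun ω => ∫ᵛ y in Ioc 0 t, H (y, ω) ∂•(dM F T C ω)

namespace IsRunningIntegral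

variable {H : ℝ≥0 × Ω → ℝ} {W : ℝ≥0 → Ω → ℝ} {s t : ℝ≥0} {A : Set Ω}

lemma absMoment_indicator_lt_top (hW : IsRunningIntegral P F hT hC H W) (s t : ℝ≥0) (A : Set Ω) :
    absMoment P F T C ((Ioc s t ×ˢ A).indicator H) < ∞ :=
  (absMoment_mono (abs_indicator_Ioc_prod_le H s t A)).trans_lt (hW.absMoment_lt_top t)

lemma indicator_sub_ae_eq [SFinite P] [IsFiniteMeasure F] (hW : IsRunningIntegral P F hT hC H W)
    (hst : s ≤ t) (A : Set Ω) :
    (A.indicator fun ω => W t ω - W s ω) =ᵐ[P]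
      stochIntegral F T C ((Ioc s t ×ˢ A).indicator H) := by
  rw [stochIntegral_indicator_prod measurableSet_Ioc]
  filter_upwards [hW.ae_eq t, hW.ae_eq s, ae_integrableOn_dM hT hC
    (hW.predictable.mono predictable_le_prod le_rfl) measurableSet_Ioc
    (hW.absMoment_lt_top t)] with ω ht hs hint
  have hsub : Ioc 0 s ⊆ Ioc 0 t := Ioc_subset_Ioc_right hst
  have hdiff : Ioc 0 t \ Ioc 0 s = Ioc s t := by
    ext y
    simp only [mem_sdiff, mem_Ioc, not_and, not_le]
    exact ⟨fun h => ⟨h.2 h.1.1, h.1.2⟩, fun h => ⟨⟨zero_le.trans_lt h.1, h.2⟩, fun _ => h.1⟩⟩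
  by_cases hω : ω ∈ A
  · rw [indicator_of_mem hω, indicator_of_mem hω, ht, hs, ← hdiff,
      VectorMeasure.setIntegral_sdiff measurableSet_Ioc measurableSet_Ioc hint hsub]
  · rw [indicator_of_notMem hω, indicator_of_notMem hω]

lemma integrable [IsFiniteMeasure F] (hW : IsRunningIntegral P F hT hC H W) (t : ℝ≥0) :
    Integrable (W t) P := by
  have hm := (hW.predictable.mono predictable_le_prod le_rfl).indicator
    ((measurableSet_Ioc (a := 0) (b := t)).prod (MeasurableSet.univ (α := Ω)))
  refine (integrable_stochIntegral hT hC hm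
    (hW.absMoment_lt_top t)).congr ?_
  rw [stochIntegral_indicator_prod measurableSet_Ioc, indicator_univ]
  exact (hW.ae_eq t).symm

variable [IsProbabilityMeasure P] [IsProbabilityMeasure F]

lemma measurable_obsFiltration (hW : IsRunningIntegral P F hT hC H W) (hS : IsSample P F T C)
    (t : ℝ≥0) : Measurable[obsFiltration P T C hT hC t] (W t) :=
  hS.measurable_setIntegral_Ioc hW.predictable (hW.absMoment_lt_top t) (hW.measurable t)
    (hW.ae_eq t)

lemma martingale (hW : IsRunningIntegral P F hT hC H W) (hS : IsSample P F T C) :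
    Martingale W (obsFiltration P T C hT hC) P := by
  refine martingale_of_setIntegral_sub_eq_zero
    (fun t => (hW.measurable_obsFiltration hS t).stronglyMeasurable) hW.integrable
    fun s t hst A hA => ?_
  rw [← integral_indicator ((obsFiltration P T C hT hC).le s A hA),
    integral_congr_ae (hW.indicator_sub_ae_eq hst A)]
  exact hS.integral_stochIntegral_eq_zero
    (measurable_indicator_Ioc_predictable hA t hW.predictable) (hW.absMoment_indicator_lt_top s t A)

end IsRunningIntegral

end Running

section Variation

variable {Ω : Type*} {mΩ : MeasurableSpace Ω} {n : ℕ} {P : Measure Ω} {F : Measure ℝ≥0}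
  {T C : Fin n → Ω → ℝ≥0} {hT : ∀ i, Measurable (T i)} {hC : ∀ i, Measurable (C i)}
  {H : ℝ≥0 × Ω → ℝ}

/-- The process `∫_{(0,t]} H² d⟨M⟩`, with the value `0` on the paths for which it is infinite. -/
def runningVariation (F : Measure ℝ≥0) (T C : Fin n → Ω → ℝ≥0) (H : ℝ≥0 × Ω → ℝ) (t : ℝ≥0)
    (ω : Ω) : ℝ :=
  ((varM F T C ω).withDensity fun y => ‖H (y, ω)‖ₑ ^ 2).real (Ioc 0 t)

lemma runningVariation_eq_toReal (F : Measure ℝ≥0) (T C : Fin n → Ω → ℝ≥0) (H : ℝ≥0 × Ω → ℝ)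
    (t : ℝ≥0) (ω : Ω) : runningVariation F T C H t ω =
      (∫⁻ y in Ioc 0 t, ‖H (y, ω)‖ₑ ^ 2 ∂(varM F T C ω)).toReal := by
  rw [runningVariation, Measure.real, withDensity_apply _ measurableSet_Ioc]

lemma setLIntegral_varM [IsFiniteMeasure F] (T C : Fin n → Ω → ℝ≥0) (ω : Ω) {g : ℝ≥0 → ℝ≥0∞}
    (hg : Measurable g) {s : Set ℝ≥0} (hs : MeasurableSet s) :
    ∫⁻ y in s, g y ∂(varM F T C ω) =
      ∫⁻ y in s ∩ Ioi 0, (F (Ici y))⁻¹ * ((1 - hazard F {y}) * atRisk T C y ω * g y) ∂F := by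
  have hw : Measurable fun y => (1 - hazard F {y}) * (atRisk T C y ω : ℝ≥0∞) :=
    ((measurable_measure_singleton _).const_sub 1).mul (measurable_atRisk_apply T C ω)
  exact (setLIntegral_withDensity_eq_setLIntegral_mul _ hw hg hs).trans
    (setLIntegral_hazard F (hw.mul hg) hs)

lemma measurable_lintegral_varM_predictable [IsFiniteMeasure F]
    (hH : Measurable[(obsFiltration P T C hT hC).predictable] H) :
    Measurable[(obsFiltration P T C hT hC).predictable] fun p : ℝ≥0 × Ω =>
      ∫⁻ y in Ioc 0 p.1, ‖H (y, p.2)‖ₑ ^ 2 ∂(varM F T C p.2) := by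
  have hY : Measurable[(obsFiltration P T C hT hC).predictable] fun p : ℝ≥0 × Ω =>
      (atRisk T C p.1 p.2 : ℝ≥0∞) := by
    simp only [atRisk, Nat.cast_sum, Nat.cast_ite, Nat.cast_one, Nat.cast_zero]
    exact Finset.measurable_sum _ fun i _ => measurable_atRisk_predictable i
  have hsq : Measurable fun r : ℝ => ‖r‖ₑ ^ 2 := measurable_enorm.pow_const 2
  have hw : Measurable[(obsFiltration P T C hT hC).predictable] fun p : ℝ≥0 × Ω =>
      (F (Ici p.1))⁻¹ * ((1 - hazard F {p.1}) * atRisk T C p.1 p.2 * ‖H p‖ₑ ^ 2) :=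
    ((measurable_measure_Ici F).inv.comp measurable_fst_predictable).mul
      (((((measurable_measure_singleton _).const_sub 1).comp
        measurable_fst_predictable).mul hY).mul (hsq.comp hH))
  convert measurable_lintegral_Ioc_predictable F hw using 2 with p
  have hg : Measurable fun y => ‖H (y, p.2)‖ₑ ^ 2 :=
    hsq.comp (hH.comp (measurable_prodMk_predictable p.2))
  rw [setLIntegral_varM T C p.2 hg measurableSet_Ioc, inter_eq_left.2 Ioc_subset_Ioi_self]

lemma measurable_lintegral_varM [IsFiniteMeasure F]
    (hH : Measurable[(obsFiltration P T C hT hC).predictable] H) (t : ℝ≥0) :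
    Measurable[obsFiltration P T C hT hC t] fun ω =>
      ∫⁻ y in Ioc 0 t, ‖H (y, ω)‖ₑ ^ 2 ∂(varM F T C ω) := by
  have hcomp := (measurable_lintegral_varM_predictable (F := F) hH).comp
    (measurable_prodMk_left_predictable t)
  exact hcomp

lemma varMoment_indicator (H : ℝ≥0 × Ω → ℝ) (s t : ℝ≥0) {A : Set Ω} (hA : MeasurableSet A) :
    varMoment P F T C ((Ioc s t ×ˢ A).indicator H) =
      ∫⁻ ω in A, ∫⁻ y in Ioc s t, ‖H (y, ω)‖ₑ ^ 2 ∂(varM F T C ω) ∂P := by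
  rw [varMoment, ← lintegral_indicator hA]
  refine lintegral_congr fun ω => ?_
  by_cases hω : ω ∈ A
  · rw [indicator_of_mem hω, ← lintegral_indicator measurableSet_Ioc]
    refine lintegral_congr fun y => ?_
    by_cases hy : y ∈ Ioc s t
    · rw [indicator_of_mem hy, indicator_of_mem (mk_mem_prod hy hω)]
    · rw [indicator_of_notMem hy, indicator_of_notMem fun h => hy h.1]
      simp
  · simp [hω]

lemma runningVariation_sub {ω : Ω} {s t : ℝ≥0} (hst : s ≤ t)
    (h : ∫⁻ y in Ioc 0 t, ‖H (y, ω)‖ₑ ^ 2 ∂(varM F T C ω) ≠ ∞) :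
    runningVariation F T C H t ω - runningVariation F T C H s ω =
      (∫⁻ y in Ioc s t, ‖H (y, ω)‖ₑ ^ 2 ∂(varM F T C ω)).toReal := by
  have hsplit : ∫⁻ y in Ioc 0 t, ‖H (y, ω)‖ₑ ^ 2 ∂(varM F T C ω) =
      ∫⁻ y in Ioc 0 s, ‖H (y, ω)‖ₑ ^ 2 ∂(varM F T C ω) +
        ∫⁻ y in Ioc s t, ‖H (y, ω)‖ₑ ^ 2 ∂(varM F T C ω) := by
    rw [← lintegral_union measurableSet_Ioc (Ioc_disjoint_Ioc_of_le le_rfl),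
      Ioc_union_Ioc_eq_Ioc zero_le hst]
  rw [hsplit] at h
  rw [runningVariation_eq_toReal, runningVariation_eq_toReal, hsplit,
    ENNReal.toReal_add (ne_top_of_le_ne_top h le_self_add) (ne_top_of_le_ne_top h le_add_self),
    add_sub_cancel_left]

namespace IsRunningIntegral

variable {W : ℝ≥0 → Ω → ℝ} {s t : ℝ≥0} {A : Set Ω}

lemma ae_lintegral_varM_ne_top [IsFiniteMeasure F]
    (hW : IsRunningIntegral P F hT hC H W)
    (hv : ∀ t, ∫⁻ ω, ∫⁻ y in Ioc 0 t, ‖H (y, ω)‖ₑ ^ 2 ∂(varM F T C ω) ∂P < ∞) :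
    ∀ᵐ ω ∂P, ∀ t, ∫⁻ y in Ioc 0 t, ‖H (y, ω)‖ₑ ^ 2 ∂(varM F T C ω) ≠ ∞ := by
  have hnat : ∀ᵐ ω ∂P, ∀ k : ℕ, ∫⁻ y in Ioc 0 (k : ℝ≥0), ‖H (y, ω)‖ₑ ^ 2 ∂(varM F T C ω) < ∞ :=
    ae_all_iff.2 fun k => ae_lt_top ((measurable_lintegral_varM hW.predictable k).mono
      ((obsFiltration P T C hT hC).le k) le_rfl) (hv k).ne
  filter_upwards [hnat] with ω hω t
  obtain ⟨k, hk⟩ := exists_nat_ge t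
  exact ((lintegral_mono_set (Ioc_subset_Ioc_right hk)).trans_lt (hω k)).ne

lemma integrable_runningVariation [IsFiniteMeasure F] (hW : IsRunningIntegral P F hT hC H W)
    (hv : ∀ t, ∫⁻ ω, ∫⁻ y in Ioc 0 t, ‖H (y, ω)‖ₑ ^ 2 ∂(varM F T C ω) ∂P < ∞) (t : ℝ≥0) :
    Integrable (runningVariation F T C H t) P := by
  simp_rw [funext fun ω => runningVariation_eq_toReal F T C H t ω]
  exact integrable_toReal_of_lintegral_ne_top ((measurable_lintegral_varM hW.predictable t).mono
    ((obsFiltration P T C hT hC).le t) le_rfl).aemeasurable (hv t).ne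

variable [IsProbabilityMeasure P] [IsProbabilityMeasure F]

lemma setLIntegral_sq_sub (hW : IsRunningIntegral P F hT hC H W) (hS : IsSample P F T C)
    (hv : ∀ t, ∫⁻ ω, ∫⁻ y in Ioc 0 t, ‖H (y, ω)‖ₑ ^ 2 ∂(varM F T C ω) ∂P < ∞) (hst : s ≤ t)
    (hA : MeasurableSet[obsFiltration P T C hT hC s] A) :
    ∫⁻ ω in A, ‖W t ω - W s ω‖ₑ ^ 2 ∂P =
      ∫⁻ ω in A, ∫⁻ y in Ioc s t, ‖H (y, ω)‖ₑ ^ 2 ∂(varM F T C ω) ∂P := by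
  have hA' := (obsFiltration P T C hT hC).le s A hA
  have hvar : varMoment P F T C ((Ioc s t ×ˢ A).indicator H) < ∞ := by
    refine (varMoment_mono (abs_indicator_Ioc_prod_le H s t A)).trans_lt ?_
    rw [varMoment_indicator H 0 t .univ, Measure.restrict_univ]
    exact hv t
  rw [← varMoment_indicator H s t hA', ← hS.lintegral_stochIntegral_sq
    (measurable_indicator_Ioc_predictable hA t hW.predictable)
    (hW.absMoment_indicator_lt_top s t A) hvar, ← lintegral_indicator hA']
  refine lintegral_congr_ae ?_
  filter_upwards [hW.indicator_sub_ae_eq hst A] with ω hω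
  rw [← hω]
  by_cases h : ω ∈ A <;> simp [h]

lemma memLp_two (hW : IsRunningIntegral P F hT hC H W) (hS : IsSample P F T C)
    (hv : ∀ t, ∫⁻ ω, ∫⁻ y in Ioc 0 t, ‖H (y, ω)‖ₑ ^ 2 ∂(varM F T C ω) ∂P < ∞) (t : ℝ≥0) :
    MemLp (W t) 2 P := by
  have hsub : W t =ᵐ[P] fun ω => W t ω - W 0 ω := by
    filter_upwards [hW.ae_eq 0] with ω hω
    simp [hω]
  refine ⟨(hW.measurable t).aestronglyMeasurable, ?_⟩
  have hinc := hW.setLIntegral_sq_sub hS hv (zero_le (a := t))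
    (@MeasurableSet.univ _ (obsFiltration P T C hT hC 0))
  rw [Measure.restrict_univ, ← eLpNorm_two_sq] at hinc
  refine eLpNorm_congr_ae hsub ▸ lt_top_iff_ne_top.2 fun htop => (hv t).ne ?_
  rw [← hinc, htop]
  simp

lemma setIntegral_sq_sub (hW : IsRunningIntegral P F hT hC H W) (hS : IsSample P F T C)
    (hv : ∀ t, ∫⁻ ω, ∫⁻ y in Ioc 0 t, ‖H (y, ω)‖ₑ ^ 2 ∂(varM F T C ω) ∂P < ∞) (hst : s ≤ t)
    (hA : MeasurableSet[obsFiltration P T C hT hC s] A) :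
    ∫ ω in A, (W t ω - W s ω) ^ 2 ∂P =
      ∫ ω in A, (runningVariation F T C H t ω - runningVariation F T C H s ω) ∂P := by
  have hfin := hW.ae_lintegral_varM_ne_top hv
  have hinc : ∀ᵐ ω ∂P, runningVariation F T C H t ω - runningVariation F T C H s ω =
      (∫⁻ y in Ioc s t, ‖H (y, ω)‖ₑ ^ 2 ∂(varM F T C ω)).toReal := by
    filter_upwards [hfin] with ω hω using runningVariation_sub hst (hω t)
  have hnonneg : ∀ᵐ ω ∂P, 0 ≤ runningVariation F T C H t ω - runningVariation F T C H s ω := by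
    filter_upwards [hinc] with ω hω
    exact hω ▸ ENNReal.toReal_nonneg
  have hsq : Measurable fun ω => (W t ω - W s ω) ^ 2 :=
    ((hW.measurable t).sub (hW.measurable s)).pow_const 2
  rw [integral_eq_lintegral_of_nonneg_ae (ae_of_all _ fun ω => sq_nonneg _)
      hsq.aestronglyMeasurable,
    integral_eq_lintegral_of_nonneg_ae (ae_restrict_of_ae hnonneg)
      ((hW.integrable_runningVariation hv t).sub
        (hW.integrable_runningVariation hv s)).aestronglyMeasurable.restrict]
  congr 1
  calc ∫⁻ ω in A, ENNReal.ofReal ((W t ω - W s ω) ^ 2) ∂P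
      = ∫⁻ ω in A, ‖W t ω - W s ω‖ₑ ^ 2 ∂P := lintegral_congr fun ω => by
        rw [Real.enorm_eq_ofReal_abs, ← ENNReal.ofReal_pow (abs_nonneg _), sq_abs]
    _ = ∫⁻ ω in A, ∫⁻ y in Ioc s t, ‖H (y, ω)‖ₑ ^ 2 ∂(varM F T C ω) ∂P :=
        hW.setLIntegral_sq_sub hS hv hst hA
    _ = _ := lintegral_congr_ae <| ae_restrict_of_ae <| by
        filter_upwards [hinc, hfin] with ω hω hωt
        rw [hω, ENNReal.ofReal_toReal (ne_top_of_le_ne_top (hωt t)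
          (lintegral_mono_set (Ioc_subset_Ioc_left zero_le)))]

lemma isSquareIntegrableMartingale (hW : IsRunningIntegral P F hT hC H W) (hS : IsSample P F T C)
    (hv : ∀ t, ∫⁻ ω, ∫⁻ y in Ioc 0 t, ‖H (y, ω)‖ₑ ^ 2 ∂(varM F T C ω) ∂P < ∞) :
    IsSquareIntegrableMartingale (obsFiltration P T C hT hC) P W :=
  ⟨hW.martingale hS, hW.memLp_two hS hv⟩

lemma isPredictableVariation (hW : IsRunningIntegral P F hT hC H W) (hS : IsSample P F T C)
    (hv : ∀ t, ∫⁻ ω, ∫⁻ y in Ioc 0 t, ‖H (y, ω)‖ₑ ^ 2 ∂(varM F T C ω) ∂P < ∞) :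
    IsPredictableVariation (obsFiltration P T C hT hC) P W (runningVariation F T C H) := by
  have hfin : ∀ᵐ ω ∂P, ∀ t,
      ((varM F T C ω).withDensity fun y => ‖H (y, ω)‖ₑ ^ 2) (Ioc 0 t) ≠ ∞ := by
    filter_upwards [hW.ae_lintegral_varM_ne_top hv] with ω hω t
    rw [withDensity_apply _ measurableSet_Ioc]
    exact hω t
  refine ⟨?_, ae_of_all _ fun ω => by simp [runningVariation], ?_, ?_, ?_⟩
  · refine Measurable.stronglyMeasurable ?_
    simp only [Function.uncurry_def, runningVariation_eq_toReal]
    exact (measurable_lintegral_varM_predictable hW.predictable).ennreal_toReal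
  · filter_upwards [hfin] with ω hω using monotone_measureReal_Ioc hω
  · filter_upwards [hfin] with ω hω using continuousWithinAt_Ici_measureReal_Ioc hω
  · refine martingale_sq_sub (hW.martingale hS) (hW.memLp_two hS hv) (fun t => ?_)
      (hW.integrable_runningVariation hv) fun s t hst A hA => hW.setIntegral_sq_sub hS hv hst hA
    simp_rw [funext fun ω => runningVariation_eq_toReal F T C H t ω]
    exact (measurable_lintegral_varM hW.predictable t).ennreal_toReal.stronglyMeasurable

end IsRunningIntegral

end Variation

section Pooled

variable {Ω : Type*} {mΩ : MeasurableSpace Ω} {n : ℕ} {P : Measure Ω} {F : Measure ℝ≥0}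
  {T C : Fin n → Ω → ℝ≥0} {hT : ∀ i, Measurable (T i)} {hC : ∀ i, Measurable (C i)}

lemma measurable_counting (hT : ∀ i, Measurable (T i)) (hC : ∀ i, Measurable (C i)) (t : ℝ≥0) :
    Measurable fun ω => counting T C t ω := by
  unfold counting
  refine Finset.measurable_sum _ fun i _ => Measurable.ite ?_ measurable_const measurable_const
  exact (measurableSet_le (measurable_obsTime hT hC i) measurable_const).inter
    (measurableSet_uncensored hT hC i)

lemma measurable_pooledM [IsFiniteMeasure F] (hT : ∀ i, Measurable (T i))
    (hC : ∀ i, Measurable (C i)) (t : ℝ≥0) : Measurable (pooledM F T C t) := by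
  have hN : Measurable fun ω => (counting T C t ω : ℝ) :=
    measurable_from_top.comp (measurable_counting hT hC t)
  have hY : Measurable fun q : Ω × ℝ≥0 => (atRisk T C q.2 q.1 : ℝ) :=
    measurable_from_top.comp ((measurable_atRisk hT hC).comp measurable_swap)
  exact hN.sub (hY.stronglyMeasurable.integral_prod_right'
    (ν := (hazard F).restrict (Ioc 0 t))).measurable

lemma dM_singleton_zero {ω : Ω} (hω : ω ∈ finitePaths F T C) (hpos : ∀ i, 0 < T i ω) :
    dM F T C ω {0} = 0 := by
  have hcensored (i : Fin n) : ¬ (obsTime T C i ω = 0 ∧ T i ω ≤ C i ω) := fun h =>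
    (hpos i).ne' ((min_eq_left h.2).symm.trans h.1)
  rw [dM_singleton hω]
  simp [jumpAt, hazard_zero, hcensored]

lemma dM_Ioc_zero {ω : Ω} (hω : ω ∈ finitePaths F T C) (hpos : ∀ i, 0 < T i ω) (t : ℝ≥0) :
    dM F T C ω (Ioc 0 t) = pooledM F T C t ω := by
  have hIic : Iic t = {0} ∪ Ioc 0 t := by
    rw [← Icc_bot, bot_eq_zero, ← Icc_self 0, Icc_union_Ioc_eq_Icc le_rfl zero_le]
  rw [← dM_Iic F T C ω hω t, hIic, VectorMeasure.of_union (by simp) (measurableSet_singleton 0)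
    measurableSet_Ioc, dM_singleton_zero hω hpos, zero_add]

variable [IsProbabilityMeasure F]

lemma IsSample.lintegral_varM_lt_top (hS : IsSample P F T C) :
    ∫⁻ ω, varM F T C ω univ ∂P < ∞ := by
  have hle (ω : Ω) : varM F T C ω univ ≤ ∑ j, hazard F (Iic (obsTime T C j ω)) := by
    calc varM F T C ω univ ≤ compensatorMeasure F T C ω univ := by
          rw [varM_eq_withDensity_compensatorMeasure, withDensity_apply _ MeasurableSet.univ]
          simpa using lintegral_mono (μ := compensatorMeasure F T C ω)
            fun y => (tsub_le_self : 1 - hazard F {y} ≤ 1)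
      _ = ∑ j, hazard F (Iic (obsTime T C j ω)) := by
          rw [compensatorMeasure_eq_sum, Measure.finsetSum_apply]
          simp
  calc ∫⁻ ω, varM F T C ω univ ∂P
      ≤ ∫⁻ ω, ∑ j, hazard F (Iic (obsTime T C j ω)) ∂P := lintegral_mono hle
    _ = ∑ j, ∫⁻ ω, hazard F (Iic (obsTime T C j ω)) ∂P :=
        lintegral_finsetSum _ fun j _ =>
          (measurable_measure_Iic _).comp (hS.measurable_obsTime j)
    _ < ∞ := ENNReal.sum_lt_top.2 fun j _ =>
        (hS.lintegral_hazard_Iic_le j).trans_lt ENNReal.one_lt_top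

lemma IsSample.lintegral_varM_Ioc_lt_top (hS : IsSample P F T C) (t : ℝ≥0) :
    ∫⁻ ω, varM F T C ω (Ioc 0 t) ∂P < ∞ :=
  (lintegral_mono fun _ => measure_mono (subset_univ _)).trans_lt hS.lintegral_varM_lt_top

variable [IsProbabilityMeasure P]

lemma IsSample.isRunningIntegral_pooledM (hS : IsSample P F T C) :
    IsRunningIntegral P F hT hC (fun _ => 1) (pooledM F T C) where
  predictable := measurable_const
  absMoment_lt_top t := by
    refine hS.absMoment_lt_top_of_bound (c := 1)
      (measurable_const.indicator (measurableSet_Ioc.prod MeasurableSet.univ)) fun p => ?_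
    rw [← Real.norm_eq_abs]
    exact (norm_indicator_le_norm_self _ p).trans (by simp)
  measurable := measurable_pooledM hT hC
  ae_eq t := by
    filter_upwards [hS.ae_finitePaths, ae_all_iff.2 hS.ae_T_pos] with ω hω hpos
    simp [dM_Ioc_zero hω hpos]

lemma IsSample.isSquareIntegrableMartingale_pooledM (hS : IsSample P F T C) :
    IsSquareIntegrableMartingale (obsFiltration P T C hT hC) P (pooledM F T C) :=
  hS.isRunningIntegral_pooledM.isSquareIntegrableMartingale hS fun t => by
    simpa using hS.lintegral_varM_Ioc_lt_top t

lemma IsSample.isPredictableVariation_pooledM (hS : IsSample P F T C) :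
    IsPredictableVariation (obsFiltration P T C hT hC) P (pooledM F T C)
      fun t ω => (varM F T C ω).real (Ioc 0 t) := by
  have hM := hS.isRunningIntegral_pooledM (hT := hT) (hC := hC)
  have hV : (fun t ω => (varM F T C ω).real (Ioc 0 t)) = runningVariation F T C fun _ => 1 := by
    ext t ω
    simp [runningVariation]
  rw [hV]
  exact hM.isPredictableVariation hS fun t => by simpa using hS.lintegral_varM_Ioc_lt_top t

end Pooled

section DoubleIntegral

variable {Ω : Type*} {mΩ : MeasurableSpace Ω} {n : ℕ} {P : Measure Ω} {F : Measure ℝ≥0}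
  {T C : Fin n → Ω → ℝ≥0} {hT : ∀ i, Measurable (T i)} {hC : ∀ i, Measurable (C i)}
  {h : ℝ≥0 → ℝ≥0 → Ω → ℝ}

lemma measurableSet_domC (t : ℝ≥0) : MeasurableSet (domC t) :=
  (measurableSet_lt measurable_const measurable_fst).inter
    ((measurableSet_lt measurable_fst measurable_snd).inter
      (measurableSet_le (f := fun p : ℝ≥0 × ℝ≥0 => p.2) measurable_snd measurable_const))

lemma indicator_domC_eq (h : ℝ≥0 → ℝ≥0 → Ω → ℝ) (t : ℝ≥0) (ω : Ω) (p : ℝ≥0 × ℝ≥0) :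
    (domC t).indicator (fun p => h p.1 p.2 ω) p =
      if p.2 ≤ t then (orderedPairs Ω).indicator (fun q => h q.1 q.2.1 q.2.2) (p.1, p.2, ω)
      else 0 := by
  by_cases h₀ : 0 < p.1 <;> by_cases h₁ : p.1 < p.2 <;> by_cases h₂ : p.2 ≤ t <;>
    simp [domC, orderedPairs, h₀, h₁, h₂]

lemma indicator_domC_left (h : ℝ≥0 → ℝ≥0 → Ω → ℝ) (t : ℝ≥0) (ω : Ω) (x y : ℝ≥0) :
    (domC t).indicator (fun p => h p.1 p.2 ω) (x, y) =
      (Iic t).indicator (fun y => (Ioo 0 y).indicator (fun x => h x y ω) x) y := by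
  rw [indicator_domC_eq]
  rfl

lemma measurable_indicator_domC (hh : IsTwoTimePredictable (obsFiltration P T C hT hC) h)
    (t : ℝ≥0) : Measurable fun q : Ω × ℝ≥0 × ℝ≥0 =>
      (domC t).indicator (fun p => h p.1 p.2 q.1) q.2 := by
  simp_rw [indicator_domC_eq]
  refine Measurable.ite (measurableSet_le measurable_snd.snd measurable_const) ?_ measurable_const
  exact (hh.measurable_indicator.mono twoTimePredictable_le_prod le_rfl).comp
    (measurable_snd.fst.prodMk (measurable_snd.snd.prodMk measurable_fst))

section Kernels

variable [IsFiniteMeasure F]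

/-- The total variation `|dM|` as a kernel. -/
def variationKernel (F : Measure ℝ≥0) [IsFiniteMeasure F] (hT : ∀ i, Measurable (T i))
    (hC : ∀ i, Measurable (C i)) : Kernel Ω ℝ≥0 :=
  (pathKernel F hT hC).withDensity fun ω y => ‖signDensity F T C ω y‖ₑ

instance (hT : ∀ i, Measurable (T i)) (hC : ∀ i, Measurable (C i)) :
    IsSFiniteKernel (variationKernel F hT hC) :=
  Kernel.IsSFiniteKernel.withDensity _ fun _ _ => enorm_ne_top

lemma variationKernel_apply (hT : ∀ i, Measurable (T i)) (hC : ∀ i, Measurable (C i)) (ω : Ω) :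
    variationKernel F hT hC ω = (dM F T C ω).variation := by
  have hρ : Measurable fun q : Ω × ℝ≥0 => ‖signDensity F T C q.1 q.2‖ₑ :=
    ((measurable_signDensity hT hC).comp measurable_swap).enorm
  rw [variationKernel, Kernel.withDensity_apply _ hρ, pathKernel_apply, variation_dM hT hC]

lemma integral_prod_dM_symm (hT : ∀ i, Measurable (T i)) (hC : ∀ i, Measurable (C i)) (ω : Ω)
    {f : ℝ≥0 × ℝ≥0 → ℝ}
    (hf : Integrable f ((dM F T C ω).variation.prod (dM F T C ω).variation)) :
    ∫ᵛ p, f p ∂•((dM F T C ω).prod (dM F T C ω) (ContinuousLinearMap.mul ℝ ℝ)) =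
      ∫ᵛ y, ∫ᵛ x, f (x, y) ∂•(dM F T C ω) ∂•(dM F T C ω) := by
  have hρ := measurable_signDensity_apply (F := F) hT hC ω
  have hρi := integrable_signDensity (F := F) hT hC (pathMeasure F T C ω) ω
  rw [dM_eq_withDensityᵥ hT hC] at hf ⊢
  exact integral_prod_withDensityᵥ_symm hρ hρi hρ hρi hf

lemma doubleIntegral_eq_integral_pathMeasure_prod (hT : ∀ i, Measurable (T i))
    (hC : ∀ i, Measurable (C i)) (h : ℝ≥0 → ℝ≥0 → Ω → ℝ) (t : ℝ≥0) (ω : Ω) :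
    doubleIntegral F T C h t ω = ∫ p, (domC t).indicator (fun p => h p.1 p.2 ω) p *
      (signDensity F T C ω p.1 * signDensity F T C ω p.2)
        ∂((pathMeasure F T C ω).prod (pathMeasure F T C ω)) := by
  have hρ := measurable_signDensity_apply (F := F) hT hC ω
  have hρi := integrable_signDensity (F := F) hT hC (pathMeasure F T C ω) ω
  have hρρ : Measurable fun p : ℝ≥0 × ℝ≥0 => signDensity F T C ω p.1 * signDensity F T C ω p.2 :=
    (hρ.comp measurable_fst).mul (hρ.comp measurable_snd)
  rw [doubleIntegral, ← VectorMeasure.integral_indicator (measurableSet_domC t),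
    dM_eq_withDensityᵥ hT hC, prod_withDensityᵥ hρi hρi,
    integral_withDensityᵥ hρρ (hρi.mul_prod hρi)]

lemma measurable_doubleIntegral (hh : IsTwoTimePredictable (obsFiltration P T C hT hC) h)
    (t : ℝ≥0) : Measurable (doubleIntegral F T C h t) := by
  have hρ : Measurable fun q : Ω × ℝ≥0 => signDensity F T C q.1 q.2 :=
    (measurable_signDensity hT hC).comp measurable_swap
  have hf : Measurable fun q : Ω × ℝ≥0 × ℝ≥0 => (domC t).indicator (fun p => h p.1 p.2 q.1) q.2 *
      (signDensity F T C q.1 q.2.1 * signDensity F T C q.1 q.2.2) :=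
    (measurable_indicator_domC hh t).mul
      ((hρ.comp (measurable_fst.prodMk measurable_snd.fst)).mul
        (hρ.comp (measurable_fst.prodMk measurable_snd.snd)))
  have hW := (hf.stronglyMeasurable.integral_kernel_prod_right'
    (κ := pathKernel F hT hC ×ₖ pathKernel F hT hC)).measurable
  simp only [Kernel.prod_apply, pathKernel_apply,
    ← doubleIntegral_eq_integral_pathMeasure_prod hT hC] at hW
  exact hW

lemma ae_integrable_indicator_domC (hh : IsTwoTimePredictable (obsFiltration P T C hT hC) h)
    {t : ℝ≥0} (hint : ∫⁻ ω, ∫⁻ p in domC t, ‖h p.1 p.2 ω‖ₑ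
      ∂((dM F T C ω).variation.prod (dM F T C ω).variation) ∂P < ∞) :
    ∀ᵐ ω ∂P, Integrable ((domC t).indicator fun p => h p.1 p.2 ω)
      ((dM F T C ω).variation.prod (dM F T C ω).variation) := by
  have hm := measurable_indicator_domC hh t
  have hlint := hm.enorm.lintegral_kernel_prod_right'
    (κ := variationKernel F hT hC ×ₖ variationKernel F hT hC)
  simp only [Kernel.prod_apply, variationKernel_apply] at hlint
  simp only [← lintegral_indicator (measurableSet_domC t), ← enorm_indicator_eq_indicator_enorm]
    at hint
  filter_upwards [ae_lt_top hlint hint.ne] with ω hω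
  exact ⟨(hm.comp measurable_prodMk_left).aestronglyMeasurable, hω⟩

end Kernels

lemma integral_indicator_domC (h : ℝ≥0 → ℝ≥0 → Ω → ℝ) (t : ℝ≥0) (ω : Ω) (ν : SignedMeasure ℝ≥0)
    (y : ℝ≥0) :
    ∫ᵛ x, (domC t).indicator (fun p => h p.1 p.2 ω) (x, y) ∂•ν =
      (Ioc 0 t).indicator (fun y => ∫ᵛ x in Ioo 0 y, h x y ω ∂•ν) y := by
  rw [show (fun x => (domC t).indicator (fun p => h p.1 p.2 ω) (x, y)) = fun x =>
    (Iic t).indicator (fun y => (Ioo 0 y).indicator (fun x => h x y ω) x) y from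
      funext fun x => indicator_domC_left h t ω x y]
  by_cases hy : y ∈ Ioc 0 t
  · rw [indicator_of_mem hy, ← VectorMeasure.integral_indicator measurableSet_Ioo]
    simp only [indicator_of_mem (mem_Iic.2 hy.2)]
  · rw [indicator_of_notMem hy]
    by_cases hyt : y ≤ t
    · obtain rfl : y = 0 := by simpa [hyt] using hy
      simp
    · simp [hyt]

lemma IsSample.isRunningIntegral_doubleIntegral [IsProbabilityMeasure P] [IsProbabilityMeasure F]
    (hS : IsSample P F T C) (hh : IsTwoTimePredictable (obsFiltration P T C hT hC) h)
    (hint : ∀ t, ∫⁻ ω, ∫⁻ p in domC t, ‖h p.1 p.2 ω‖ₑ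
      ∂((dM F T C ω).variation.prod (dM F T C ω).variation) ∂P < ∞) :
    IsRunningIntegral P F hT hC (fun p => ∫ᵛ x in Ioo 0 p.1, h x p.1 p.2 ∂•(dM F T C p.2))
      (doubleIntegral F T C h) where
  predictable := hS.measurable_setIntegral_Ioo_predictable hh
  absMoment_lt_top t := by
    refine lt_of_le_of_lt (lintegral_mono fun ω => ?_) (hint t)
    have hm : Measurable ((domC t).indicator fun p => h p.1 p.2 ω) :=
      (measurable_indicator_domC hh t).comp measurable_prodMk_left
    rw [← lintegral_indicator (measurableSet_domC t)]
    simp only [← enorm_indicator_eq_indicator_enorm]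
    rw [lintegral_prod_symm _ hm.enorm.aemeasurable]
    refine lintegral_mono fun y => ?_
    refine le_trans (le_of_eq ?_) (enorm_integral_lsmul_le_lintegral_enorm _ _)
    rw [integral_indicator_domC]
    by_cases hy : y ∈ Ioc 0 t <;> simp [hy]
  measurable := measurable_doubleIntegral hh
  ae_eq t := by
    filter_upwards [ae_integrable_indicator_domC hh (hint t)] with ω hω
    rw [doubleIntegral, ← VectorMeasure.integral_indicator (measurableSet_domC t),
      integral_prod_dM_symm hT hC ω hω, ← VectorMeasure.integral_indicator measurableSet_Ioc]
    simp only [integral_indicator_domC]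

end DoubleIntegral

section DoubleVariation

variable {Ω : Type*} {mΩ : MeasurableSpace Ω} {n : ℕ} {F : Measure ℝ≥0}
  [IsFiniteMeasure F] {T C : Fin n → Ω → ℝ≥0}

lemma ofReal_survival_div_survivalLeft_sq {y : ℝ≥0} (hy : 0 < y) (hFy : F (Ici y) ≠ 0) :
    ENNReal.ofReal (survival F y / survivalLeft F y ^ 2) =
      (F (Ici y))⁻¹ * (1 - hazard F {y}) := by
  have hpos : 0 < survivalLeft F y := ENNReal.toReal_pos hFy (measure_ne_top _ _)
  rw [one_sub_hazard_singleton hy hFy, ENNReal.ofReal_div_of_pos (by positivity),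
    ENNReal.ofReal_pow hpos.le, survival, survivalLeft, ofReal_measureReal, ofReal_measureReal,
    div_eq_mul_inv, ENNReal.inv_pow]
  ring

lemma measurable_survival (F : Measure ℝ≥0) [IsFiniteMeasure F] : Measurable (survival F) :=
  Antitone.measurable fun _ _ hab => measureReal_mono (Ioi_subset_Ioi hab)

lemma measurable_survivalLeft (F : Measure ℝ≥0) [IsFiniteMeasure F] :
    Measurable (survivalLeft F) :=
  Antitone.measurable fun _ _ hab => measureReal_mono (Ici_subset_Ici.2 hab)

lemma setIntegral_sq_mul_survival_eq_runningVariation {H : ℝ≥0 × Ω → ℝ} (hH : Measurable H)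
    (t : ℝ≥0) (ω : Ω) :
    ∫ y in Ioc 0 t, H (y, ω) ^ 2 *
      ((atRisk T C y ω : ℝ) * survival F y / survivalLeft F y ^ 2) ∂F =
        runningVariation F T C H t ω := by
  have hHω : Measurable fun y => H (y, ω) := hH.comp measurable_prodMk_right
  have hY : Measurable fun y => (atRisk T C y ω : ℝ) := by
    simpa using (measurable_atRisk_apply T C ω).ennreal_toReal
  have hm : Measurable fun y => H (y, ω) ^ 2 *
      ((atRisk T C y ω : ℝ) * survival F y / survivalLeft F y ^ 2) :=
    (hHω.pow_const 2).mul
      ((hY.mul (measurable_survival F)).div ((measurable_survivalLeft F).pow_const 2))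
  have hnonneg : ∀ y, 0 ≤ H (y, ω) ^ 2 *
      ((atRisk T C y ω : ℝ) * survival F y / survivalLeft F y ^ 2) := fun y => by
    have hs : 0 ≤ survival F y := measureReal_nonneg
    positivity
  rw [integral_eq_lintegral_of_nonneg_ae (ae_of_all _ hnonneg) hm.aestronglyMeasurable,
    runningVariation_eq_toReal, setLIntegral_varM T C ω (hHω.enorm.pow_const 2) measurableSet_Ioc,
    inter_eq_left.2 Ioc_subset_Ioi_self]
  congr 1
  refine lintegral_congr_ae ?_
  filter_upwards [ae_restrict_mem measurableSet_Ioc,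
    ae_restrict_of_ae (ae_measure_Ici_ne_zero F)] with y hy hFy
  rw [mul_div_assoc, ENNReal.ofReal_mul (sq_nonneg _), ENNReal.ofReal_mul (Nat.cast_nonneg _),
    ofReal_survival_div_survivalLeft_sq hy.1 hFy, ENNReal.ofReal_natCast,
    Real.enorm_eq_ofReal_abs, ← ENNReal.ofReal_pow (abs_nonneg _), sq_abs]
  ring

lemma doubleVariation_eq_runningVariation {h : ℝ≥0 → ℝ≥0 → Ω → ℝ}
    (hH : Measurable fun p : ℝ≥0 × Ω => ∫ᵛ x in Ioo 0 p.1, h x p.1 p.2 ∂•(dM F T C p.2)) :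
    doubleVariation F T C h =
      runningVariation F T C fun p => ∫ᵛ x in Ioo 0 p.1, h x p.1 p.2 ∂•(dM F T C p.2) :=
  funext₂ fun t ω => setIntegral_sq_mul_survival_eq_runningVariation hH t ω

end DoubleVariation

end Censored

end

theorem mainTheorem8_general {Ω : Type*} {mΩ : MeasurableSpace Ω} (P : Measure Ω)
    [IsProbabilityMeasure P] (F : Measure ℝ≥0) [IsProbabilityMeasure F] (hF : F {0} = 0)
    {n : ℕ} (T C : Fin n → Ω → ℝ≥0)
    (hT : ∀ i, Measurable (T i)) (hC : ∀ i, Measurable (C i))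
    (hTF : ∀ i, P.map (T i) = F) (hTind : iIndepFun T P)
    (hTC : IndepFun (fun ω i => T i ω) (fun ω i => C i ω) P)
    (h : ℝ≥0 → ℝ≥0 → Ω → ℝ)
    (hh : Censored.IsTwoTimePredictable (Censored.obsFiltration P T C hT hC) h)
    (hint : ∀ t, ∫⁻ ω, ∫⁻ p in Censored.domC t, ‖h p.1 p.2 ω‖ₑ
      ∂((Censored.dM F T C ω).variation.prod (Censored.dM F T C ω).variation) ∂P < ∞) :
    (Censored.IsSquareIntegrableMartingale (Censored.obsFiltration P T C hT hC) P
        (Censored.pooledM F T C) ∧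
      Censored.IsPredictableVariation (Censored.obsFiltration P T C hT hC) P
        (Censored.pooledM F T C) (fun t ω => (Censored.varM F T C ω).real (Ioc 0 t))) ∧
    Martingale (Censored.doubleIntegral F T C h) (Censored.obsFiltration P T C hT hC) P ∧
    ((∀ t, ∫⁻ ω, ∫⁻ y in Ioc 0 t, ‖∫ᵛ x in Ioo 0 y, h x y ω ∂•(Censored.dM F T C ω)‖ₑ ^ 2
        ∂(Censored.varM F T C ω) ∂P < ∞) →
      Censored.IsSquareIntegrableMartingale (Censored.obsFiltration P T C hT hC) P
        (Censored.doubleIntegral F T C h) ∧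
      Censored.IsPredictableVariation (Censored.obsFiltration P T C hT hC) P
        (Censored.doubleIntegral F T C h) (Censored.doubleVariation F T C h)) := by
  have hS : Censored.IsSample P F T C := ⟨hT, hC, hTF, hF, hTind, hTC⟩
  have hW := hS.isRunningIntegral_doubleIntegral hh hint
  refine ⟨⟨hS.isSquareIntegrableMartingale_pooledM, hS.isPredictableVariation_pooledM⟩,
    hW.martingale hS, fun hsq => ?_⟩
  rw [Censored.doubleVariation_eq_runningVariation
    (hW.predictable.mono Censored.predictable_le_prod le_rfl)]
  exact ⟨hW.isSquareIntegrableMartingale hS hsq, hW.isPredictableVariation hS hsq⟩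

theorem mainTheorem8 {Ω : Type*} {mΩ : MeasurableSpace Ω} (P : Measure Ω) [IsProbabilityMeasure P]
    (F G : Measure ℝ≥0) [IsProbabilityMeasure F] [IsProbabilityMeasure G]
    (hF : F {0} = 0) (hG : G {0} = 0)
    {n : ℕ} (T C : Fin n → Ω → ℝ≥0)
    (hT : ∀ i, Measurable (T i)) (hC : ∀ i, Measurable (C i))
    (hTF : ∀ i, P.map (T i) = F) (hCG : ∀ i, P.map (C i) = G)
    (hTind : iIndepFun T P) (hCind : iIndepFun C P)
    (hTC : IndepFun (fun ω i => T i ω) (fun ω i => C i ω) P)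
    (h : ℝ≥0 → ℝ≥0 → Ω → ℝ)
    (hh : Censored.IsTwoTimePredictable (Censored.obsFiltration P T C hT hC) h)
    (hint : ∀ t, ∫⁻ ω, ∫⁻ p in Censored.domC t, ‖h p.1 p.2 ω‖ₑ
      ∂((Censored.dM F T C ω).variation.prod (Censored.dM F T C ω).variation) ∂P < ∞) :
    -- the recalled description of `M` and of `⟨M⟩`, which enters the second-moment condition
    (Censored.IsSquareIntegrableMartingale (Censored.obsFiltration P T C hT hC) P
        (Censored.pooledM F T C) ∧
      Censored.IsPredictableVariation (Censored.obsFiltration P T C hT hC) P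
        (Censored.pooledM F T C) (fun t ω => (Censored.varM F T C ω).real (Ioc 0 t))) ∧
    Martingale (Censored.doubleIntegral F T C h) (Censored.obsFiltration P T C hT hC) P ∧
    ((∀ t, ∫⁻ ω, ∫⁻ y in Ioc 0 t,
        (∫⁻ x in Ioo 0 y, ‖h x y ω‖ₑ ∂(Censored.dM F T C ω).variation) ^ 2
          ∂(Censored.varM F T C ω) ∂P < ∞) →
      Censored.IsSquareIntegrableMartingale (Censored.obsFiltration P T C hT hC) P
        (Censored.doubleIntegral F T C h) ∧
      Censored.IsPredictableVariation (Censored.obsFiltration P T C hT hC) P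
        (Censored.doubleIntegral F T C h) (Censored.doubleVariation F T C h)) := by
  have hgen := mainTheorem8_general P F hF T C hT hC hTF hTind hTC h hh hint
  refine ⟨hgen.1, hgen.2.1, fun hsq => hgen.2.2 fun t => lt_of_le_of_lt ?_ (hsq t)⟩
  gcongr with ω y
  exact Censored.enorm_setIntegral_lsmul_le_lintegral_enorm _ _ _
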